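/- Let $n\ge 2$ and let $M$ be an $n$-dimensional smooth manifold (possibly with boundary). Let $\Omega=d\alpha$ be an exact volume form on $M$, where $\alpha$ is an $(n-1)$-form of class $C^1$. Let $V=V(x,t)$ be a time-dependent vector field on $M$ with a complete $C^1$ flow $\varphi_{t_1,t_0}:M\to M$, that is, $\varphi_{t_1,t_0}(x)$ is jointly $C^1$ in $(t_1,t_0,x)$, $\varphi_{t,t}=\mathrm{id}$, $\varphi_{t,s}\circ\varphi_{s,r}=\varphi_{t,r}$ and $\frac{d}{dt}\varphi_{t,t_0}(x)=V(\varphi_{t,t_0}(x),t)$. Suppose that $V$ is globally Liouville: for each time $t$ there is an $(n-2)$-form $\beta_t$ of class $C^1$ on $M$ with $\imath_{V(\cdot,t)}\Omega=d\beta_t$. Fix such forms and let $\lambda_t=\imath_{V(\cdot,t)}\alpha+\beta_t$ be the Lagrangian form of $V$ at time $t$. Let $\mathcal A\subseteq M\times\mathbb R$ be invariant under the flow (if $(x,s)\in\mathcal A$ then $(\varphi_{t,s}(x),t)\in\mathcal A$ for all $t$), let $\Gamma_t=\{x\in M:(x,t)\in\mathcal A\}$ be its time-$t$ slice, so that $\Gamma_t=\varphi_{t,s}(\Gamma_s)$,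 and suppose that for one time (hence for every time) the slice is a compact oriented $(n-1)$-dimensional embedded $C^1$ submanifold of $M$ with (possibly empty) boundary. Give the slices the orientations transported by the flow and their boundaries $\partial\Gamma_t$ the induced orientations (outward vector first). Then for all $r,t\in\mathbb R$ the function $s\mapsto\int_{\partial\Gamma_s}\lambda_s$ is integrable between $r$ and $t$, and $$\int_{\Gamma_t}\alpha=\int_r^t\left(\int_{\partial\Gamma_s}\lambda_s\right)ds+\int_{\Gamma_r}\alpha .$$ -/

import Mathlib

open Set MeasureTheory Topology
open scoped Manifold ContDiff

noncomputable section

namespace ActionFlux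

section Forms

variable {E : Type*} [NormedAddCommGroup E] [NormedSpace ℝ E]
  {H : Type*} [TopologicalSpace H] (I : ModelWithCorners ℝ E H)
  {M : Type*} [TopologicalSpace M] [ChartedSpace H M]

/-- Differential forms of degree `m` on `M`, with no regularity imposed. -/
abbrev DiffForm (M : Type*) [TopologicalSpace M] [ChartedSpace H M] (m : ℕ) :=
  ∀ x : M, (TangentSpace I x) [⋀^Fin m]→L[ℝ] ℝ

/-- Vector fields on `M`, with no regularity imposed. -/
abbrev VField (M : Type*) [TopologicalSpace M] [ChartedSpace H M] :=
  ∀ x : M, TangentSpace I x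

variable {I}

/-- The expression of a form in the chart at `x₀`: its pullback under the inverse of that chart. -/
def chartRep {m : ℕ} (η : DiffForm I M m) (x₀ : M) : E → E [⋀^Fin m]→L[ℝ] ℝ :=
  fun u => (η ((extChartAt I x₀).symm u)).compContinuousLinearMap
    (mfderivWithin 𝓘(ℝ, E) I (extChartAt I x₀).symm (range I) u)

/-- A form is of class `C^r` if its expression in each chart of the manifold structure is. -/
def IsContDiffForm {m : ℕ} (r : ℕ∞) (η : DiffForm I M m) : Prop :=
  ∀ x₀ : M, ContDiffOn ℝ r (chartRep η x₀) (extChartAt I x₀).target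

/-- The exterior derivative, computed at `x` in the chart at `x`. -/
def dForm {m : ℕ} (η : DiffForm I M m) : DiffForm I M (m + 1) :=
  fun x => (extDerivWithin (chartRep η x) (range I) (extChartAt I x x)).compContinuousLinearMap
    (mfderiv I 𝓘(ℝ, E) (extChartAt I x) x)

/-- The interior product `η(V, ·, …, ·)`. -/
def interiorProd {m : ℕ} (V : VField I M) (η : DiffForm I M (m + 1)) : DiffForm I M m :=
  fun x => ContinuousAlternatingMap.curryLeft (𝕜 := ℝ) (E := E) (F := ℝ) (η x) (V x)

theorem interiorProd_apply {m : ℕ} (V : VField I M) (η : DiffForm I M (m + 1)) (x : M)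
    (v : Fin m → TangentSpace I x) : interiorProd V η x v = η x (Fin.cons (V x) v) := rfl

/-- The pullback of a form under a map. -/
def pullback {E' : Type*} [NormedAddCommGroup E'] [NormedSpace ℝ E']
    {H' : Type*} [TopologicalSpace H'] {J : ModelWithCorners ℝ E' H'}
    {N : Type*} [TopologicalSpace N] [ChartedSpace H' N] {m : ℕ}
    (f : N → M) (η : DiffForm I M m) : DiffForm J N m :=
  fun p => (η (f p)).compContinuousLinearMap (mfderiv J I f p)

/-- A volume form: a continuous form, nondegenerate at each point. (It is used for forms whose
degree is the dimension of the manifold, where nondegenerate means nonzero.) -/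
def IsVolumeForm {m : ℕ} (Ω : DiffForm I M m) : Prop :=
  IsContDiffForm 0 Ω ∧ ∀ x, Ω x ≠ 0

/-- `V` is globally Liouville with respect to `Ω`, with potential `β`: `i_V Ω = dβ`. -/
def IsLiouvillePotential {m : ℕ} (Ω : DiffForm I M (m + 2)) (V : VField I M)
    (β : DiffForm I M m) : Prop :=
  IsContDiffForm 1 β ∧ interiorProd V Ω = dForm β

/-- The Lagrangian form `λ = i_V α + β`. -/
def lagrangianForm {m : ℕ} (α : DiffForm I M (m + 1)) (V : VField I M) (β : DiffForm I M m) :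
    DiffForm I M m :=
  fun x => interiorProd V α x + β x

/-- `φ` is the complete `C^1` flow of the time-dependent vector field `V`: `φ t₁ t₀` maps the
position at time `t₀` of a trajectory of `V` to its position at time `t₁`. -/
structure IsFlow (V : ℝ → VField I M) (φ : ℝ → ℝ → M → M) : Prop where
  contMDiff : ContMDiff ((𝓘(ℝ, ℝ).prod 𝓘(ℝ, ℝ)).prod I) I 1
    (fun p : (ℝ × ℝ) × M => φ p.1.1 p.1.2 p.2)
  self : ∀ t x, φ t t x = x
  comp : ∀ t s r x, φ t s (φ s r x) = φ t r x
  hasMFDerivAt : ∀ t t₀ x, HasMFDerivAt 𝓘(ℝ, ℝ) I (fun s => φ s t₀ x) t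
    ((1 : ℝ →L[ℝ] ℝ).smulRight (V t (φ t t₀ x)))

/-- A subset of the extended phase space `M × ℝ` is invariant under the flow. -/
def IsFlowInvariant (φ : ℝ → ℝ → M → M) (A : Set (M × ℝ)) : Prop :=
  ∀ s t x, (x, s) ∈ A → (φ t s x, t) ∈ A

/-- The time-`t` slice of a subset of the extended phase space. -/
def slice (A : Set (M × ℝ)) (t : ℝ) : Set M := {x | (x, t) ∈ A}

theorem slice_eq_image {V : ℝ → VField I M} {φ : ℝ → ℝ → M → M} (hφ : IsFlow V φ)
    {A : Set (M × ℝ)} (hA : IsFlowInvariant φ A) (s t : ℝ) : slice A t = φ t s '' slice A s := by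
  ext x
  constructor
  · intro hx
    exact ⟨φ s t x, hA t s x hx, by rw [hφ.comp, hφ.self]⟩
  · rintro ⟨y, hy, rfl⟩
    exact hA s t y hy

theorem IsFlow.contMDiff_map {V : ℝ → VField I M} {φ : ℝ → ℝ → M → M} (hφ : IsFlow V φ)
    (t s : ℝ) : ContMDiff I I 1 (φ t s) := by
  have h : ContMDiff I ((𝓘(ℝ, ℝ).prod 𝓘(ℝ, ℝ)).prod I) 1 (fun x : M => ((t, s), x)) :=
    contMDiff_const.prodMk contMDiff_id
  exact hφ.contMDiff.comp h

theorem IsFlow.mfderiv_injective {V : ℝ → VField I M} {φ : ℝ → ℝ → M → M} (hφ : IsFlow V φ)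
    (t s : ℝ) (x : M) : Function.Injective (mfderiv I I (φ t s) x) := by
  have h1 : MDifferentiableAt I I (φ t s) x :=
    ((hφ.contMDiff_map t s).mdifferentiable one_ne_zero) x
  have h2 : MDifferentiableAt I I (φ s t) (φ t s x) :=
    ((hφ.contMDiff_map s t).mdifferentiable one_ne_zero) _
  have hid : φ s t ∘ φ t s = id := by
    funext y
    simp [hφ.comp, hφ.self]
  have h3 := mfderiv_comp x h2 h1
  rw [hid, mfderiv_id] at h3
  intro v w hvw
  have hv : v = mfderiv I I (φ s t) (φ t s x) (mfderiv I I (φ t s) x v) :=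
    congrArg (fun L : E →L[ℝ] E => L v) h3
  have hw : w = mfderiv I I (φ s t) (φ t s x) (mfderiv I I (φ t s) x w) :=
    congrArg (fun L : E →L[ℝ] E => L w) h3
  rw [hv, hw, hvw]

end Forms

section Integration

variable {k : ℕ} {N : Type*} [TopologicalSpace N] [ChartedSpace (EuclideanHalfSpace (k + 1)) N]

/-- A nowhere vanishing continuous form of top degree, which orients `N`. -/
def IsOrientationForm (μ : DiffForm (𝓡∂ (k + 1)) N (k + 1)) : Prop :=
  IsContDiffForm 0 μ ∧ ∀ p, μ p ≠ 0

/-- The coordinate vectors of `ℝ^(k+1)`. -/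
def coordVec (i : Fin (k + 1)) : EuclideanSpace ℝ (Fin (k + 1)) := EuclideanSpace.single i 1

/-- The sign, `1` or `-1`, of the coordinate frame of the chart at `p` with respect to the
orientation defined by `μ`, at the point with coordinates `u`. -/
def chartSign (μ : DiffForm (𝓡∂ (k + 1)) N (k + 1)) (p : N)
    (u : EuclideanSpace ℝ (Fin (k + 1))) : ℝ :=
  Real.sign (chartRep μ p u coordVec)

variable (k N) in
/-- A smooth partition of unity on `N` subordinate to the cover by the domains of the charts. -/
def chartPartition [CompactSpace N] [T2Space N] [IsManifold (𝓡∂ (k + 1)) ∞ N] :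
    SmoothPartitionOfUnity N (𝓡∂ (k + 1)) N univ :=
  (SmoothPartitionOfUnity.exists_isSubordinate_chartAt_source (𝓡∂ (k + 1)) N).choose

variable [CompactSpace N] [T2Space N] [IsManifold (𝓡∂ (k + 1)) ∞ N]

/-- The integral of a form of degree `k + 1` over the compact `(k + 1)`-dimensional manifold with
boundary `N`, oriented by `μ`. -/
def formIntegral (μ η : DiffForm (𝓡∂ (k + 1)) N (k + 1)) : ℝ :=
  ∑ᶠ p : N, ∫ v in {v : Fin (k + 1) → ℝ | WithLp.toLp 2 v ∈ (extChartAt (𝓡∂ (k + 1)) p).target},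
    chartPartition k N p ((extChartAt (𝓡∂ (k + 1)) p).symm (WithLp.toLp 2 v))
      * chartSign μ p (WithLp.toLp 2 v) * chartRep η p (WithLp.toLp 2 v) coordVec

/-- The point `(0, w)` of the boundary of the half space. -/
def boundaryPt (w : Fin k → ℝ) : EuclideanSpace ℝ (Fin (k + 1)) :=
  WithLp.toLp 2 (Fin.cons 0 w : Fin (k + 1) → ℝ)

/-- The integral of a form of degree `k` over the boundary of `N`. In the chart at `p`, the
boundary is `{u | u 0 = 0}` with coordinates `u 1, …, u k`, and the sign comes from the convention
that a frame of the boundary is positive if it is so for `μ` when preceded by an outward vector,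
here the opposite of the vector `coordVec 0`. If `k = 0`, this is a signed sum over points. -/
def boundaryFormIntegral (μ : DiffForm (𝓡∂ (k + 1)) N (k + 1)) (η : DiffForm (𝓡∂ (k + 1)) N k) :
    ℝ :=
  ∑ᶠ p : N, ∫ w in {w : Fin k → ℝ | boundaryPt w ∈ (extChartAt (𝓡∂ (k + 1)) p).target},
    chartPartition k N p ((extChartAt (𝓡∂ (k + 1)) p).symm (boundaryPt w))
      * (-chartSign μ p (boundaryPt w)) * chartRep η p (boundaryPt w) (fun i => coordVec i.succ)

end Integration

section Submanifolds

variable {E : Type*} [NormedAddCommGroup E] [NormedSpace ℝ E]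
  {H : Type*} [TopologicalSpace H] {I : ModelWithCorners ℝ E H}
  {M : Type*} [TopologicalSpace M] [ChartedSpace H M]
  {k : ℕ} {N : Type*} [TopologicalSpace N] [ChartedSpace (EuclideanHalfSpace (k + 1)) N]

variable (I k N M) in
/-- An oriented `(k + 1)`-dimensional `C^1` submanifold with boundary of `M`, presented as the
image of an injective `C^1` immersion of a manifold `N` with boundary. (It is used with `N`
compact, and then the immersion is an embedding.) -/
structure OrientedSubmanifold where
  /-- the immersion -/
  toFun : N → M
  contMDiff : ContMDiff (𝓡∂ (k + 1)) I 1 toFun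
  injective : Function.Injective toFun
  mfderiv_injective : ∀ p, Function.Injective (mfderiv (𝓡∂ (k + 1)) I toFun p)
  /-- the orientation -/
  orientation : DiffForm (𝓡∂ (k + 1)) N (k + 1)
  isOrientationForm : IsOrientationForm orientation

namespace OrientedSubmanifold

/-- The underlying subset of `M`. -/
def carrier (Γ : OrientedSubmanifold I M k N) : Set M := range Γ.toFun

/-- The submanifold into which the flow transports `Γ` from time `s` to time `t`, with the
transported orientation. -/
def evolve {V : ℝ → VField I M} {φ : ℝ → ℝ → M → M} (hφ : IsFlow V φ)
    (Γ : OrientedSubmanifold I M k N) (s t : ℝ) : OrientedSubmanifold I M k N where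
  toFun := φ t s ∘ Γ.toFun
  contMDiff := (hφ.contMDiff_map t s).comp Γ.contMDiff
  injective := by
    intro p q hpq
    apply Γ.injective
    have h := congrArg (φ s t) hpq
    simpa [hφ.comp, hφ.self] using h
  mfderiv_injective := by
    intro p
    rw [mfderiv_comp p ((hφ.contMDiff_map t s).mdifferentiable one_ne_zero _)
      (Γ.contMDiff.mdifferentiable one_ne_zero p)]
    exact (hφ.mfderiv_injective t s _).comp (Γ.mfderiv_injective p)
  orientation := Γ.orientation
  isOrientationForm := Γ.isOrientationForm

theorem carrier_evolve {V : ℝ → VField I M} {φ : ℝ → ℝ → M → M} (hφ : IsFlow V φ)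
    {A : Set (M × ℝ)} (hA : IsFlowInvariant φ A) {Γ : OrientedSubmanifold I M k N} {s : ℝ}
    (hΓ : Γ.carrier = slice A s) (t : ℝ) : (Γ.evolve hφ s t).carrier = slice A t := by
  rw [slice_eq_image hφ hA s t, ← hΓ]
  exact range_comp (φ t s) Γ.toFun

variable [CompactSpace N] [T2Space N] [IsManifold (𝓡∂ (k + 1)) ∞ N]

/-- The integral over `Γ` of a form on `M`. -/
def integral (Γ : OrientedSubmanifold I M k N) (η : DiffForm I M (k + 1)) : ℝ :=
  formIntegral Γ.orientation (pullback Γ.toFun η)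

/-- The integral over the boundary of `Γ` of a form on `M`. -/
def boundaryIntegral (Γ : OrientedSubmanifold I M k N) (η : DiffForm I M k) : ℝ :=
  boundaryFormIntegral Γ.orientation (pullback Γ.toFun η)

end OrientedSubmanifold

end Submanifolds

end ActionFlux

end

open ActionFlux

/-!
The action integral changes along the flow by Stokes' theorem on the flow tube. For an oriented
compact submanifold `f : N → M`, put `f_s = φ_{s,t₀} ∘ f` and let `F(s, x) = f_s(x)`. The contraction
of `F^* η` with the time direction is the form `f_s^* (i_V η)` on `N`, so that Stokes' theorem for
`F^* α` on `[r, t] × N` reads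
`∫_N f_t^* α - ∫_N f_r^* α = ∫_r^t (∫_N f_s^* (i_V dα) + ∫_{∂N} f_s^* (i_V α)) ds`.
Since `i_V dα = i_V Ω = dβ_s`, a second use of Stokes' theorem, on `N`, replaces the inner integral
over `N` by `∫_{∂N} f_s^* β_s`, and the two boundary terms add up to the integral of the Lagrangian
form.

The maps are only of class `C^1`, so that the pullbacks are merely continuous. Stokes' theorem is
therefore proved on boxes, in the form `∫ (g f^* dη + dg ∧ f^* η) = ∫_∂ g f^* η` with a test function
`g`, which makes sense for `C^1` maps `f` (`BoxStokes`). For smooth maps to a vector space it is the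
divergence theorem (`boxStokes_of_differentiableAt`). A `C^1` map on a convex body is a limit of
smooth maps together with its derivative, under averages which keep its values in a given convex set
(`exists_smooth_approximation`), and the identity passes to the limit (`boxStokes_pullback`). For
maps to a manifold it follows by localization, as the exterior derivative does not depend on the
chart (`chartRep_dForm`, `boxStokes_pullbackWithin`).

Integrals over `N` are defined by a partition of unity `χ_p` subordinate to the charts. In the chart
at `p` the test function is `χ_p` with the sign of the coordinates (`chartWeight`), on a box which
meets the boundary of the half space in one face. On this box Stokes' theorem gives the identity for
`β_s` (`formTerm_dForm_add`), and on its product with `[r, t]` the identity for `α`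
(`formTerm_sub_formTerm`); the latter also gives the integrability in time, as all its terms are
integrals of continuous functions. Both identities contain the terms `∫ dχ_p ∧ θ`. Their sum over `p`
is zero because `∑ χ_p = 1`; as each of them is taken in its own chart, this uses the change of
variables formula for the transitions between charts (`sum_chartIntegral_wedgeForm`).
-/


noncomputable section

namespace ActionFlux
/-! ### Approximation of `C^1` maps on convex bodies -/

section Smoothing

set_option linter.unusedSectionVars false

open Filter

variable {X : Type*} [NormedAddCommGroup X] [NormedSpace ℝ X] [FiniteDimensional ℝ X]
  [MeasurableSpace X] [BorelSpace X] {E : Type*} [NormedAddCommGroup E] [NormedSpace ℝ E]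

/-- The average of `F` over the points `(1 - ε) x + ε y`, where `y` has distribution `ν`. If `F` is
defined on a convex body and `ν` lives in its interior, then only values of `F` at interior points
are used, so that, in contrast with a convolution, no extension of `F` is needed. -/
def contractionAverage (ν : Measure X) (ε : ℝ) (F : X → E) (x : X) : E :=
  ∫ y, F ((1 - ε) • x + ε • y) ∂ν

/-- The probability measure with a smooth bump function as density. -/
def bumpMeasure (μ : Measure X) {c : X} (ρ : ContDiffBump c) : Measure X :=
  μ.withDensity fun y => ENNReal.ofReal (ρ.normed μ y)

variable {μ : Measure X} [μ.IsAddHaarMeasure] {c : X} (ρ : ContDiffBump c)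

theorem integral_bumpMeasure (F : X → E) :
    ∫ y, F y ∂bumpMeasure μ ρ = ∫ y, ρ.normed μ y • F y ∂μ := by
  rw [bumpMeasure, integral_withDensity_eq_integral_toReal_smul
    (ρ.continuous_normed.measurable.ennreal_ofReal) (by simp)]
  simp [ENNReal.toReal_ofReal (ρ.nonneg_normed _)]

instance : IsProbabilityMeasure (bumpMeasure μ ρ) := by
  constructor
  rw [bumpMeasure, withDensity_apply _ MeasurableSet.univ, Measure.restrict_univ,
    ← ofReal_integral_eq_lintegral_ofReal ρ.integrable_normed
      (Eventually.of_forall fun x => ρ.nonneg_normed x), ρ.integral_normed, ENNReal.ofReal_one]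

theorem ae_bumpMeasure : ∀ᵐ y ∂bumpMeasure μ ρ, y ∈ Metric.closedBall c ρ.rOut := by
  rw [bumpMeasure, ae_withDensity_iff (ρ.continuous_normed.measurable.ennreal_ofReal)]
  refine Eventually.of_forall fun y hy => ?_
  rw [← ρ.tsupport_normed_eq (μ := μ)]
  apply subset_tsupport
  intro h
  simp [h] at hy

theorem aestronglyMeasurable_contraction {Q : Set X} {F : X → E} (hF : ContinuousOn F Q) {ε : ℝ}
    {x : X} (hx : ∀ y ∈ Metric.closedBall c ρ.rOut, (1 - ε) • x + ε • y ∈ Q) :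
    AEStronglyMeasurable (fun y => F ((1 - ε) • x + ε • y)) (bumpMeasure μ ρ) := by
  have hc : IsCompact (Metric.closedBall c ρ.rOut) := isCompact_closedBall _ _
  have h2 : ContinuousOn (fun y => F ((1 - ε) • x + ε • y)) (Metric.closedBall c ρ.rOut) :=
    hF.comp (by fun_prop) hx
  have h3 := h2.aestronglyMeasurable_of_isCompact (μ := bumpMeasure μ ρ) hc hc.measurableSet
  rwa [Measure.restrict_eq_self_of_ae_mem (ae_bumpMeasure ρ)] at h3

variable {Q : Set X} (hQ : Convex ℝ Q) (hQc : IsCompact Q)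
  (hρ : Metric.closedBall c ρ.rOut ⊆ interior Q)
include hQ hQc hρ

theorem contraction_mem {ε : ℝ} (h0 : 0 < ε) (h1 : ε ≤ 1) {x : X} (hx : x ∈ Q) :
    ∀ y ∈ Metric.closedBall c ρ.rOut, (1 - ε) • x + ε • y ∈ Q := fun _ hy =>
  interior_subset (hQ.combo_self_interior_mem_interior hx (hρ hy) (by linarith) h0 (by ring))

theorem contractionAverage_mem {ε : ℝ} (h0 : 0 < ε) (h1 : ε ≤ 1) {x : X} (hx : x ∈ Q) :
    ∀ᵐ y ∂bumpMeasure μ ρ, (1 - ε) • x + ε • y ∈ interior Q := by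
  filter_upwards [ae_bumpMeasure (μ := μ) ρ] with y hy
  exact hQ.combo_self_interior_mem_interior hx (hρ hy) (by linarith) h0 (by ring)

theorem integrable_contraction {F : X → E} (hF : ContinuousOn F Q) {ε : ℝ}
    (h0 : 0 < ε) (h1 : ε ≤ 1) {x : X} (hx : x ∈ Q) :
    Integrable (fun y => F ((1 - ε) • x + ε • y)) (bumpMeasure μ ρ) := by
  obtain ⟨B, hB⟩ := hQc.exists_bound_of_continuousOn hF
  refine Integrable.of_bound (aestronglyMeasurable_contraction ρ hF (contraction_mem ρ hQ hQc hρ h0 h1 hx)) B ?_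
  filter_upwards [contractionAverage_mem ρ hQ hQc hρ h0 h1 hx] with y hy
  exact hB _ (interior_subset hy)

theorem norm_contractionAverage_le {F : X → E} {B : ℝ} (hB : ∀ x ∈ Q, ‖F x‖ ≤ B) {ε : ℝ}
    (h0 : 0 < ε) (h1 : ε ≤ 1) {x : X} (hx : x ∈ Q) :
    ‖contractionAverage (bumpMeasure μ ρ) ε F x‖ ≤ B := by
  have := norm_integral_le_of_norm_le_const (μ := bumpMeasure μ ρ)
    (f := fun y => F ((1 - ε) • x + ε • y)) (C := B) (by
      filter_upwards [contractionAverage_mem ρ hQ hQc hρ h0 h1 hx] with y hy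
      exact hB _ (interior_subset hy))
  simpa [contractionAverage] using this

theorem contractionAverage_mem_convex [CompleteSpace E] {F : X → E} (hF : ContinuousOn F Q)
    {C : Set E} (hC : Convex ℝ C) (hCc : IsClosed C) (hFC : MapsTo F Q C) {ε : ℝ}
    (h0 : 0 < ε) (h1 : ε ≤ 1) {x : X} (hx : x ∈ Q) :
    contractionAverage (bumpMeasure μ ρ) ε F x ∈ C := by
  refine hC.integral_mem hCc ?_ (integrable_contraction ρ hQ hQc hρ hF h0 h1 hx)
  filter_upwards [contractionAverage_mem ρ hQ hQc hρ h0 h1 hx] with y hy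
  exact hFC (interior_subset hy)

theorem tendsto_contractionAverage [CompleteSpace E] {F : X → E} (hF : ContinuousOn F Q)
    {ε : ℕ → ℝ} (h0 : ∀ j, 0 < ε j) (h1 : ∀ j, ε j ≤ 1) (hε : Tendsto ε atTop (𝓝 0))
    {x : X} (hx : x ∈ Q) :
    Tendsto (fun j => contractionAverage (bumpMeasure μ ρ) (ε j) F x) atTop (𝓝 (F x)) := by
  obtain ⟨B, hB⟩ := hQc.exists_bound_of_continuousOn hF
  have key := tendsto_integral_of_dominated_convergence (μ := bumpMeasure μ ρ)
    (F := fun j y => F ((1 - ε j) • x + ε j • y)) (f := fun _ => F x) (fun _ => B)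
    (fun j => aestronglyMeasurable_contraction ρ hF (contraction_mem ρ hQ hQc hρ (h0 j) (h1 j) hx))
    (integrable_const _)
    (fun j => by
      filter_upwards [contractionAverage_mem ρ hQ hQc hρ (h0 j) (h1 j) hx] with y hy
      exact hB _ (interior_subset hy))
    (by
      filter_upwards [ae_bumpMeasure (μ := μ) ρ] with y hy
      refine (hF x hx).tendsto.comp (tendsto_nhdsWithin_iff.2 ⟨?_, ?_⟩)
      · have : Tendsto (fun j => (1 - ε j) • x + ε j • y) atTop (𝓝 ((1 - 0 : ℝ) • x + (0 : ℝ) • y)) :=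
          ((tendsto_const_nhds.sub hε).smul_const x).add (hε.smul_const y)
        simpa using this
      · refine Eventually.of_forall fun j => interior_subset ?_
        exact hQ.combo_self_interior_mem_interior hx (hρ hy) (by linarith [h1 j]) (h0 j) (by ring))
  simpa [contractionAverage] using key

/-- As a function of `(1 - ε) x`, the average is a convolution with a smooth bump function. -/
theorem contDiff_contractionAverage {F : X → E} (hF : ContinuousOn F Q) {ε : ℝ} (h0 : 0 < ε) :
    ContDiff ℝ ∞ (contractionAverage (bumpMeasure μ ρ) ε (Q.indicator F)) := by
  set g : X → ℝ := fun t => ρ.normed μ ((-ε⁻¹) • t) with hg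
  have hne : (-ε⁻¹) ≠ 0 := by simp [h0.ne']
  have hgs : HasCompactSupport g := ρ.hasCompactSupport_normed.comp_smul hne
  have hgd : ContDiff ℝ ∞ g := ρ.contDiff_normed.comp (contDiff_const_smul _)
  have hint : LocallyIntegrable (Q.indicator F) μ :=
    ((hF.integrableOn_compact hQc).integrable_indicator hQc.measurableSet).locallyIntegrable
  have hconv := hgs.contDiff_convolution_left (ContinuousLinearMap.lsmul ℝ ℝ : ℝ →L[ℝ] E →L[ℝ] E)
    hgd hint
  have key : contractionAverage (bumpMeasure μ ρ) ε (Q.indicator F) = fun x =>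
      (|((-ε⁻¹) ^ Module.finrank ℝ X)⁻¹|)⁻¹ •
        (convolution g (Q.indicator F) (ContinuousLinearMap.lsmul ℝ ℝ : ℝ →L[ℝ] E →L[ℝ] E) μ)
          ((1 - ε) • x) := by
    funext x
    rw [contractionAverage, integral_bumpMeasure, convolution_def]
    have := Measure.integral_comp_smul μ
      (fun y => ρ.normed μ y • Q.indicator F ((1 - ε) • x + ε • y)) (-ε⁻¹)
    have h2 : ∀ t : X, (1 - ε) • x + ε • ((-ε⁻¹) • t) = (1 - ε) • x - t := by
      intro t
      rw [smul_smul, mul_neg, mul_inv_cancel₀ h0.ne', neg_one_smul, ← sub_eq_add_neg]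
    simp only [h2] at this
    simp only [ContinuousLinearMap.lsmul_apply, hg]
    rw [this, smul_smul, inv_mul_cancel₀ (by positivity), one_smul]
  rw [key]
  exact (hconv.comp (contDiff_const_smul _)).const_smul _

/-- The truncation of `F` outside `Q`, which makes it integrable on the whole space, does not change
its averages on `Q`. -/
theorem contractionAverage_indicator {F : X → E} {ε : ℝ} (h0 : 0 < ε) (h1 : ε ≤ 1) {x : X}
    (hx : x ∈ Q) : contractionAverage (bumpMeasure μ ρ) ε (Q.indicator F) x =
      contractionAverage (bumpMeasure μ ρ) ε F x := by
  refine integral_congr_ae ?_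
  filter_upwards [contractionAverage_mem ρ hQ hQc hρ h0 h1 hx] with y hy
  simp [interior_subset hy]

/-- The derivative of the average is, up to the factor `1 - ε`, the average of the derivative: the
points `(1 - ε) z + ε y` stay in the interior of `Q` for `z` near `x`, even if `x` is on the
boundary, so that one can differentiate under the integral. -/
theorem hasFDerivAt_contractionAverage [CompleteSpace E] {F : X → E} (hF : ContDiffOn ℝ 1 F Q)
    {ε : ℝ} (h0 : 0 < ε) (h1 : ε < 1) {r : ℝ} (hr : ρ.rOut < r)
    (hrQ : Metric.ball c r ⊆ interior Q) {x : X} (hx : x ∈ Q) :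
    HasFDerivAt (contractionAverage (bumpMeasure μ ρ) ε (Q.indicator F))
      ((1 - ε) • contractionAverage (bumpMeasure μ ρ) ε (fderivWithin ℝ F Q) x) x := by
  have hint : (interior Q).Nonempty :=
    ⟨c, hρ (Metric.mem_closedBall_self ρ.rOut_pos.le)⟩
  have hud : UniqueDiffOn ℝ Q := uniqueDiffOn_convex hQ hint
  have hF' : ContinuousOn (fderivWithin ℝ F Q) Q := hF.continuousOn_fderivWithin hud le_rfl
  obtain ⟨B, hB⟩ := hQc.exists_bound_of_continuousOn hF'
  have hδ : 0 < (r - ρ.rOut) * ε := mul_pos (sub_pos.2 hr) h0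
  have hmem : ∀ y ∈ Metric.closedBall c ρ.rOut, ∀ z ∈ Metric.ball x ((r - ρ.rOut) * ε),
      (1 - ε) • z + ε • y ∈ interior Q := by
    intro y hy z hz
    have : (1 - ε) • z + ε • y = (1 - ε) • x + ε • (y + ((1 - ε) / ε) • (z - x)) := by
      rw [smul_add, smul_smul, mul_div_cancel₀ _ h0.ne']
      module
    rw [this]
    refine hQ.combo_self_interior_mem_interior hx (hrQ ?_) (by linarith) h0 (by ring)
    rw [Metric.mem_ball, dist_eq_norm] at hz ⊢
    rw [Metric.mem_closedBall, dist_eq_norm] at hy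
    have h2 : ‖((1 - ε) / ε) • (z - x)‖ ≤ (1 / ε) * ‖z - x‖ := by
      rw [norm_smul]
      gcongr
      rw [Real.norm_of_nonneg (by apply div_nonneg <;> linarith)]
      gcongr
      linarith
    have h3 : (1 / ε) * ‖z - x‖ < r - ρ.rOut := by
      rw [one_div, inv_mul_lt_iff₀ h0]
      linarith
    calc ‖y + ((1 - ε) / ε) • (z - x) - c‖ = ‖(y - c) + ((1 - ε) / ε) • (z - x)‖ := by
          congr 1; abel
      _ ≤ ‖y - c‖ + ‖((1 - ε) / ε) • (z - x)‖ := norm_add_le _ _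
      _ < r := by linarith
  have hsm : ∀ z ∈ Metric.ball x ((r - ρ.rOut) * ε),
      AEStronglyMeasurable (fun y => (Q.indicator F) ((1 - ε) • z + ε • y))
        (bumpMeasure μ ρ) := by
    intro z hz
    have h2 := aestronglyMeasurable_contraction (μ := μ) ρ hF.continuousOn (ε := ε) (x := z)
      fun y hy => interior_subset (hmem y hy z hz)
    refine h2.congr ?_
    filter_upwards [ae_bumpMeasure (μ := μ) ρ] with y hy
    simp [interior_subset (hmem y hy z hz)]
  have hi : Integrable (fun y => (Q.indicator F) ((1 - ε) • x + ε • y)) (bumpMeasure μ ρ) := by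
    refine (integrable_contraction ρ hQ hQc hρ hF.continuousOn h0 h1.le hx).congr ?_
    filter_upwards [contractionAverage_mem ρ hQ hQc hρ h0 h1.le hx] with y hy
    simp [interior_subset hy]
  have hm' : AEStronglyMeasurable
      (fun y => (1 - ε) • fderivWithin ℝ F Q ((1 - ε) • x + ε • y)) (bumpMeasure μ ρ) := by
    have h2 : ContinuousOn (fun z => (1 - ε) • fderivWithin ℝ F Q z) Q :=
      hF'.const_smul (1 - ε)
    exact aestronglyMeasurable_contraction ρ h2 (contraction_mem ρ hQ hQc hρ h0 h1.le hx)
  have hb : ∀ y ∈ Metric.closedBall c ρ.rOut, ∀ z ∈ Metric.ball x ((r - ρ.rOut) * ε),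
      ‖(1 - ε) • fderivWithin ℝ F Q ((1 - ε) • z + ε • y)‖ ≤ B := by
    intro y hy z hz
    have h2 := hB _ (interior_subset (hmem y hy z hz))
    have h4 : ‖1 - ε‖ ≤ 1 := by
      rw [Real.norm_of_nonneg (by linarith)]
      linarith
    rw [norm_smul]
    calc ‖1 - ε‖ * ‖fderivWithin ℝ F Q ((1 - ε) • z + ε • y)‖
      _ ≤ 1 * B := mul_le_mul h4 h2 (norm_nonneg _) zero_le_one
      _ = B := one_mul B
  have hd : ∀ y ∈ Metric.closedBall c ρ.rOut, ∀ z ∈ Metric.ball x ((r - ρ.rOut) * ε),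
      HasFDerivAt (fun z => (Q.indicator F) ((1 - ε) • z + ε • y))
        ((1 - ε) • fderivWithin ℝ F Q ((1 - ε) • z + ε • y)) z := by
    intro y hy z hz
    have hm := hmem y hy z hz
    have hnhds : Q ∈ 𝓝 ((1 - ε) • z + ε • y) := mem_interior_iff_mem_nhds.1 hm
    have h2 : HasFDerivAt (Q.indicator F) (fderivWithin ℝ F Q ((1 - ε) • z + ε • y))
        ((1 - ε) • z + ε • y) := by
      have h3 := ((hF.differentiableOn one_ne_zero _
        (interior_subset hm)).hasFDerivWithinAt.hasFDerivAt hnhds)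
      refine h3.congr_of_eventuallyEq ?_
      filter_upwards [hnhds] with w hw
      exact indicator_of_mem hw F
    have hl : HasFDerivAt (fun z : X => (1 - ε) • z + ε • y)
        ((1 - ε) • ContinuousLinearMap.id ℝ X) z :=
      ((hasFDerivAt_id z).const_smul (1 - ε)).add_const _
    have h4 := h2.comp z hl
    rw [ContinuousLinearMap.comp_smul, ContinuousLinearMap.comp_id] at h4
    exact h4
  have key : HasFDerivAt
      (fun z => ∫ y, (Q.indicator F) ((1 - ε) • z + ε • y) ∂bumpMeasure μ ρ)
      (∫ y, (1 - ε) • fderivWithin ℝ F Q ((1 - ε) • x + ε • y) ∂bumpMeasure μ ρ) x := by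
    refine hasFDerivAt_integral_of_dominated_of_fderiv_le (bound := fun _ => B)
      (F' := fun z y => (1 - ε) • fderivWithin ℝ F Q ((1 - ε) • z + ε • y))
      (Metric.ball_mem_nhds x hδ) ?_ hi hm' ?_ (integrable_const B) ?_
    · filter_upwards [Metric.ball_mem_nhds x hδ] with z hz using hsm z hz
    · filter_upwards [ae_bumpMeasure (μ := μ) ρ] with y hy using hb y hy
    · filter_upwards [ae_bumpMeasure (μ := μ) ρ] with y hy using hd y hy
  have h5 : ∫ y, (1 - ε) • fderivWithin ℝ F Q ((1 - ε) • x + ε • y) ∂bumpMeasure μ ρ =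
      (1 - ε) • contractionAverage (bumpMeasure μ ρ) ε (fderivWithin ℝ F Q) x :=
    integral_smul _ _
  rw [h5] at key
  exact key

end Smoothing

/-- A `C^1` map on a compact convex body is a limit of smooth maps, with the derivatives, at
each point and with a uniform bound. The approximations are averages, so that they respect
closed convex constraints on the values. -/
theorem exists_smooth_approximation {X : Type*} [NormedAddCommGroup X] [NormedSpace ℝ X]
    [FiniteDimensional ℝ X] {E : Type*} [NormedAddCommGroup E] [NormedSpace ℝ E] [CompleteSpace E]
    {Q : Set X} (hQ : Convex ℝ Q) (hQc : IsCompact Q) (hint : (interior Q).Nonempty)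
    {F : X → E} (hF : ContDiffOn ℝ 1 F Q) {C : Set E} (hC : Convex ℝ C) (hCc : IsClosed C)
    (hFC : MapsTo F Q C) :
    ∃ f : ℕ → X → E, (∀ j, ContDiff ℝ ∞ (f j)) ∧ (∀ j, MapsTo (f j) Q C) ∧
      (∃ B, ∀ j, ∀ x ∈ Q, ‖fderiv ℝ (f j) x‖ ≤ B) ∧
      ∀ x ∈ Q, Filter.Tendsto (fun j => f j x) Filter.atTop (𝓝 (F x)) ∧
        Filter.Tendsto (fun j => fderiv ℝ (f j) x) Filter.atTop (𝓝 (fderivWithin ℝ F Q x)) := by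
  obtain ⟨c, hc⟩ := hint
  obtain ⟨r, hr, hrQ⟩ := Metric.isOpen_iff.1 isOpen_interior c hc
  let ρ : ContDiffBump c := ⟨r / 4, r / 2, by linarith, by linarith⟩
  let _ : MeasurableSpace X := borel X
  have _ : BorelSpace X := ⟨rfl⟩
  let μ : Measure X := Measure.addHaar
  have hρr : ρ.rOut < r := by change r / 2 < r; linarith
  have hρ : Metric.closedBall c ρ.rOut ⊆ interior Q :=
    (Metric.closedBall_subset_ball hρr).trans hrQ
  have hud : UniqueDiffOn ℝ Q := uniqueDiffOn_convex hQ ⟨c, hc⟩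
  have hF' : ContinuousOn (fderivWithin ℝ F Q) Q := hF.continuousOn_fderivWithin hud le_rfl
  obtain ⟨B, hB⟩ := hQc.exists_bound_of_continuousOn hF'
  let ε : ℕ → ℝ := fun j => 1 / ((j : ℝ) + 2)
  have h0 : ∀ j, 0 < ε j := fun j => by positivity
  have h1 : ∀ j, ε j < 1 := fun j => by
    rw [div_lt_one (by positivity)]
    have : (0 : ℝ) ≤ j := by positivity
    linarith
  have hε : Filter.Tendsto ε Filter.atTop (𝓝 0) := by
    have := (tendsto_one_div_add_atTop_nhds_zero_nat (𝕜 := ℝ)).comp (Filter.tendsto_add_atTop_nat 1)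
    refine this.congr fun j => ?_
    simp only [Function.comp, ε]
    push_cast
    ring_nf
  have hfd : ∀ j, ∀ x ∈ Q, fderiv ℝ (contractionAverage (bumpMeasure μ ρ) (ε j) (Q.indicator F)) x
      = (1 - ε j) • contractionAverage (bumpMeasure μ ρ) (ε j) (fderivWithin ℝ F Q) x :=
    fun j x hx => (hasFDerivAt_contractionAverage ρ hQ hQc hρ hF (h0 j) (h1 j) hρr hrQ hx).fderiv
  refine ⟨fun j => contractionAverage (bumpMeasure μ ρ) (ε j) (Q.indicator F),
    fun j => contDiff_contractionAverage ρ hQ hQc hρ hF.continuousOn (h0 j), ?_, ⟨B, ?_⟩, ?_⟩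
  · intro j x hx
    simp only
    rw [contractionAverage_indicator ρ hQ hQc hρ (h0 j) (h1 j).le hx]
    exact contractionAverage_mem_convex ρ hQ hQc hρ hF.continuousOn hC hCc hFC (h0 j) (h1 j).le hx
  · intro j x hx
    rw [hfd j x hx, norm_smul, Real.norm_of_nonneg (by linarith [h1 j])]
    have h2 := norm_contractionAverage_le (μ := μ) ρ hQ hQc hρ hB (h0 j) (h1 j).le hx
    have h3 := norm_nonneg (contractionAverage (bumpMeasure μ ρ) (ε j) (fderivWithin ℝ F Q) x)
    nlinarith [h0 j, h1 j]
  · intro x hx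
    constructor
    · refine (tendsto_contractionAverage (μ := μ) ρ hQ hQc hρ hF.continuousOn h0
        (fun j => (h1 j).le) hε hx).congr fun j => ?_
      beta_reduce
      rw [contractionAverage_indicator ρ hQ hQc hρ (h0 j) (h1 j).le hx]
    · have h2 := (tendsto_const_nhds (x := (1 : ℝ))).sub hε |>.smul
        (tendsto_contractionAverage (μ := μ) ρ hQ hQc hρ hF' h0 (fun j => (h1 j).le) hε hx)
      simp only [sub_zero, one_smul] at h2
      exact h2.congr fun j => (hfd j x hx).symm

/-! ### The wedge product by a covector -/

section WedgeOne

variable {X : Type*} [NormedAddCommGroup X] [NormedSpace ℝ X] {n : ℕ}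

/-- The wedge product of a covector and an `n`-form. -/
def wedgeOne (L : X →L[ℝ] ℝ) (θ : X [⋀^Fin n]→L[ℝ] ℝ) : X [⋀^Fin (n + 1)]→L[ℝ] ℝ :=
  .alternatizeUncurryFin (L.smulRight θ)

theorem wedgeOne_apply (L : X →L[ℝ] ℝ) (θ : X [⋀^Fin n]→L[ℝ] ℝ) (v : Fin (n + 1) → X) :
    wedgeOne L θ v = ∑ i : Fin (n + 1), (-1) ^ (i : ℕ) * (L (v i) * θ (i.removeNth v)) := by
  simp [wedgeOne, ContinuousAlternatingMap.alternatizeUncurryFin_apply]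

theorem wedgeOne_add (L L' : X →L[ℝ] ℝ) (θ : X [⋀^Fin n]→L[ℝ] ℝ) :
    wedgeOne (L + L') θ = wedgeOne L θ + wedgeOne L' θ := by
  ext v
  simp [wedgeOne_apply, add_mul, mul_add, Finset.sum_add_distrib]

theorem wedgeOne_zero (θ : X [⋀^Fin n]→L[ℝ] ℝ) : wedgeOne 0 θ = 0 := by
  ext v
  simp [wedgeOne_apply]

theorem wedgeOne_smul (c : ℝ) (L : X →L[ℝ] ℝ) (θ : X [⋀^Fin n]→L[ℝ] ℝ) :
    wedgeOne (c • L) θ = c • wedgeOne L θ := by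
  ext v
  simp only [wedgeOne_apply, smul_apply, ContinuousAlternatingMap.smul_apply,
    smul_eq_mul, Finset.mul_sum]
  exact Finset.sum_congr rfl fun i _ => by ring

theorem wedgeOne_compContinuousLinearMap {Y : Type*} [NormedAddCommGroup Y] [NormedSpace ℝ Y]
    (L : X →L[ℝ] ℝ) (θ : X [⋀^Fin n]→L[ℝ] ℝ) (f : Y →L[ℝ] X) :
    (wedgeOne L θ).compContinuousLinearMap f =
      wedgeOne (L.comp f) (θ.compContinuousLinearMap f) := by
  ext v
  simp only [ContinuousAlternatingMap.compContinuousLinearMap_apply, wedgeOne_apply]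
  rfl

theorem ContinuousOn.wedgeOne {T : Type*} [TopologicalSpace T] {s : Set T}
    {L : T → X →L[ℝ] ℝ} {θ : T → X [⋀^Fin n]→L[ℝ] ℝ} (hL : ContinuousOn L s)
    (hθ : ContinuousOn θ s) : ContinuousOn (fun t => wedgeOne (L t) (θ t)) s := by
  have h1 : ContinuousOn (fun t => (L t).smulRight (θ t)) s :=
    ((ContinuousLinearMap.smulRightL ℝ X (X [⋀^Fin n]→L[ℝ] ℝ)).continuous₂).comp_continuousOn
      (hL.prodMk hθ)
  exact (ContinuousAlternatingMap.alternatizeUncurryFinCLM ℝ X ℝ).continuous.comp_continuousOn h1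

/-- The pullback of a form by a linear map is jointly continuous in the form and the map. -/
theorem continuous_compContinuousLinearMap {Y : Type*} [NormedAddCommGroup Y] [NormedSpace ℝ Y]
    {n : ℕ} : Continuous (fun fg : (X [⋀^Fin n]→L[ℝ] ℝ) × (Y →L[ℝ] X) =>
      fg.1.compContinuousLinearMap fg.2) :=
  continuous_iff_continuousAt.2 fun fg =>
    (ContinuousAlternatingMap.hasStrictFDerivAt_compContinuousLinearMap (𝕜 := ℝ)
      fg).hasFDerivAt.continuousAt

theorem continuous_apply_form {T : Type*} [TopologicalSpace T] {s : Set T}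
    {θ : T → X [⋀^Fin n]→L[ℝ] ℝ} (hθ : ContinuousOn θ s) (v : Fin n → X) :
    ContinuousOn (fun t => θ t v) s :=
  (ContinuousAlternatingMap.apply ℝ X ℝ v).continuous.comp_continuousOn hθ

end WedgeOne

/-! ### Stokes' theorem on a box, for `C^1` maps to a vector space -/

section BoxStokes

variable {n : ℕ}

/-- The coordinate vectors of `ℝ^n`. -/
def stdVec (n : ℕ) : Fin n → Fin n → ℝ := fun i => Pi.single i 1

/-- The integral of `g θ` over the boundary of the box `[a, b]`, oriented by outward vectors. -/
def boxBoundary (a b : Fin (n + 1) → ℝ) (g : (Fin (n + 1) → ℝ) → ℝ)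
    (θ : (Fin (n + 1) → ℝ) → (Fin (n + 1) → ℝ) [⋀^Fin n]→L[ℝ] ℝ) : ℝ :=
  ∑ i : Fin (n + 1),
    ((∫ w in Icc (a ∘ i.succAbove) (b ∘ i.succAbove), (-1) ^ (i : ℕ) *
        (g (i.insertNth (b i) w) * θ (i.insertNth (b i) w) (i.removeNth (stdVec (n + 1))))) -
      ∫ w in Icc (a ∘ i.succAbove) (b ∘ i.succAbove), (-1) ^ (i : ℕ) *
        (g (i.insertNth (a i) w) * θ (i.insertNth (a i) w) (i.removeNth (stdVec (n + 1)))))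

/-- Stokes' theorem on the box `[a, b]` for `g θ`, where `dθ` plays the role of the exterior
derivative of `θ`: the integral of `g dθ + dg ∧ θ` over the box is that of `g θ` over its
boundary. -/
def BoxStokes (a b : Fin (n + 1) → ℝ) (g : (Fin (n + 1) → ℝ) → ℝ)
    (θ : (Fin (n + 1) → ℝ) → (Fin (n + 1) → ℝ) [⋀^Fin n]→L[ℝ] ℝ)
    (dθ : (Fin (n + 1) → ℝ) → (Fin (n + 1) → ℝ) [⋀^Fin (n + 1)]→L[ℝ] ℝ) : Prop :=
  ∫ x in Icc a b, (g x * dθ x (stdVec (n + 1)) +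
    wedgeOne (fderivWithin ℝ g (Icc a b) x) (θ x) (stdVec (n + 1))) = boxBoundary a b g θ

variable {a b : Fin (n + 1) → ℝ}

theorem interior_Icc_pi {m : ℕ} (a b : Fin m → ℝ) :
    interior (Icc a b) = pi univ fun i => Ioo (a i) (b i) := by
  rw [← pi_univ_Icc, interior_pi_set finite_univ]
  simp

theorem interior_Icc_nonempty {m : ℕ} {a b : Fin m → ℝ} (hab : ∀ i, a i < b i) :
    (interior (Icc a b)).Nonempty := by
  rw [interior_Icc_pi, univ_pi_nonempty_iff]
  exact fun i => nonempty_Ioo.2 (hab i)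

theorem uniqueDiffOn_Icc_pi {m : ℕ} {a b : Fin m → ℝ} (hab : ∀ i, a i < b i) :
    UniqueDiffOn ℝ (Icc a b) :=
  uniqueDiffOn_convex (convex_Icc a b) (interior_Icc_nonempty hab)

theorem insertNth_mem_Icc {i : Fin (n + 1)} {c : ℝ} (hc : c ∈ Icc (a i) (b i)) {w : Fin n → ℝ}
    (hw : w ∈ Icc (a ∘ i.succAbove) (b ∘ i.succAbove)) :
    (i.insertNth c w : Fin (n + 1) → ℝ) ∈ Icc a b := by
  rw [Fin.insertNth_mem_Icc]
  exact ⟨hc, hw⟩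

theorem continuous_insertNth_const (i : Fin (n + 1)) (c : ℝ) :
    Continuous fun w : Fin n → ℝ => (i.insertNth c w : Fin (n + 1) → ℝ) :=
  continuous_const.finInsertNth i continuous_id

theorem continuousOn_face {F : (Fin (n + 1) → ℝ) → ℝ} (hF : ContinuousOn F (Icc a b))
    {i : Fin (n + 1)} {c : ℝ} (hc : c ∈ Icc (a i) (b i)) :
    ContinuousOn (fun w : Fin n → ℝ => F (i.insertNth c w))
      (Icc (a ∘ i.succAbove) (b ∘ i.succAbove)) :=
  hF.comp (continuous_insertNth_const i c).continuousOn fun _ hw => insertNth_mem_Icc hc hw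

theorem continuousOn_boxStokes_integrand (hab : ∀ i, a i < b i) {g : (Fin (n + 1) → ℝ) → ℝ}
    {θ : (Fin (n + 1) → ℝ) → (Fin (n + 1) → ℝ) [⋀^Fin n]→L[ℝ] ℝ}
    {dθ : (Fin (n + 1) → ℝ) → (Fin (n + 1) → ℝ) [⋀^Fin (n + 1)]→L[ℝ] ℝ}
    (hg : ContDiffOn ℝ 1 g (Icc a b)) (hθ : ContinuousOn θ (Icc a b))
    (hdθ : ContinuousOn dθ (Icc a b)) :
    ContinuousOn (fun x => g x * dθ x (stdVec (n + 1)) +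
      wedgeOne (fderivWithin ℝ g (Icc a b) x) (θ x) (stdVec (n + 1))) (Icc a b) :=
  (hg.continuousOn.mul (continuous_apply_form hdθ _)).add
    (continuous_apply_form ((hg.continuousOn_fderivWithin (uniqueDiffOn_Icc_pi hab)
      le_rfl).wedgeOne hθ) _)

/-- Stokes' theorem on a box, for a form which is differentiable inside. -/
theorem boxStokes_of_differentiableAt (hab : ∀ i, a i < b i) {g : (Fin (n + 1) → ℝ) → ℝ}
    {θ : (Fin (n + 1) → ℝ) → (Fin (n + 1) → ℝ) [⋀^Fin n]→L[ℝ] ℝ}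
    {dθ : (Fin (n + 1) → ℝ) → (Fin (n + 1) → ℝ) [⋀^Fin (n + 1)]→L[ℝ] ℝ}
    (hg : ContDiffOn ℝ 1 g (Icc a b)) (hθ : ContinuousOn θ (Icc a b))
    (hdθ : ContinuousOn dθ (Icc a b))
    (hd : ∀ x ∈ interior (Icc a b), DifferentiableAt ℝ θ x ∧ extDeriv θ x = dθ x) :
    BoxStokes a b g θ dθ := by
  have hle : a ≤ b := fun i => (hab i).le
  have hDae : ∀ᵐ x ∂(volume.restrict (Icc a b)), x ∈ interior (Icc a b) := by
    rw [interior_Icc_pi]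
    have h1 := Measure.univ_pi_Ioo_ae_eq_Icc (μ := fun _ : Fin (n + 1) => (volume : Measure ℝ))
      (f := a) (g := b)
    have h2 : (volume.restrict (Icc a b) : Measure (Fin (n + 1) → ℝ)) =
        volume.restrict (pi univ fun i => Ioo (a i) (b i)) := (Measure.restrict_congr_set h1).symm
    rw [h2]
    exact ae_restrict_mem (MeasurableSet.univ_pi fun i => measurableSet_Ioo)
  set f : Fin (n + 1) → (Fin (n + 1) → ℝ) → ℝ := fun i x =>
    (-1) ^ (i : ℕ) * (g x * θ x (i.removeNth (stdVec (n + 1)))) with hf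
  set f' : Fin (n + 1) → (Fin (n + 1) → ℝ) → (Fin (n + 1) → ℝ) →L[ℝ] ℝ := fun i x =>
    ((-1 : ℝ) ^ (i : ℕ)) • (g x • fderiv ℝ (fun y => θ y (i.removeNth (stdVec (n + 1)))) x +
      θ x (i.removeNth (stdVec (n + 1))) • fderivWithin ℝ g (Icc a b) x) with hf'
  -- the divergence of `f` is the coefficient of `d(g θ) = g dθ + dg ∧ θ`
  have hdiv : ∀ x ∈ interior (Icc a b), ∑ i, f' i x (Pi.single i 1) =
      g x * dθ x (stdVec (n + 1)) +
        wedgeOne (fderivWithin ℝ g (Icc a b) x) (θ x) (stdVec (n + 1)) := by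
    intro x hx
    rw [← (hd x hx).2, extDeriv_apply (hd x hx).1, wedgeOne_apply, Finset.mul_sum,
      ← Finset.sum_add_distrib]
    refine Finset.sum_congr rfl fun i _ => ?_
    simp only [hf', stdVec, smul_apply, add_apply,
      smul_eq_mul, zsmul_eq_mul, Int.cast_pow, Int.cast_neg, Int.cast_one]
    ring
  have hcont := continuousOn_boxStokes_integrand hab hg hθ hdθ
  have key := integral_divergence_of_hasFDerivAt_off_countable' a b hle f f' ∅ countable_empty
    (fun i => continuousOn_const.mul (hg.continuousOn.mul (continuous_apply_form hθ _)))
    (by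
      rintro x ⟨hx, -⟩ i
      rw [← interior_Icc_pi] at hx
      have hgx : HasFDerivAt g (fderivWithin ℝ g (Icc a b) x) x :=
        (hg.differentiableOn one_ne_zero x (interior_subset hx)).hasFDerivWithinAt.hasFDerivAt
          (mem_interior_iff_mem_nhds.1 hx)
      have hθx : HasFDerivAt (fun y => θ y (i.removeNth (stdVec (n + 1))))
          (fderiv ℝ (fun y => θ y (i.removeNth (stdVec (n + 1)))) x) x :=
        ((ContinuousAlternatingMap.apply ℝ (Fin (n + 1) → ℝ) ℝ
          (i.removeNth (stdVec (n + 1)))).differentiableAt.comp x (hd x hx).1).hasFDerivAt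
      exact (hgx.mul hθx).const_mul _)
    ((hcont.integrableOn_compact isCompact_Icc).congr
      (hDae.mono fun x hx => (hdiv x hx).symm))
  rw [BoxStokes, boxBoundary, ← key]
  exact integral_congr_ae (hDae.mono fun x hx => (hdiv x hx).symm)

/-- The conclusion of Stokes' theorem passes to pointwise bounded limits. -/
theorem BoxStokes.of_tendsto (hab : ∀ i, a i < b i) {g : (Fin (n + 1) → ℝ) → ℝ}
    {θ : (Fin (n + 1) → ℝ) → (Fin (n + 1) → ℝ) [⋀^Fin n]→L[ℝ] ℝ}
    {dθ : (Fin (n + 1) → ℝ) → (Fin (n + 1) → ℝ) [⋀^Fin (n + 1)]→L[ℝ] ℝ}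
    {θs : ℕ → (Fin (n + 1) → ℝ) → (Fin (n + 1) → ℝ) [⋀^Fin n]→L[ℝ] ℝ}
    {dθs : ℕ → (Fin (n + 1) → ℝ) → (Fin (n + 1) → ℝ) [⋀^Fin (n + 1)]→L[ℝ] ℝ}
    (hg : ContDiffOn ℝ 1 g (Icc a b)) (hθ : ∀ j, ContinuousOn (θs j) (Icc a b))
    (hdθ : ∀ j, ContinuousOn (dθs j) (Icc a b))
    (h : ∀ j, BoxStokes a b g (θs j) (dθs j)) {B : ℝ}
    (hBθ : ∀ j, ∀ x ∈ Icc a b, ‖θs j x‖ ≤ B) (hBdθ : ∀ j, ∀ x ∈ Icc a b, ‖dθs j x‖ ≤ B)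
    (htθ : ∀ x ∈ Icc a b, Filter.Tendsto (fun j => θs j x) Filter.atTop (𝓝 (θ x)))
    (htdθ : ∀ x ∈ Icc a b, Filter.Tendsto (fun j => dθs j x) Filter.atTop (𝓝 (dθ x))) :
    BoxStokes a b g θ dθ := by
  have hg' : ContinuousOn (fderivWithin ℝ g (Icc a b)) (Icc a b) :=
    hg.continuousOn_fderivWithin (uniqueDiffOn_Icc_pi hab) le_rfl
  obtain ⟨A, hA⟩ := isCompact_Icc.exists_bound_of_continuousOn hg.continuousOn
  obtain ⟨A', hA'⟩ := isCompact_Icc.exists_bound_of_continuousOn hg'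
  have hstd : ∀ (m : ℕ) (i : Fin m), ‖stdVec m i‖ ≤ 1 := fun m i => by
    rw [stdVec, Pi.norm_single, norm_one]
  have hB0 : 0 ≤ B := (norm_nonneg _).trans (hBθ 0 a (left_mem_Icc.2 fun i => (hab i).le))
  have hev : ∀ {m : ℕ} (η : (Fin (n + 1) → ℝ) [⋀^Fin m]→L[ℝ] ℝ) (v : Fin m → Fin (n + 1) → ℝ),
      (∀ i, ‖v i‖ ≤ 1) → ‖η‖ ≤ B → ‖η v‖ ≤ B := by
    intro m η v hv hη
    calc ‖η v‖ ≤ ‖η‖ * ∏ i, ‖v i‖ := η.le_opNorm v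
      _ ≤ B * 1 := mul_le_mul hη (Finset.prod_le_one (fun i _ => norm_nonneg _)
          fun i _ => hv i) (Finset.prod_nonneg fun i _ => norm_nonneg _) hB0
      _ = B := mul_one B
  have hleft : Filter.Tendsto (fun j => ∫ x in Icc a b, (g x * dθs j x (stdVec (n + 1)) +
      wedgeOne (fderivWithin ℝ g (Icc a b) x) (θs j x) (stdVec (n + 1)))) Filter.atTop
      (𝓝 (∫ x in Icc a b, (g x * dθ x (stdVec (n + 1)) +
        wedgeOne (fderivWithin ℝ g (Icc a b) x) (θ x) (stdVec (n + 1))))) := by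
    refine tendsto_integral_of_dominated_convergence (fun _ => A * B + (n + 1) * (A' * B)) ?_ ?_ ?_ ?_
    · exact fun j => (continuousOn_boxStokes_integrand hab hg (hθ j)
        (hdθ j)).aestronglyMeasurable measurableSet_Icc
    · exact continuousOn_const.integrableOn_compact isCompact_Icc
    · intro j
      filter_upwards [ae_restrict_mem measurableSet_Icc] with x hx
      have h1 : ‖g x * dθs j x (stdVec (n + 1))‖ ≤ A * B := by
        rw [norm_mul]
        exact mul_le_mul (hA x hx) (hev _ _ (hstd _) (hBdθ j x hx)) (norm_nonneg _)
          ((norm_nonneg _).trans (hA x hx))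
      have h2 : ‖wedgeOne (fderivWithin ℝ g (Icc a b) x) (θs j x) (stdVec (n + 1))‖ ≤
          (n + 1) * (A' * B) := by
        rw [wedgeOne_apply]
        refine (norm_sum_le _ _).trans ?_
        have h3 : ∀ i ∈ (Finset.univ : Finset (Fin (n + 1))),
            ‖(-1 : ℝ) ^ (i : ℕ) * (fderivWithin ℝ g (Icc a b) x (stdVec (n + 1) i) *
              θs j x (i.removeNth (stdVec (n + 1))))‖ ≤ A' * B := by
          intro i _
          rw [norm_mul, norm_pow, norm_neg, norm_one, one_pow, one_mul, norm_mul]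
          refine mul_le_mul ?_ (hev _ _ (fun l => hstd _ _) (hBθ j x hx)) (norm_nonneg _)
            ((norm_nonneg _).trans (hA' x hx))
          calc _ ≤ ‖fderivWithin ℝ g (Icc a b) x‖ * ‖stdVec (n + 1) i‖ :=
                ContinuousLinearMap.le_opNorm _ _
            _ ≤ A' * 1 := mul_le_mul (hA' x hx) (hstd _ _) (norm_nonneg _)
                ((norm_nonneg _).trans (hA' x hx))
            _ = A' := mul_one _
        refine (Finset.sum_le_card_nsmul _ _ _ h3).trans_eq ?_
        simp
      exact (norm_add_le _ _).trans (add_le_add h1 h2)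
    · filter_upwards [ae_restrict_mem measurableSet_Icc] with x hx
      refine Filter.Tendsto.add ?_ ?_
      · exact (((ContinuousAlternatingMap.apply ℝ (Fin (n + 1) → ℝ) ℝ
          (stdVec (n + 1))).continuous.tendsto _).comp (htdθ x hx)).const_mul _
      · simp only [wedgeOne_apply]
        refine tendsto_finsetSum _ fun i _ => ?_
        exact ((((ContinuousAlternatingMap.apply ℝ (Fin (n + 1) → ℝ) ℝ
          (i.removeNth (stdVec (n + 1)))).continuous.tendsto _).comp
            (htθ x hx)).const_mul _).const_mul _
  have hface : ∀ (i : Fin (n + 1)) (c : ℝ), c ∈ Icc (a i) (b i) → Filter.Tendsto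
      (fun j => ∫ w in Icc (a ∘ i.succAbove) (b ∘ i.succAbove), (-1) ^ (i : ℕ) *
        (g (i.insertNth c w) * θs j (i.insertNth c w) (i.removeNth (stdVec (n + 1)))))
      Filter.atTop (𝓝 (∫ w in Icc (a ∘ i.succAbove) (b ∘ i.succAbove), (-1) ^ (i : ℕ) *
        (g (i.insertNth c w) * θ (i.insertNth c w) (i.removeNth (stdVec (n + 1)))))) := by
    intro i c hc
    refine tendsto_integral_of_dominated_convergence (fun _ => A * B) ?_ ?_ ?_ ?_
    · exact fun j => (continuousOn_const.mul (continuousOn_face (F := fun x => g x *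
        θs j x (i.removeNth (stdVec (n + 1)))) (hg.continuousOn.mul
          (continuous_apply_form (hθ j) _)) hc)).aestronglyMeasurable measurableSet_Icc
    · exact continuousOn_const.integrableOn_compact isCompact_Icc
    · intro j
      filter_upwards [ae_restrict_mem measurableSet_Icc] with w hw
      have hx := insertNth_mem_Icc hc hw
      rw [norm_mul, norm_pow, norm_neg, norm_one, one_pow, one_mul, norm_mul]
      exact mul_le_mul (hA _ hx) (hev _ _ (fun l => hstd _ _) (hBθ j _ hx)) (norm_nonneg _)
        ((norm_nonneg _).trans (hA _ hx))
    · filter_upwards [ae_restrict_mem measurableSet_Icc] with w hw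
      exact ((((ContinuousAlternatingMap.apply ℝ (Fin (n + 1) → ℝ) ℝ
          (i.removeNth (stdVec (n + 1)))).continuous.tendsto _).comp
            (htθ _ (insertNth_mem_Icc hc hw))).const_mul _).const_mul _
  have hright : Filter.Tendsto (fun j => boxBoundary a b g (θs j)) Filter.atTop
      (𝓝 (boxBoundary a b g θ)) := by
    refine tendsto_finsetSum _ fun i _ => ?_
    exact (hface i (b i) (right_mem_Icc.2 (hab i).le)).sub
      (hface i (a i) (left_mem_Icc.2 (hab i).le))
  exact tendsto_nhds_unique (hleft.congr fun j => h j) hright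

/-- Stokes' theorem on a box for the pullback of a `C^1` form under a map which is only `C^1`. The
pullback then is merely continuous, and the theorem holds because it holds for smooth maps. -/
theorem boxStokes_pullback {E : Type*} [NormedAddCommGroup E] [NormedSpace ℝ E]
    [FiniteDimensional ℝ E] (hab : ∀ i, a i < b i) {g : (Fin (n + 1) → ℝ) → ℝ}
    (hg : ContDiffOn ℝ 1 g (Icc a b)) {C S : Set E} (hC : Convex ℝ C) (hCc : IsCompact C)
    (hCS : C ⊆ S) {η : E → E [⋀^Fin n]→L[ℝ] ℝ} (hη : ∀ y ∈ C, DifferentiableWithinAt ℝ η S y)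
    (hη' : ContinuousOn (extDerivWithin η S) C) {f : (Fin (n + 1) → ℝ) → E}
    (hf : ContDiffOn ℝ 1 f (Icc a b)) (hfC : MapsTo f (Icc a b) C) :
    BoxStokes a b g
      (fun x => (η (f x)).compContinuousLinearMap (fderivWithin ℝ f (Icc a b) x))
      (fun x => (extDerivWithin η S (f x)).compContinuousLinearMap
        (fderivWithin ℝ f (Icc a b) x)) := by
  obtain ⟨F, hF, hFC, ⟨D, hD⟩, hlim⟩ := exists_smooth_approximation (convex_Icc a b) isCompact_Icc
    (interior_Icc_nonempty hab) hf hC hCc.isClosed hfC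
  have hηc : ContinuousOn η C := fun y hy => (hη y hy).continuousWithinAt.mono hCS
  obtain ⟨A, hA⟩ := hCc.exists_bound_of_continuousOn hηc
  obtain ⟨A', hA'⟩ := hCc.exists_bound_of_continuousOn hη'
  have hcont : ∀ {m : ℕ} {ζ : E → E [⋀^Fin m]→L[ℝ] ℝ}, ContinuousOn ζ C → ∀ j,
      ContinuousOn (fun x => (ζ (F j x)).compContinuousLinearMap (fderiv ℝ (F j) x)) (Icc a b) := by
    intro m ζ hζ j
    refine continuous_compContinuousLinearMap.comp_continuousOn
      ((hζ.comp (hF j).continuous.continuousOn (hFC j)).prodMk ?_)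
    exact ((hF j).continuous_fderiv (by simp)).continuousOn
  have hbd : ∀ {m : ℕ} {ζ : E → E [⋀^Fin m]→L[ℝ] ℝ} {K : ℝ}, (∀ y ∈ C, ‖ζ y‖ ≤ K) → ∀ j,
      ∀ x ∈ Icc a b, ‖(ζ (F j x)).compContinuousLinearMap (fderiv ℝ (F j) x)‖ ≤ K * D ^ m := by
    intro m ζ K hK j x hx
    have h1 := (ζ (F j x)).norm_compContinuousLinearMap_le (fderiv ℝ (F j) x)
    rw [Fintype.card_fin] at h1
    have h2 := hK _ (hFC j hx)
    exact h1.trans (mul_le_mul h2 (pow_le_pow_left₀ (norm_nonneg _) (hD j x hx) m)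
      (by positivity) ((norm_nonneg _).trans h2))
  have hlim' : ∀ {m : ℕ} {ζ : E → E [⋀^Fin m]→L[ℝ] ℝ}, ContinuousOn ζ C → ∀ x ∈ Icc a b,
      Filter.Tendsto (fun j => (ζ (F j x)).compContinuousLinearMap (fderiv ℝ (F j) x)) Filter.atTop
        (𝓝 ((ζ (f x)).compContinuousLinearMap (fderivWithin ℝ f (Icc a b) x))) := by
    intro m ζ hζ x hx
    refine (continuous_compContinuousLinearMap.tendsto
      (ζ (f x), fderivWithin ℝ f (Icc a b) x)).comp (Filter.Tendsto.prodMk_nhds ?_ (hlim x hx).2)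
    exact (hζ _ (hfC hx)).tendsto.comp (tendsto_nhdsWithin_iff.2
      ⟨(hlim x hx).1, Filter.Eventually.of_forall fun j => hFC j hx⟩)
  refine BoxStokes.of_tendsto hab hg (hcont hηc) (hcont hη') (fun j => ?_)
    (B := max (A * D ^ n) (A' * D ^ (n + 1)))
    (fun j x hx => (hbd hA j x hx).trans (le_max_left _ _))
    (fun j x hx => (hbd hA' j x hx).trans (le_max_right _ _)) (hlim' hηc) (hlim' hη')
  refine boxStokes_of_differentiableAt hab hg (hcont hηc j) (hcont hη' j) fun x hx => ?_
  have hU : IsOpen (interior (Icc a b)) := isOpen_interior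
  have htwo : (2 : WithTop ℕ∞) ≤ ∞ :=
    WithTop.coe_le_coe.2 (le_top : (2 : ℕ∞) ≤ ⊤)
  have hmaps : MapsTo (F j) (interior (Icc a b)) S :=
    fun y hy => hCS (hFC j (interior_subset hy))
  have hηx := hη _ (hFC j (interior_subset hx))
  have heq : ∀ y ∈ interior (Icc a b),
      fderivWithin ℝ (F j) (interior (Icc a b)) y = fderiv ℝ (F j) y :=
    fun y hy => fderivWithin_of_isOpen hU hy
  have hd2 : DifferentiableAt ℝ (fderiv ℝ (F j)) x :=
    ((hF j).fderiv_right (m := 1) (by rwa [one_add_one_eq_two])).differentiable one_ne_zero x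
  have hd1 : DifferentiableAt ℝ (fun x => η (F j x)) x :=
    (hηx.comp x ((hF j).differentiable (by simp) x).differentiableWithinAt
      hmaps).differentiableAt (hU.mem_nhds hx)
  have hdiff : DifferentiableAt ℝ
      (fun x => (η (F j x)).compContinuousLinearMap (fderiv ℝ (F j) x)) x :=
    (hd1.hasFDerivAt.continuousAlternatingMapCompContinuousLinearMap
      hd2.hasFDerivAt).differentiableAt
  refine ⟨hdiff, ?_⟩
  have key := extDerivWithin_pullback (r := ∞) hηx (hF j).contDiffAt.contDiffWithinAt
    (by simpa using htwo) hU.uniqueDiffOn (by rw [hU.interior_eq]; exact subset_closure hx)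
    hx hmaps
  rw [heq x hx] at key
  rw [← key, extDerivWithin, extDeriv, fderivWithin_of_isOpen hU hx]
  congr 1
  refine Filter.EventuallyEq.fderiv_eq ?_
  filter_upwards [hU.mem_nhds hx] with y hy
  rw [heq y hy]

end BoxStokes

/-! ### Localization of Stokes' theorem on a box -/

section BoxLocalization

variable {n : ℕ} {a b : Fin (n + 1) → ℝ} {g : (Fin (n + 1) → ℝ) → ℝ}
  {θ : (Fin (n + 1) → ℝ) → (Fin (n + 1) → ℝ) [⋀^Fin n]→L[ℝ] ℝ}
  {dθ : (Fin (n + 1) → ℝ) → (Fin (n + 1) → ℝ) [⋀^Fin (n + 1)]→L[ℝ] ℝ}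

/-- The function `g` vanishes near each point of `Q` outside `W`: it has support in `W`,
relatively to `Q`. -/
def VanishesOff {X : Type*} [TopologicalSpace X] (Q W : Set X) (g : X → ℝ) : Prop :=
  ∀ x ∈ Q, x ∉ W → g =ᶠ[𝓝[Q] x] 0

theorem VanishesOff.eq_zero {X : Type*} [TopologicalSpace X] {Q W : Set X} {g : X → ℝ}
    (h : VanishesOff Q W g) {x : X} (hx : x ∈ Q) (hxW : x ∉ W) : g x = 0 :=
  (h x hx hxW).self_of_nhdsWithin hx

theorem VanishesOff.fderivWithin_eq_zero {X : Type*} [NormedAddCommGroup X] [NormedSpace ℝ X]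
    {Q W : Set X} {g : X → ℝ} (h : VanishesOff Q W g) {x : X} (hx : x ∈ Q) (hxW : x ∉ W) :
    fderivWithin ℝ g Q x = 0 := by
  rw [(h x hx hxW).fderivWithin_eq (h.eq_zero hx hxW)]
  simp

/-- The extension by zero of a function which is continuous on a relatively open subset. -/
theorem continuousOn_of_vanishesOff {X : Type*} [TopologicalSpace X] {Q W : Set X}
    (hW : ∀ x ∈ W, W ∈ 𝓝[Q] x) {h : X → ℝ} (hc : ContinuousOn h W)
    (hv : VanishesOff Q W h) : ContinuousOn h Q := by
  intro x hx
  by_cases hxW : x ∈ W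
  · exact (hc x hxW).mono_of_mem_nhdsWithin (hW x hxW)
  · exact (continuousWithinAt_const (b := (0 : ℝ))).congr_of_eventuallyEq (hv x hx hxW)
      (hv.eq_zero hx hxW)

theorem BoxStokes.congr {g' : (Fin (n + 1) → ℝ) → ℝ} (hab : ∀ i, a i < b i)
    (h : BoxStokes a b g θ dθ) (hg : EqOn g' g (Icc a b)) : BoxStokes a b g' θ dθ := by
  have h1 : ∀ x ∈ Icc a b, g' x * dθ x (stdVec (n + 1)) +
      wedgeOne (fderivWithin ℝ g' (Icc a b) x) (θ x) (stdVec (n + 1)) =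
      g x * dθ x (stdVec (n + 1)) +
      wedgeOne (fderivWithin ℝ g (Icc a b) x) (θ x) (stdVec (n + 1)) := by
    intro x hx
    rw [hg hx, fderivWithin_congr hg (hg hx)]
  rw [BoxStokes, setIntegral_congr_fun measurableSet_Icc h1]
  rw [BoxStokes] at h
  rw [h]
  refine Finset.sum_congr rfl fun i _ => ?_
  congr 1
  · refine setIntegral_congr_fun measurableSet_Icc fun w hw => ?_
    have := hg (insertNth_mem_Icc (right_mem_Icc.2 (hab i).le) hw)
    simp only [this]
  · refine setIntegral_congr_fun measurableSet_Icc fun w hw => ?_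
    have := hg (insertNth_mem_Icc (left_mem_Icc.2 (hab i).le) hw)
    simp only [this]

variable {W : Set (Fin (n + 1) → ℝ)}

theorem continuousOn_mul_form (hWI : W ⊆ Icc a b) (hW : ∀ x ∈ W, W ∈ 𝓝[Icc a b] x)
    {m : ℕ} {ζ : (Fin (n + 1) → ℝ) → (Fin (n + 1) → ℝ) [⋀^Fin m]→L[ℝ] ℝ} (hζ : ContinuousOn ζ W)
    (hg : ContinuousOn g (Icc a b)) (hv : VanishesOff (Icc a b) W g)
    (v : Fin m → Fin (n + 1) → ℝ) : ContinuousOn (fun x => g x * ζ x v) (Icc a b) := by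
  refine continuousOn_of_vanishesOff hW
    ((hg.mono hWI).mul (continuous_apply_form hζ v)) fun x hx hxW => ?_
  filter_upwards [hv x hx hxW] with y hy
  simp [hy]

theorem continuousOn_wedgeOne_fderivWithin (hab : ∀ i, a i < b i) (hWI : W ⊆ Icc a b)
    (hW : ∀ x ∈ W, W ∈ 𝓝[Icc a b] x) (hθ : ContinuousOn θ W) (hg : ContDiffOn ℝ 1 g (Icc a b))
    (hv : VanishesOff (Icc a b) W g) : ContinuousOn
      (fun x => wedgeOne (fderivWithin ℝ g (Icc a b) x) (θ x) (stdVec (n + 1))) (Icc a b) := by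
  have hg' := hg.continuousOn_fderivWithin (uniqueDiffOn_Icc_pi hab) le_rfl
  refine continuousOn_of_vanishesOff hW
    (continuous_apply_form ((hg'.mono hWI).wedgeOne hθ) _) fun x hx hxW => ?_
  filter_upwards [(hv x hx hxW).fderivWithin (𝕜 := ℝ)] with y hy
  rw [hy]
  have h0 : fderivWithin ℝ (0 : (Fin (n + 1) → ℝ) → ℝ) (Icc a b) y = 0 := by simp
  rw [h0, wedgeOne_zero]
  simp

theorem integrableOn_face (hWI : W ⊆ Icc a b) (hW : ∀ x ∈ W, W ∈ 𝓝[Icc a b] x)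
    (hθ : ContinuousOn θ W) (hg : ContinuousOn g (Icc a b)) (hv : VanishesOff (Icc a b) W g)
    {i : Fin (n + 1)} {c : ℝ} (hc : c ∈ Icc (a i) (b i)) :
    IntegrableOn (fun w : Fin n → ℝ => (-1 : ℝ) ^ (i : ℕ) *
      (g (i.insertNth c w) * θ (i.insertNth c w) (i.removeNth (stdVec (n + 1)))))
      (Icc (a ∘ i.succAbove) (b ∘ i.succAbove)) :=
  (continuousOn_const.mul (continuousOn_face (F := fun x => g x *
    θ x (i.removeNth (stdVec (n + 1)))) (continuousOn_mul_form hWI hW hθ hg hv _)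
      hc)).integrableOn_compact isCompact_Icc

theorem BoxStokes.add (hab : ∀ i, a i < b i) (hWI : W ⊆ Icc a b)
    (hW : ∀ x ∈ W, W ∈ 𝓝[Icc a b] x) (hθ : ContinuousOn θ W) (hdθ : ContinuousOn dθ W)
    {g₁ g₂ : (Fin (n + 1) → ℝ) → ℝ}
    (hg₁ : ContDiffOn ℝ 1 g₁ (Icc a b)) (hv₁ : VanishesOff (Icc a b) W g₁)
    (hg₂ : ContDiffOn ℝ 1 g₂ (Icc a b)) (hv₂ : VanishesOff (Icc a b) W g₂)
    (h₁ : BoxStokes a b g₁ θ dθ) (h₂ : BoxStokes a b g₂ θ dθ) :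
    BoxStokes a b (fun x => g₁ x + g₂ x) θ dθ := by
  have hint : ∀ {g : (Fin (n + 1) → ℝ) → ℝ}, ContDiffOn ℝ 1 g (Icc a b) →
      VanishesOff (Icc a b) W g → IntegrableOn (fun x => g x * dθ x (stdVec (n + 1)) +
        wedgeOne (fderivWithin ℝ g (Icc a b) x) (θ x) (stdVec (n + 1))) (Icc a b) :=
    fun hg hv => ((continuousOn_mul_form hWI hW hdθ hg.continuousOn hv _).add
      (continuousOn_wedgeOne_fderivWithin hab hWI hW hθ hg hv)).integrableOn_compact isCompact_Icc
  have hsplit : ∀ x ∈ Icc a b, (g₁ x + g₂ x) * dθ x (stdVec (n + 1)) +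
      wedgeOne (fderivWithin ℝ (fun x => g₁ x + g₂ x) (Icc a b) x) (θ x) (stdVec (n + 1)) =
      (g₁ x * dθ x (stdVec (n + 1)) +
        wedgeOne (fderivWithin ℝ g₁ (Icc a b) x) (θ x) (stdVec (n + 1))) +
      (g₂ x * dθ x (stdVec (n + 1)) +
        wedgeOne (fderivWithin ℝ g₂ (Icc a b) x) (θ x) (stdVec (n + 1))) := by
    intro x hx
    rw [fderivWithin_fun_add (uniqueDiffOn_Icc_pi hab x hx)
      (hg₁.differentiableOn one_ne_zero x hx) (hg₂.differentiableOn one_ne_zero x hx),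
      wedgeOne_add, ContinuousAlternatingMap.add_apply]
    ring
  rw [BoxStokes, setIntegral_congr_fun measurableSet_Icc hsplit,
    integral_add (hint hg₁ hv₁) (hint hg₂ hv₂)]
  rw [BoxStokes] at h₁ h₂
  rw [h₁, h₂, boxBoundary, boxBoundary, boxBoundary, ← Finset.sum_add_distrib]
  refine Finset.sum_congr rfl fun i _ => ?_
  have hf : ∀ c ∈ Icc (a i) (b i),
      ∫ w in Icc (a ∘ i.succAbove) (b ∘ i.succAbove), (-1 : ℝ) ^ (i : ℕ) *
        ((g₁ (i.insertNth c w) + g₂ (i.insertNth c w)) *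
          θ (i.insertNth c w) (i.removeNth (stdVec (n + 1)))) =
      (∫ w in Icc (a ∘ i.succAbove) (b ∘ i.succAbove), (-1 : ℝ) ^ (i : ℕ) *
        (g₁ (i.insertNth c w) * θ (i.insertNth c w) (i.removeNth (stdVec (n + 1))))) +
      ∫ w in Icc (a ∘ i.succAbove) (b ∘ i.succAbove), (-1 : ℝ) ^ (i : ℕ) *
        (g₂ (i.insertNth c w) * θ (i.insertNth c w) (i.removeNth (stdVec (n + 1)))) := by
    intro c hc
    rw [← integral_add (integrableOn_face hWI hW hθ hg₁.continuousOn hv₁ hc)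
      (integrableOn_face hWI hW hθ hg₂.continuousOn hv₂ hc)]
    congr 1
    funext w
    ring
  rw [hf _ (right_mem_Icc.2 (hab i).le), hf _ (left_mem_Icc.2 (hab i).le)]
  ring

theorem boxStokes_zero : BoxStokes a b (fun _ => 0) θ dθ := by
  rw [BoxStokes, boxBoundary]
  simp [wedgeOne_zero]

theorem VanishesOff.add {X : Type*} [TopologicalSpace X] {Q W : Set X} {g₁ g₂ : X → ℝ}
    (h₁ : VanishesOff Q W g₁) (h₂ : VanishesOff Q W g₂) :
    VanishesOff Q W fun x => g₁ x + g₂ x := by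
  intro x hx hxW
  filter_upwards [h₁ x hx hxW, h₂ x hx hxW] with y h1 h2
  simp [h1, h2]

theorem BoxStokes.sum {ι : Type*} (s : Finset ι) (hab : ∀ i, a i < b i) (hWI : W ⊆ Icc a b)
    (hW : ∀ x ∈ W, W ∈ 𝓝[Icc a b] x) (hθ : ContinuousOn θ W) (hdθ : ContinuousOn dθ W)
    {h : ι → (Fin (n + 1) → ℝ) → ℝ} (hg : ∀ i, ContDiffOn ℝ 1 (h i) (Icc a b))
    (hv : ∀ i, VanishesOff (Icc a b) W (h i)) (hs : ∀ i, BoxStokes a b (h i) θ dθ) :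
    BoxStokes a b (fun x => ∑ i ∈ s, h i x) θ dθ := by
  classical
  suffices H : ContDiffOn ℝ 1 (fun x => ∑ i ∈ s, h i x) (Icc a b) ∧
      VanishesOff (Icc a b) W (fun x => ∑ i ∈ s, h i x) ∧
      BoxStokes a b (fun x => ∑ i ∈ s, h i x) θ dθ from H.2.2
  induction s using Finset.induction_on with
  | empty =>
    simp only [Finset.sum_empty]
    exact ⟨contDiffOn_const, fun x _ _ => Filter.EventuallyEq.rfl, boxStokes_zero⟩
  | insert i s hi ih =>
    simp only [Finset.sum_insert hi]
    exact ⟨(hg i).add ih.1, (hv i).add ih.2.1,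
      BoxStokes.add hab hWI hW hθ hdθ (hg i) (hv i) ih.1 ih.2.1 (hs i) ih.2.2⟩

/-- Stokes' theorem for test functions with small support implies it for all test functions. -/
theorem boxStokes_of_locally (hab : ∀ i, a i < b i) (hWI : W ⊆ Icc a b)
    (hW : ∀ x ∈ W, W ∈ 𝓝[Icc a b] x) (hθ : ContinuousOn θ W) (hdθ : ContinuousOn dθ W)
    (hloc : ∀ x ∈ W, ∃ O : Set (Fin (n + 1) → ℝ), IsOpen O ∧ x ∈ O ∧
      ∀ h : (Fin (n + 1) → ℝ) → ℝ, ContDiffOn ℝ 1 h (Icc a b) → VanishesOff (Icc a b) O h →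
        BoxStokes a b h θ dθ)
    (hg : ContDiffOn ℝ 1 g (Icc a b)) (hv : VanishesOff (Icc a b) W g) :
    BoxStokes a b g θ dθ := by
  choose! O hO hxO hOs using hloc
  -- the support of `g` is a compact subset `K` of `W`, on which a partition of unity is taken
  set U₀ : Set (Fin (n + 1) → ℝ) := {x | ∀ᶠ y in 𝓝 x, y ∈ Icc a b → g y = 0} with hU₀
  have hU₀o : IsOpen U₀ := isOpen_setOfPred_eventually_nhds
  set K := Icc a b ∩ U₀ᶜ with hK
  have hKc : IsCompact K := isCompact_Icc.inter_right hU₀o.isClosed_compl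
  have hKW : K ⊆ W := by
    rintro x ⟨hx, hx0⟩
    by_contra hxW
    exact hx0 (eventually_nhdsWithin_iff.1 (hv x hx hxW))
  have hgK : ∀ x ∈ Icc a b, x ∉ K → g x = 0 := by
    intro x hx hxK
    have : x ∈ U₀ := by
      by_contra h
      exact hxK ⟨hx, h⟩
    exact this.self_of_nhds hx
  obtain ⟨t, htK, ht⟩ := hKc.elim_nhds_subcover O
    fun x hx => (hO x (hKW hx)).mem_nhds (hxO x (hKW hx))
  obtain ⟨ρ, hρ⟩ := SmoothPartitionOfUnity.exists_isSubordinate 𝓘(ℝ, Fin (n + 1) → ℝ)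
    hKc.isClosed (fun i : t => O i) (fun i => hO i (hKW (htK i i.2)))
    (by simpa [iUnion_subtype] using ht)
  have hsum : EqOn g (fun x => ∑ i : t, ρ i x * g x) (Icc a b) := by
    intro x hx
    simp only
    rw [← Finset.sum_mul]
    by_cases hxK : x ∈ K
    · have := ρ.sum_eq_one hxK
      rw [finsum_eq_sum_of_fintype] at this
      rw [this, one_mul]
    · rw [hgK x hx hxK, mul_zero]
  have hsm : ∀ i : t, ContDiffOn ℝ 1 (fun x => ρ i x * g x) (Icc a b) := by
    intro i
    have h1 : ContDiff ℝ ∞ (ρ i) := (ρ i).contMDiff.contDiff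
    exact (h1.of_le (by exact_mod_cast le_top)).contDiffOn.mul hg
  refine BoxStokes.congr hab (BoxStokes.sum Finset.univ hab hWI hW hθ hdθ hsm ?_ ?_) hsum
  · intro i x hx hxW
    filter_upwards [hv x hx hxW] with y hy
    simp [hy]
  · intro i
    refine hOs i (hKW (htK i i.2)) _ (hsm i) fun x hx hxO => ?_
    have h2 : x ∉ tsupport (ρ i) := fun h => hxO (hρ i h)
    filter_upwards [nhdsWithin_le_nhds (notMem_tsupport_iff_eventuallyEq.1 h2)] with y hy
    simp [hy]

/-- Stokes' theorem on the intersection with the box `[a', b']` implies it on `[a, b]` for a test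
function with support in the interior of `[a', b']`: each face of the intersection either lies in a
face of `[a, b]` or does not meet the support. -/
theorem boxStokes_of_subbox {a' b' : Fin (n + 1) → ℝ}
    (hab' : ∀ i, max (a i) (a' i) < min (b i) (b' i)) {h : (Fin (n + 1) → ℝ) → ℝ}
    (hh : ContDiffOn ℝ 1 h (Icc a b))
    (hv : VanishesOff (Icc a b) (pi univ fun i => Ioo (a' i) (b' i)) h)
    {θ' : (Fin (n + 1) → ℝ) → (Fin (n + 1) → ℝ) [⋀^Fin n]→L[ℝ] ℝ}
    {dθ' : (Fin (n + 1) → ℝ) → (Fin (n + 1) → ℝ) [⋀^Fin (n + 1)]→L[ℝ] ℝ}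
    (hθ : EqOn θ' θ (Icc (a ⊔ a') (b ⊓ b'))) (hdθ : EqOn dθ' dθ (Icc (a ⊔ a') (b ⊓ b')))
    (H : BoxStokes (a ⊔ a') (b ⊓ b') h θ' dθ') : BoxStokes a b h θ dθ := by
  have hsub : Icc (a ⊔ a') (b ⊓ b') ⊆ Icc a b := Icc_subset_Icc le_sup_left inf_le_left
  have hout : ∀ x ∈ Icc a b, x ∉ Icc (a ⊔ a') (b ⊓ b') →
      x ∉ pi univ fun i => Ioo (a' i) (b' i) := by
    intro x hx hx' hxp
    refine hx' ⟨sup_le hx.1 fun i => ?_, le_inf hx.2 fun i => ?_⟩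
    · exact (hxp i (mem_univ i)).1.le
    · exact (hxp i (mem_univ i)).2.le
  have hab : ∀ i, a i < b i := fun i =>
    (le_max_left _ _).trans_lt ((hab' i).trans_le (min_le_left _ _))
  rw [BoxStokes] at H ⊢
  have h1 : ∫ x in Icc a b, (h x * dθ x (stdVec (n + 1)) +
      wedgeOne (fderivWithin ℝ h (Icc a b) x) (θ x) (stdVec (n + 1))) =
      ∫ x in Icc (a ⊔ a') (b ⊓ b'), (h x * dθ' x (stdVec (n + 1)) +
      wedgeOne (fderivWithin ℝ h (Icc (a ⊔ a') (b ⊓ b')) x) (θ' x) (stdVec (n + 1))) := by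
    rw [setIntegral_eq_of_subset_of_forall_sdiff_eq_zero measurableSet_Icc hsub]
    · refine setIntegral_congr_fun measurableSet_Icc fun x hx => ?_
      rw [hθ hx, hdθ hx, fderivWithin_subset hsub
        (uniqueDiffOn_Icc_pi (a := a ⊔ a') (b := b ⊓ b') hab' x hx)
        (hh.differentiableOn one_ne_zero x (hsub hx))]
    · rintro x ⟨hx, hx'⟩
      rw [hv.eq_zero hx (hout x hx hx'), hv.fderivWithin_eq_zero hx (hout x hx hx'),
        wedgeOne_zero]
      simp
  rw [h1, H, boxBoundary, boxBoundary]
  refine Finset.sum_congr rfl fun i _ => ?_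
  have hface : ∀ c c' : ℝ, c ∈ Icc (a i) (b i) → c' ∈ Icc ((a ⊔ a') i) ((b ⊓ b') i) →
      (c' = c ∨ (c ∉ Ioo (a' i) (b' i) ∧ c' ∉ Ioo (a' i) (b' i))) →
      ∫ w in Icc ((a ⊔ a') ∘ i.succAbove) ((b ⊓ b') ∘ i.succAbove), (-1 : ℝ) ^ (i : ℕ) *
        (h (i.insertNth c' w) * θ' (i.insertNth c' w) (i.removeNth (stdVec (n + 1)))) =
      ∫ w in Icc (a ∘ i.succAbove) (b ∘ i.succAbove), (-1 : ℝ) ^ (i : ℕ) *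
        (h (i.insertNth c w) * θ (i.insertNth c w) (i.removeNth (stdVec (n + 1)))) := by
    intro c c' hc hc' hcc
    rcases hcc with rfl | ⟨h2, h3⟩
    · symm
      have hs' : Icc ((a ⊔ a') ∘ i.succAbove) ((b ⊓ b') ∘ i.succAbove) ⊆
          Icc (a ∘ i.succAbove) (b ∘ i.succAbove) :=
        Icc_subset_Icc (fun j => le_max_left _ _) fun j => min_le_left _ _
      rw [setIntegral_eq_of_subset_of_forall_sdiff_eq_zero measurableSet_Icc hs']
      · refine setIntegral_congr_fun measurableSet_Icc fun w hw => ?_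
        rw [hθ (insertNth_mem_Icc hc' hw)]
      · rintro w ⟨hw, hw'⟩
        have hx := insertNth_mem_Icc hc hw
        rw [hv.eq_zero hx (hout _ hx fun hmem => hw' (Fin.insertNth_mem_Icc.1 hmem).2)]
        simp
    · rw [setIntegral_eq_zero_of_forall_eq_zero, setIntegral_eq_zero_of_forall_eq_zero]
      · intro w hw
        rw [hv.eq_zero (insertNth_mem_Icc hc hw) fun hmem => h2 ?_]
        · simp
        · have := hmem i (mem_univ i)
          rwa [Fin.insertNth_apply_same] at this
      · intro w hw
        rw [hv.eq_zero (hsub (insertNth_mem_Icc hc' hw)) fun hmem => h3 ?_]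
        · simp
        · have := hmem i (mem_univ i)
          rwa [Fin.insertNth_apply_same] at this
  have hlt : (a ⊔ a') i < (b ⊓ b') i := hab' i
  rw [hface (b i) ((b ⊓ b') i) (right_mem_Icc.2 (hab i).le) (right_mem_Icc.2 hlt.le) ?_,
    hface (a i) ((a ⊔ a') i) (left_mem_Icc.2 (hab i).le) (left_mem_Icc.2 hlt.le) ?_]
  · rcases le_total (a' i) (a i) with h2 | h2
    · exact Or.inl (sup_eq_left.2 h2)
    · refine Or.inr ⟨fun h3 => absurd h3.1 h2.not_gt, fun h3 => ?_⟩
      exact absurd h3.1 (by simp [h2])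
  · rcases le_total (b i) (b' i) with h2 | h2
    · exact Or.inl (inf_eq_left.2 h2)
    · refine Or.inr ⟨fun h3 => absurd h3.2 h2.not_gt, fun h3 => ?_⟩
      exact absurd h3.2 (by simp [h2])

end BoxLocalization

/-! ### Pullback of forms to vector spaces, and invariance of the exterior derivative -/

section PullbackWithin

variable {E : Type*} [NormedAddCommGroup E] [NormedSpace ℝ E]
  {H : Type*} [TopologicalSpace H] {I : ModelWithCorners ℝ E H}
  {M : Type*} [TopologicalSpace M] [ChartedSpace H M]
  {X : Type*} [NormedAddCommGroup X] [NormedSpace ℝ X] {m : ℕ}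

/-- The pullback of a form on `M` under a map defined on a subset `S` of a vector space, with the
derivative within `S`. -/
def pullbackWithin (F : X → M) (S : Set X) (η : DiffForm I M m) (x : X) : X [⋀^Fin m]→L[ℝ] ℝ :=
  (η (F x)).compContinuousLinearMap (mfderivWithin 𝓘(ℝ, X) I F S x)

theorem chartRep_eq_pullbackWithin (η : DiffForm I M m) (x₀ : M) :
    chartRep η x₀ = pullbackWithin (extChartAt I x₀).symm (range I) η := rfl

/-- The value of a form at a point, seen in the fixed space of forms on `E`, of which all tangent
spaces are copies. -/
def modelForm (η : DiffForm I M m) (y : M) : E [⋀^Fin m]→L[ℝ] ℝ := η y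

theorem IsContDiffForm.of_le {r s : ℕ∞} (hrs : r ≤ s) {η : DiffForm I M m}
    (hη : IsContDiffForm s η) : IsContDiffForm r η :=
  fun x₀ => (hη x₀).of_le (by exact_mod_cast hrs)

theorem continuousOn_extDerivWithin_chartRep {η : DiffForm I M m} (hη : IsContDiffForm 1 η)
    (x₀ : M) : ContinuousOn (extDerivWithin (chartRep η x₀) (range I)) (extChartAt I x₀).target := by
  have h1 : ContinuousOn (fderivWithin ℝ (chartRep η x₀) (extChartAt I x₀).target)
      (extChartAt I x₀).target :=
    (hη x₀).continuousOn_fderivWithin (uniqueDiffOn_extChartAt_target x₀) le_rfl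
  have h2 : ContinuousOn (fderivWithin ℝ (chartRep η x₀) (range I)) (extChartAt I x₀).target := by
    refine h1.congr fun u hu => ?_
    exact (fderivWithin_congr_set (extChartAt_target_eventuallyEq_of_mem hu)).symm
  exact (ContinuousAlternatingMap.alternatizeUncurryFinCLM ℝ E ℝ).continuous.comp_continuousOn h2

variable [IsManifold I ∞ M]

/-- The pullback of a form can be computed in any chart around the image point. -/
theorem pullbackWithin_eq_chartRep {F : X → M} {S : Set X} {x : X}
    (hS : UniqueDiffWithinAt ℝ S x) (hF : MDifferentiableWithinAt 𝓘(ℝ, X) I F S x) {x₀ : M}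
    (hx : F x ∈ (extChartAt I x₀).source) (η : DiffForm I M m) :
    pullbackWithin F S η x = (chartRep η x₀ (extChartAt I x₀ (F x))).compContinuousLinearMap
      (fderivWithin ℝ (extChartAt I x₀ ∘ F) S x) := by
  have _ : IsManifold I 1 M := IsManifold.of_le (n := ∞) (by exact_mod_cast le_top)
  have hx' : F x ∈ (chartAt H x₀).source := by rwa [← extChartAt_source (I := I)]
  have h1 : fderivWithin ℝ (extChartAt I x₀ ∘ F) S x =
      (mfderiv I 𝓘(ℝ, E) (extChartAt I x₀) (F x)).comp (mfderivWithin 𝓘(ℝ, X) I F S x) := by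
    rw [← mfderivWithin_eq_fderivWithin]
    exact mfderiv_comp_mfderivWithin x (mdifferentiableAt_extChartAt hx') hF
      hS.uniqueMDiffWithinAt
  have h2 := mfderivWithin_extChartAt_symm_comp_mfderiv_extChartAt' hx
  have h3 : ∀ v : X, (mfderivWithin 𝓘(ℝ, E) I (extChartAt I x₀).symm (range I)
      (extChartAt I x₀ (F x)) : E →L[ℝ] E) ((fderivWithin ℝ (extChartAt I x₀ ∘ F) S x) v) =
      (mfderivWithin 𝓘(ℝ, X) I F S x : X →L[ℝ] E) v := by
    intro v
    rw [h1]
    exact congrArg (fun L : E →L[ℝ] E => L ((mfderivWithin 𝓘(ℝ, X) I F S x : X →L[ℝ] E) v)) h2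
  have h5 : chartRep η x₀ (extChartAt I x₀ (F x)) = (modelForm η (F x)).compContinuousLinearMap
      (mfderivWithin 𝓘(ℝ, E) I (extChartAt I x₀).symm (range I)
        (extChartAt I x₀ (F x)) : E →L[ℝ] E) := by
    have h4 : chartRep η x₀ (extChartAt I x₀ (F x)) =
        (modelForm η ((extChartAt I x₀).symm (extChartAt I x₀ (F x)))).compContinuousLinearMap
          (mfderivWithin 𝓘(ℝ, E) I (extChartAt I x₀).symm (range I)
            (extChartAt I x₀ (F x)) : E →L[ℝ] E) := rfl
    rw [h4, (extChartAt I x₀).left_inv hx]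
  rw [h5]
  ext v
  change modelForm η (F x) (fun i => (mfderivWithin 𝓘(ℝ, X) I F S x : X →L[ℝ] E) (v i))
    = modelForm η (F x) (fun i => (mfderivWithin 𝓘(ℝ, E) I (extChartAt I x₀).symm
      (range I) (extChartAt I x₀ (F x)) : E →L[ℝ] E)
        ((fderivWithin ℝ (extChartAt I x₀ ∘ F) S x) (v i)))
  simp only [h3]

/-- In each chart, `dForm η` is the exterior derivative of the expression of `η`: it does not
depend on the charts used in its definition. -/
theorem chartRep_dForm {η : DiffForm I M m} (hη : IsContDiffForm 1 η) {x₀ : M} {u : E}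
    (hu : u ∈ (extChartAt I x₀).target) :
    chartRep (dForm η) x₀ u = extDerivWithin (chartRep η x₀) (range I) u := by
  have _ : IsManifold I 1 M := IsManifold.of_le (n := ∞) (by exact_mod_cast le_top)
  set y : M := (extChartAt I x₀).symm u with hy
  set τ : E → E := extChartAt I y ∘ (extChartAt I x₀).symm with hτ
  set S : Set E := ((extChartAt I x₀).symm ≫ extChartAt I y).source with hS
  have hSmem : ∀ z ∈ S, z ∈ (extChartAt I x₀).target ∧
      (extChartAt I x₀).symm z ∈ (extChartAt I y).source := fun z hz => by
    simpa [hS] using hz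
  have huS : u ∈ S := by
    have : (extChartAt I x₀).symm u ∈ (extChartAt I y).source := mem_extChartAt_source y
    simp only [hS, PartialEquiv.trans_source, PartialEquiv.symm_source]
    exact ⟨hu, this⟩
  have hSr : S ⊆ range I := fun z hz => extChartAt_target_subset_range x₀ (hSmem z hz).1
  have hSn : ∀ z ∈ S, S ∈ 𝓝[range I] z := fun z hz =>
    I.extendCoordChange_source_mem_nhdsWithin hz
  have hSeq : ∀ z ∈ S, S =ᶠ[𝓝 z] range I := fun z hz => by
    rw [← nhdsWithin_eq_iff_eventuallyEq]
    exact le_antisymm (nhdsWithin_mono _ hSr) (nhdsWithin_le_iff.2 (hSn z hz))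
  have hud : UniqueDiffOn ℝ S := I.uniqueDiffOn_extendCoordChange_source
  have hsm : ContDiffOn ℝ ∞ τ S := contDiffOn_ext_coord_change y x₀
  have hrep : ∀ z ∈ S, chartRep η x₀ z =
      (chartRep η y (τ z)).compContinuousLinearMap (fderivWithin ℝ τ S z) := by
    intro z hz
    rw [chartRep_eq_pullbackWithin η x₀, pullbackWithin_eq_chartRep (I.uniqueDiffOn _ (hSr hz))
      (mdifferentiableWithinAt_extChartAt_symm (hSmem z hz).1) (hSmem z hz).2,
      fderivWithin_congr_set (hSeq z hz)]
    rfl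
  have hyt : extChartAt I y y ∈ (extChartAt I y).target := mem_extChartAt_target y
  have hdη : DifferentiableWithinAt ℝ (chartRep η y) (range I) (τ u) := by
    have h1 := (hη y).differentiableOn one_ne_zero _ hyt
    exact h1.mono_of_mem_nhdsWithin (extChartAt_target_mem_nhdsWithin y)
  have htwo : (2 : WithTop ℕ∞) ≤ ∞ := WithTop.coe_le_coe.2 (le_top : (2 : ℕ∞) ≤ ⊤)
  have hcl : u ∈ closure (interior S) := by
    have h1 : u ∈ closure (interior (range I)) := I.range_subset_closure_interior (hSr huS)
    rw [mem_closure_iff_nhds] at h1 ⊢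
    intro t ht
    obtain ⟨O, hO, hOS⟩ := mem_nhdsWithin_iff_exists_mem_nhds_inter.1 (hSn u huS)
    obtain ⟨z, ⟨hzt, hzO⟩, hzI⟩ := h1 (t ∩ interior O)
      (Filter.inter_mem ht (interior_mem_nhds.2 hO))
    refine ⟨z, hzt, ?_⟩
    have h2 : interior O ∩ interior (range I) ⊆ S := fun w hw =>
      hOS ⟨interior_subset hw.1, interior_subset hw.2⟩
    exact interior_maximal h2 (isOpen_interior.inter isOpen_interior) ⟨hzO, hzI⟩
  have key := extDerivWithin_pullback (r := ∞) hdη (hsm u huS) (by simpa using htwo) hud hcl huS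
    (t := range I) (fun z hz => extChartAt_target_subset_range y
      ((extChartAt I y).map_source (hSmem z hz).2))
  have h6 : extDerivWithin (chartRep η x₀) (range I) u =
      extDerivWithin (fun z => (chartRep η y (τ z)).compContinuousLinearMap
        (fderivWithin ℝ τ S z)) S u := by
    rw [extDerivWithin, extDerivWithin, ← fderivWithin_congr_set (hSeq u huS)]
    congr 1
    exact fderivWithin_congr hrep (hrep u huS)
  rw [h6, key]
  have h7 : fderivWithin ℝ τ S u = (mfderiv I 𝓘(ℝ, E) (extChartAt I y) y).comp
      (mfderivWithin 𝓘(ℝ, E) I (extChartAt I x₀).symm (range I) u) := by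
    rw [fderivWithin_congr_set (hSeq u huS), ← mfderivWithin_eq_fderivWithin]
    exact mfderiv_comp_mfderivWithin u (mdifferentiableAt_extChartAt (mem_chart_source H y))
      (mdifferentiableWithinAt_extChartAt_symm hu) (I.uniqueMDiffOn _ (hSr huS))
  rw [h7]
  rfl

theorem IsContDiffForm.dForm {η : DiffForm I M m} (hη : IsContDiffForm 1 η) :
    IsContDiffForm 0 (dForm η) := by
  intro x₀
  have h := (continuousOn_extDerivWithin_chartRep hη x₀).congr fun u hu => chartRep_dForm hη hu
  exact contDiffOn_zero.2 h

/-- The pullback of a continuous form under a `C^1` map is continuous. -/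
theorem continuousOn_pullbackWithin {F : X → M} {S W : Set X} (hS : UniqueDiffOn ℝ S)
    (hWS : W ⊆ S) (hW : ∀ x ∈ W, W ∈ 𝓝[S] x) (hF : ContMDiffOn 𝓘(ℝ, X) I 1 F W)
    {η : DiffForm I M m} (hη : IsContDiffForm 0 η) :
    ContinuousOn (pullbackWithin F S η) W := by
  have _ : IsManifold I 1 M := IsManifold.of_le (n := ∞) (by exact_mod_cast le_top)
  intro x hx
  set x₀ := F x with hx₀
  set T : Set X := W ∩ F ⁻¹' (extChartAt I x₀).source with hT
  have hTW : ∀ z ∈ T, T ∈ 𝓝[W] z := fun z hz => Filter.inter_mem self_mem_nhdsWithin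
    ((hF.continuousOn z hz.1).preimage_mem_nhdsWithin
      ((isOpen_extChartAt_source x₀).mem_nhds hz.2))
  have hTS : ∀ z ∈ T, T ∈ 𝓝[S] z := fun z hz =>
    nhdsWithin_le_iff.2 (hW z hz.1) (hTW z hz)
  have hSeq : ∀ z ∈ T, T =ᶠ[𝓝 z] S := fun z hz => by
    rw [← nhdsWithin_eq_iff_eventuallyEq]
    exact le_antisymm (nhdsWithin_mono _ fun w hw => hWS hw.1) (nhdsWithin_le_iff.2 (hTS z hz))
  have hud : UniqueDiffOn ℝ T := fun z hz =>
    ((hS z (hWS hz.1)).mono_nhds (nhdsWithin_le_iff.2 (hTS z hz)))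
  have hf : ContDiffOn ℝ 1 (extChartAt I x₀ ∘ F) T := by
    rw [← contMDiffOn_iff_contDiffOn]
    refine (contMDiffOn_extChartAt (x := x₀) (n := 1)).comp (hF.mono inter_subset_left) fun z hz => ?_
    have := hz.2
    rwa [mem_preimage, extChartAt_source] at this
  have hfd : ContinuousOn (fderivWithin ℝ (extChartAt I x₀ ∘ F) T) T :=
    hf.continuousOn_fderivWithin hud le_rfl
  have hrep : ContinuousOn (fun z => chartRep η x₀ (extChartAt I x₀ (F z))) T :=
    (hη x₀).continuousOn.comp hf.continuousOn fun z hz => (extChartAt I x₀).map_source hz.2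
  have hmain : ContinuousOn (pullbackWithin F S η) T := by
    refine (continuous_compContinuousLinearMap.comp_continuousOn (hrep.prodMk hfd)).congr
      fun z hz => ?_
    have hFz : MDifferentiableWithinAt 𝓘(ℝ, X) I F S z :=
      (hF.mdifferentiableOn one_ne_zero z hz.1).mono_of_mem_nhdsWithin (hW z hz.1)
    rw [pullbackWithin_eq_chartRep (hS z (hWS hz.1)) hFz hz.2 η,
      ← fderivWithin_congr_set (hSeq z hz)]
    rfl
  have hxT : x ∈ T := ⟨hx, mem_extChartAt_source x₀⟩
  exact (hmain x hxT).mono_of_mem_nhdsWithin (hTW x hxT)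

end PullbackWithin

/-! ### Stokes' theorem on a box, for `C^1` maps to a manifold -/

section ManifoldStokes

variable {E : Type*} [NormedAddCommGroup E] [NormedSpace ℝ E] [FiniteDimensional ℝ E]
  {H : Type*} [TopologicalSpace H] {I : ModelWithCorners ℝ E H}
  {M : Type*} [TopologicalSpace M] [ChartedSpace H M] [IsManifold I ∞ M] {n : ℕ}

/-- Stokes' theorem for a `C^1` form on a manifold and a `C^1` map to it from a box, defined on a
relatively open subset which contains the support of the test function. -/
theorem boxStokes_pullbackWithin {a b : Fin (n + 1) → ℝ} (hab : ∀ i, a i < b i)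
    {W : Set (Fin (n + 1) → ℝ)} (hWI : W ⊆ Icc a b) (hW : ∀ x ∈ W, W ∈ 𝓝[Icc a b] x)
    {F : (Fin (n + 1) → ℝ) → M} (hF : ContMDiffOn 𝓘(ℝ, Fin (n + 1) → ℝ) I 1 F W)
    {η : DiffForm I M n} (hη : IsContDiffForm 1 η) {g : (Fin (n + 1) → ℝ) → ℝ}
    (hg : ContDiffOn ℝ 1 g (Icc a b)) (hv : VanishesOff (Icc a b) W g) :
    BoxStokes a b g (pullbackWithin F (Icc a b) η) (pullbackWithin F (Icc a b) (dForm η)) := by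
  have _ : IsManifold I 1 M := IsManifold.of_le (n := ∞) (by exact_mod_cast le_top)
  have hud := uniqueDiffOn_Icc_pi hab
  refine boxStokes_of_locally hab hWI hW
    (continuousOn_pullbackWithin hud hWI hW hF (hη.of_le zero_le_one))
    (continuousOn_pullbackWithin hud hWI hW hF hη.dForm) (fun x hx => ?_) hg hv
  set x₀ := F x with hx₀
  set e := extChartAt I x₀ with he
  obtain ⟨ε, hε, hεt⟩ := Metric.mem_nhdsWithin_iff.1 (extChartAt_target_mem_nhdsWithin (I := I) x₀)
  -- a compact convex neighbourhood of the image point, inside the domain of the chart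
  set C : Set E := Metric.closedBall (e x₀) (ε / 2) ∩ range I with hC
  have hCt : C ⊆ e.target := fun y hy =>
    hεt ⟨Metric.closedBall_subset_ball (half_lt_self hε) hy.1, hy.2⟩
  have hCconv : Convex ℝ C := (convex_closedBall _ _).inter I.convex_range
  have hCc : IsCompact C := (isCompact_closedBall _ _).inter_right I.isClosed_range
  set T : Set (Fin (n + 1) → ℝ) := W ∩ F ⁻¹' (e.source ∩ e ⁻¹' Metric.ball (e x₀) (ε / 2)) with hT
  have hTx : T ∈ 𝓝[Icc a b] x := by
    have h1 : IsOpen (e.source ∩ e ⁻¹' Metric.ball (e x₀) (ε / 2)) :=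
      (continuousOn_extChartAt x₀).isOpen_inter_preimage (isOpen_extChartAt_source x₀)
        Metric.isOpen_ball
    have h2 : F ⁻¹' (e.source ∩ e ⁻¹' Metric.ball (e x₀) (ε / 2)) ∈ 𝓝[W] x :=
      (hF.continuousOn x hx).preimage_mem_nhdsWithin
        (h1.mem_nhds ⟨mem_extChartAt_source x₀, Metric.mem_ball_self (half_pos hε)⟩)
    exact Filter.inter_mem (hW x hx) (nhdsWithin_le_iff.2 (hW x hx) h2)
  obtain ⟨δ, hδ, hδT⟩ := Metric.mem_nhdsWithin_iff.1 hTx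
  set a' : Fin (n + 1) → ℝ := fun i => x i - δ / 2 with ha'
  set b' : Fin (n + 1) → ℝ := fun i => x i + δ / 2 with hb'
  have hxI := hWI hx
  have hab' : ∀ i, max (a i) (a' i) < min (b i) (b' i) := by
    intro i
    have h1 := hxI.1 i
    have h2 := hxI.2 i
    have h3 := hab i
    simp only [max_lt_iff, lt_min_iff, ha', hb']
    refine ⟨⟨h3, ?_⟩, ?_, ?_⟩ <;> linarith
  set Q : Set (Fin (n + 1) → ℝ) := Icc (a ⊔ a') (b ⊓ b') with hQ
  have hQI : Q ⊆ Icc a b := Icc_subset_Icc le_sup_left inf_le_left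
  have hQT : Q ⊆ T := by
    intro z hz
    refine hδT ⟨?_, hQI hz⟩
    have h1 : ‖z - x‖ ≤ δ / 2 := by
      refine (pi_norm_le_iff_of_nonneg (half_pos hδ).le).2 fun i => ?_
      have h2 : a' i ≤ z i := (le_max_right _ _).trans (hz.1 i)
      have h3 : z i ≤ b' i := (hz.2 i).trans (min_le_right _ _)
      simp only [ha', hb'] at h2 h3
      rw [Pi.sub_apply, Real.norm_eq_abs, abs_le]
      constructor <;> linarith
    rw [Metric.mem_ball, dist_eq_norm]
    linarith
  have hudQ : UniqueDiffOn ℝ Q := uniqueDiffOn_Icc_pi hab'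
  refine ⟨pi univ fun i => Ioo (a' i) (b' i), isOpen_set_pi finite_univ fun i _ => isOpen_Ioo,
    fun i _ => ⟨?_, ?_⟩, fun h hh hvh => ?_⟩
  · simp only [ha']
    linarith
  · simp only [hb']
    linarith
  have hmem : ∀ z ∈ T, F z ∈ (chartAt H x₀).source := fun z hz => by
    have := hz.2.1
    rwa [he, extChartAt_source] at this
  have hfT : ContDiffOn ℝ 1 (e ∘ F) T := by
    rw [← contMDiffOn_iff_contDiffOn]
    exact (contMDiffOn_extChartAt (x := x₀) (n := 1)).comp (hF.mono inter_subset_left) hmem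
  have hfQ : ContDiffOn ℝ 1 (e ∘ F) Q := hfT.mono hQT
  have hfC : MapsTo (e ∘ F) Q C := fun z hz =>
    ⟨Metric.ball_subset_closedBall (hQT hz).2.2,
      extChartAt_target_subset_range x₀ (e.map_source (hQT hz).2.1)⟩
  have hMD : ∀ z ∈ Q, MDifferentiableWithinAt 𝓘(ℝ, Fin (n + 1) → ℝ) I F (Icc a b) z := fun z hz =>
    (hF.mdifferentiableOn one_ne_zero z (hQT hz).1).mono_of_mem_nhdsWithin (hW z (hQT hz).1)
  have hfd : ∀ z ∈ Q, fderivWithin ℝ (e ∘ F) Q z = fderivWithin ℝ (e ∘ F) (Icc a b) z := by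
    intro z hz
    refine fderivWithin_subset hQI (hudQ z hz) ?_
    have h1 : MDifferentiableWithinAt 𝓘(ℝ, Fin (n + 1) → ℝ) 𝓘(ℝ, E) (e ∘ F) (Icc a b) z :=
      (mdifferentiableAt_extChartAt (hmem z (hQT hz))).comp_mdifferentiableWithinAt z (hMD z hz)
    exact h1.differentiableWithinAt
  refine boxStokes_of_subbox hab' (hh) hvh
    (θ' := fun z => (chartRep η x₀ ((e ∘ F) z)).compContinuousLinearMap
      (fderivWithin ℝ (e ∘ F) Q z))
    (dθ' := fun z => (extDerivWithin (chartRep η x₀) (range I) ((e ∘ F) z)).compContinuousLinearMap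
      (fderivWithin ℝ (e ∘ F) Q z)) ?_ ?_ ?_
  · intro z hz
    rw [pullbackWithin_eq_chartRep (hud z (hQI hz)) (hMD z hz) (hQT hz).2.1 η]
    simp only
    rw [hfd z hz]
    rfl
  · intro z hz
    rw [pullbackWithin_eq_chartRep (hud z (hQI hz)) (hMD z hz) (hQT hz).2.1 (dForm η),
      chartRep_dForm hη (e.map_source (hQT hz).2.1)]
    simp only
    rw [hfd z hz]
    rfl
  · refine boxStokes_pullback hab' (hh.mono hQI) hCconv hCc (fun y hy => hy.2) (fun y hy => ?_)
      ((continuousOn_extDerivWithin_chartRep hη x₀).mono hCt) hfQ hfC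
    exact ((hη x₀).differentiableOn one_ne_zero y (hCt hy)).mono_of_mem_nhdsWithin
      (extChartAt_target_mem_nhdsWithin_of_mem (hCt hy))

end ManifoldStokes

/-! ### Functoriality of the pullback, and continuity of forms -/

section Functoriality

variable {E : Type*} [NormedAddCommGroup E] [NormedSpace ℝ E]
  {H : Type*} [TopologicalSpace H] {I : ModelWithCorners ℝ E H}
  {M : Type*} [TopologicalSpace M] [ChartedSpace H M]
  {E' : Type*} [NormedAddCommGroup E'] [NormedSpace ℝ E']
  {H' : Type*} [TopologicalSpace H'] {J : ModelWithCorners ℝ E' H'}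
  {N : Type*} [TopologicalSpace N] [ChartedSpace H' N]
  {X : Type*} [NormedAddCommGroup X] [NormedSpace ℝ X]
  {Y : Type*} [NormedAddCommGroup Y] [NormedSpace ℝ Y] {m : ℕ}

theorem pullbackWithin_eq_of_hasMFDerivWithinAt {F : X → M} {S : Set X} {x : X} {L : X →L[ℝ] E}
    (hS : UniqueDiffWithinAt ℝ S x) (hF : HasMFDerivWithinAt 𝓘(ℝ, X) I F S x L)
    (η : DiffForm I M m) :
    pullbackWithin F S η x = (modelForm η (F x)).compContinuousLinearMap L := by
  have h : mfderivWithin 𝓘(ℝ, X) I F S x = L := hF.mfderivWithin hS.uniqueMDiffWithinAt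
  rw [pullbackWithin, h]
  rfl

theorem pullbackWithin_comp_linear {F : X → M} {S : Set X} (ℓ : Y →L[ℝ] X) {S' : Set Y} {y : Y}
    (hS' : UniqueDiffWithinAt ℝ S' y) (hSS : S' ⊆ ℓ ⁻¹' S)
    (hF : MDifferentiableWithinAt 𝓘(ℝ, X) I F S (ℓ y)) (η : DiffForm I M m) :
    pullbackWithin (F ∘ ℓ) S' η y =
      (pullbackWithin F S η (ℓ y)).compContinuousLinearMap ℓ := by
  have h1 : HasMFDerivWithinAt 𝓘(ℝ, Y) 𝓘(ℝ, X) ℓ S' y ℓ :=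
    ℓ.hasFDerivWithinAt.hasMFDerivWithinAt
  rw [pullbackWithin_eq_of_hasMFDerivWithinAt hS' (hF.hasMFDerivWithinAt.comp y h1 hSS)]
  rfl

theorem pullbackWithin_pullback {f : N → M} {F : X → N} {S : Set X} {x : X}
    (hS : UniqueDiffWithinAt ℝ S x) (hF : MDifferentiableWithinAt 𝓘(ℝ, X) J F S x)
    (hf : MDifferentiableAt J I f (F x)) (η : DiffForm I M m) :
    pullbackWithin (f ∘ F) S η x = pullbackWithin F S (pullback (J := J) f η) x := by
  rw [pullbackWithin_eq_of_hasMFDerivWithinAt hS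
    (hf.hasMFDerivAt.comp_hasMFDerivWithinAt x hF.hasMFDerivWithinAt)]
  rfl

/-- The form `dχ ∧ θ`, for a function `χ`. -/
def wedgeForm (χ : N → ℝ) (θ : DiffForm J N m) : DiffForm J N (m + 1) :=
  fun x => wedgeOne (X := E') (mfderiv J 𝓘(ℝ, ℝ) χ x) (modelForm θ x)

theorem pullbackWithin_wedgeForm {χ : N → ℝ} {F : X → N} {S : Set X} {x : X}
    (hS : UniqueDiffWithinAt ℝ S x) (hF : MDifferentiableWithinAt 𝓘(ℝ, X) J F S x)
    (hχ : MDifferentiableAt J 𝓘(ℝ, ℝ) χ (F x)) (θ : DiffForm J N m) :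
    pullbackWithin F S (wedgeForm χ θ) x =
      wedgeOne (fderivWithin ℝ (χ ∘ F) S x) (pullbackWithin F S θ x) := by
  have h1 : fderivWithin ℝ (χ ∘ F) S x =
      (mfderiv J 𝓘(ℝ, ℝ) χ (F x) : E' →L[ℝ] ℝ).comp
        (mfderivWithin 𝓘(ℝ, X) J F S x : X →L[ℝ] E') := by
    rw [← mfderivWithin_eq_fderivWithin]
    exact mfderiv_comp_mfderivWithin x hχ hF hS.uniqueMDiffWithinAt
  rw [h1]
  exact wedgeOne_compContinuousLinearMap (X := E') (Y := X) (mfderiv J 𝓘(ℝ, ℝ) χ (F x))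
    (modelForm θ (F x)) (mfderivWithin 𝓘(ℝ, X) J F S x)

theorem IsContDiffForm.smul_function {χ : N → ℝ} (hχ : Continuous χ) {θ : DiffForm J N m}
    (hθ : IsContDiffForm 0 θ) : IsContDiffForm 0 (fun x => χ x • θ x : DiffForm J N m) := by
  intro p
  refine contDiffOn_zero.2 ?_
  have h1 : ContinuousOn (fun u => χ ((extChartAt J p).symm u)) (extChartAt J p).target :=
    hχ.comp_continuousOn (continuousOn_extChartAt_symm p)
  exact (h1.smul (hθ p).continuousOn).congr fun u _ => ContinuousAlternatingMap.ext fun _ => rfl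

variable [IsManifold I ∞ M] [IsManifold J ∞ N]

theorem IsContDiffForm.pullback {f : N → M} (hf : ContMDiff J I 1 f) {η : DiffForm I M m}
    (hη : IsContDiffForm 0 η) : IsContDiffForm 0 (ActionFlux.pullback (J := J) f η) := by
  have _ : IsManifold J 1 N := IsManifold.of_le (n := ∞) (by exact_mod_cast le_top)
  intro p
  refine contDiffOn_zero.2 ?_
  have h1 : ContMDiffOn 𝓘(ℝ, E') I 1 (f ∘ (extChartAt J p).symm) (extChartAt J p).target :=
    hf.comp_contMDiffOn (contMDiffOn_extChartAt_symm p)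
  refine (continuousOn_pullbackWithin J.uniqueDiffOn (extChartAt_target_subset_range p)
    (fun x hx => extChartAt_target_mem_nhdsWithin_of_mem hx) h1 hη).congr fun u hu => ?_
  exact (pullbackWithin_pullback (J.uniqueDiffOn _ (extChartAt_target_subset_range p hu))
    (mdifferentiableWithinAt_extChartAt_symm hu)
    (hf.mdifferentiable one_ne_zero _) η).symm

theorem IsContDiffForm.wedgeForm {χ : N → ℝ} (hχ : ContMDiff J 𝓘(ℝ, ℝ) 1 χ) {θ : DiffForm J N m}
    (hθ : IsContDiffForm 0 θ) : IsContDiffForm 0 (wedgeForm χ θ) := by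
  have _ : IsManifold J 1 N := IsManifold.of_le (n := ∞) (by exact_mod_cast le_top)
  intro p
  refine contDiffOn_zero.2 ?_
  have h1 : ContDiffOn ℝ 1 (χ ∘ (extChartAt J p).symm) (extChartAt J p).target :=
    contMDiffOn_iff_contDiffOn.1 (hχ.comp_contMDiffOn (contMDiffOn_extChartAt_symm p))
  have h2 := h1.continuousOn_fderivWithin (uniqueDiffOn_extChartAt_target p) le_rfl
  refine (ActionFlux.ContinuousOn.wedgeOne h2 (hθ p).continuousOn).congr fun u hu => ?_
  rw [chartRep_eq_pullbackWithin, pullbackWithin_wedgeForm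
    (J.uniqueDiffOn _ (extChartAt_target_subset_range p hu))
    (mdifferentiableWithinAt_extChartAt_symm hu) (hχ.mdifferentiable one_ne_zero _),
    ← fderivWithin_congr_set (extChartAt_target_eventuallyEq_of_mem hu)]
  rfl

/-- The change of charts for the expressions of a form. -/
theorem chartRep_eq_comp_fderivWithin (η : DiffForm I M m) {x₀ y : M} {z : E}
    (hz : z ∈ (extChartAt I x₀).target) (hz' : (extChartAt I x₀).symm z ∈ (extChartAt I y).source) :
    chartRep η x₀ z = (chartRep η y ((extChartAt I y ∘ (extChartAt I x₀).symm) z)).compContinuousLinearMap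
      (fderivWithin ℝ (extChartAt I y ∘ (extChartAt I x₀).symm) (range I) z) := by
  have _ : IsManifold I 1 M := IsManifold.of_le (n := ∞) (by exact_mod_cast le_top)
  rw [chartRep_eq_pullbackWithin η x₀, pullbackWithin_eq_chartRep
    (I.uniqueDiffOn _ (extChartAt_target_subset_range x₀ hz))
    (mdifferentiableWithinAt_extChartAt_symm hz) hz']
  rfl

end Functoriality

/-! ### Integrals in charts and their changes of coordinates -/

section ChartIntegral

variable {k : ℕ} {N : Type*} [TopologicalSpace N] [ChartedSpace (EuclideanHalfSpace (k + 1)) N]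

theorem sign_mul_eq (a b : ℝ) : Real.sign (a * b) = Real.sign a * Real.sign b := by
  rcases lt_trichotomy a 0 with ha | rfl | ha <;> rcases lt_trichotomy b 0 with hb | rfl | hb <;>
    simp [Real.sign_of_neg, Real.sign_of_pos, mul_pos_of_neg_of_neg, mul_neg_of_neg_of_pos,
      mul_neg_of_pos_of_neg, *]

theorem sign_mul_self_eq_abs (a : ℝ) : Real.sign a * a = |a| := by
  rcases lt_trichotomy a 0 with ha | rfl | ha
  · simp [Real.sign_of_neg ha, abs_of_neg ha]
  · simp
  · simp [Real.sign_of_pos ha, abs_of_pos ha]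

theorem continuousAt_sign {a : ℝ} (ha : a ≠ 0) : ContinuousAt Real.sign a := by
  rcases lt_or_gt_of_ne ha with h | h
  · exact (continuousAt_const (y := (-1 : ℝ))).congr
      (by filter_upwards [eventually_lt_nhds h] with x hx using (Real.sign_of_neg hx).symm)
  · exact (continuousAt_const (y := (1 : ℝ))).congr
      (by filter_upwards [eventually_gt_nhds h] with x hx using (Real.sign_of_pos hx).symm)

/-- A linear map acts on forms of top degree by its determinant. -/
theorem form_comp_coordVec
    (θ : (EuclideanSpace ℝ (Fin (k + 1))) [⋀^Fin (k + 1)]→L[ℝ] ℝ)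
    (B : EuclideanSpace ℝ (Fin (k + 1)) →L[ℝ] EuclideanSpace ℝ (Fin (k + 1))) :
    (θ.compContinuousLinearMap B) coordVec = B.det * θ coordVec := by
  set e := (EuclideanSpace.basisFun (Fin (k + 1)) ℝ).toBasis with he
  have hc : (coordVec : Fin (k + 1) → EuclideanSpace ℝ (Fin (k + 1))) = e := by
    funext i
    simp [coordVec, he]
  have h1 := AlternatingMap.eq_smul_basis_det e θ.toAlternatingMap
  have h2 : ∀ w, θ w = θ e * e.det w := fun w => congrArg (fun f => f w) h1
  rw [ContinuousAlternatingMap.compContinuousLinearMap_apply, hc, h2 (B ∘ e)]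
  have h3 := e.det_comp (B : EuclideanSpace ℝ (Fin (k + 1)) →ₗ[ℝ] EuclideanSpace ℝ (Fin (k + 1))) e
  have h4 : e.det (B ∘ e) = B.det * e.det e := h3
  rw [h4, e.det_self]
  ring

/-- The integral over the domain of the chart at `p` of a form of top degree, oriented by `μ`. -/
def chartIntegral (μ : DiffForm (𝓡∂ (k + 1)) N (k + 1)) (p : N)
    (ζ : DiffForm (𝓡∂ (k + 1)) N (k + 1)) : ℝ :=
  ∫ u in (extChartAt (𝓡∂ (k + 1)) p).target, chartSign μ p u * chartRep ζ p u coordVec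

theorem chartRep_eq_zero {m : ℕ} {ζ : DiffForm (𝓡∂ (k + 1)) N m} {p : N}
    {u : EuclideanSpace ℝ (Fin (k + 1))}
    (h : ζ ((extChartAt (𝓡∂ (k + 1)) p).symm u) = 0) : chartRep ζ p u = 0 := by
  rw [chartRep, h]
  rfl

theorem measurableSet_extChartAt_target (p : N) :
    MeasurableSet (extChartAt (𝓡∂ (k + 1)) p).target := by
  rw [extChartAt_target]
  exact (((chartAt _ p).open_target.preimage (𝓡∂ (k + 1)).continuous_symm).measurableSet).inter
    (𝓡∂ (k + 1)).isClosed_range.measurableSet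

theorem chartRep_sum_apply {ι : Type*} (s : Finset ι) {m : ℕ}
    (ζ : ι → DiffForm (𝓡∂ (k + 1)) N m) (p : N) (u : EuclideanSpace ℝ (Fin (k + 1)))
    (v : Fin m → EuclideanSpace ℝ (Fin (k + 1))) :
    chartRep (fun x => ∑ i ∈ s, ζ i x) p u v = ∑ i ∈ s, chartRep (ζ i) p u v :=
  ContinuousAlternatingMap.sum_apply (M := EuclideanSpace ℝ (Fin (k + 1))) (R := ℝ) (N := ℝ)
    (fun i => modelForm (ζ i) ((extChartAt (𝓡∂ (k + 1)) p).symm u)) (s := s) _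

variable [IsManifold (𝓡∂ (k + 1)) ∞ N]

/-- The sign in `chartSign` turns the determinant of the change of charts into its absolute value. -/
theorem chartSign_mul_chartRep (μ ζ : DiffForm (𝓡∂ (k + 1)) N (k + 1)) {p q : N}
    {z : EuclideanSpace ℝ (Fin (k + 1))} (hz : z ∈ (extChartAt (𝓡∂ (k + 1)) p).target)
    (hz' : (extChartAt (𝓡∂ (k + 1)) p).symm z ∈ (extChartAt (𝓡∂ (k + 1)) q).source) :
    chartSign μ p z * chartRep ζ p z coordVec =
      |(fderivWithin ℝ (extChartAt (𝓡∂ (k + 1)) q ∘ (extChartAt (𝓡∂ (k + 1)) p).symm)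
        (range (𝓡∂ (k + 1))) z).det| *
      (chartSign μ q ((extChartAt (𝓡∂ (k + 1)) q ∘ (extChartAt (𝓡∂ (k + 1)) p).symm) z) *
      chartRep ζ q ((extChartAt (𝓡∂ (k + 1)) q ∘ (extChartAt (𝓡∂ (k + 1)) p).symm) z)
        coordVec) := by
  rw [chartSign, chartRep_eq_comp_fderivWithin μ hz hz', chartRep_eq_comp_fderivWithin ζ hz hz',
    form_comp_coordVec, form_comp_coordVec, sign_mul_eq, ← sign_mul_self_eq_abs, chartSign]
  ring

/-- The integral of a form does not depend on the chart, if the form vanishes outside both. -/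
theorem chartIntegral_eq_chartIntegral (μ : DiffForm (𝓡∂ (k + 1)) N (k + 1)) {p q : N}
    {ζ : DiffForm (𝓡∂ (k + 1)) N (k + 1)}
    (hp : ∀ x, x ∉ (extChartAt (𝓡∂ (k + 1)) p).source → ζ x = 0)
    (hq : ∀ x, x ∉ (extChartAt (𝓡∂ (k + 1)) q).source → ζ x = 0) :
    chartIntegral μ p ζ = chartIntegral μ q ζ := by
  set ep := extChartAt (𝓡∂ (k + 1)) p with hep
  set eq := extChartAt (𝓡∂ (k + 1)) q with heq
  set S := (ep.symm ≫ eq).source with hS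
  set τ : EuclideanSpace ℝ (Fin (k + 1)) → EuclideanSpace ℝ (Fin (k + 1)) := eq ∘ ep.symm with hτ
  have hSmem : ∀ z, z ∈ S ↔ z ∈ ep.target ∧ ep.symm z ∈ eq.source := fun z => by
    simp [hS]
  have himage : τ '' S = (eq.symm ≫ ep).source := by
    have h1 := (ep.symm ≫ eq).image_source_eq_target
    have h2 : (eq.symm ≫ ep).source = (ep.symm ≫ eq).target := by
      rw [← PartialEquiv.symm_source, PartialEquiv.trans_symm_eq_symm_trans_symm,
        PartialEquiv.symm_symm]
    rw [h2, ← h1]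
    rfl
  have hTmem : ∀ z, z ∈ τ '' S ↔ z ∈ eq.target ∧ eq.symm z ∈ ep.source := fun z => by
    rw [himage]
    simp
  have hSmeas : MeasurableSet S := by
    have h1 : S = (𝓡∂ (k + 1)) '' ((chartAt _ p).symm ≫ₕ chartAt _ q).source :=
      ext_coord_change_source (I := 𝓡∂ (k + 1)) q p
    rw [h1, (𝓡∂ (k + 1)).image_eq]
    exact (((OpenPartialHomeomorph.open_source _).preimage
      (𝓡∂ (k + 1)).continuous_symm).measurableSet).inter
      (𝓡∂ (k + 1)).isClosed_range.measurableSet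
  have h1 : chartIntegral μ p ζ =
      ∫ u in S, chartSign μ p u * chartRep ζ p u coordVec := by
    refine setIntegral_eq_of_subset_of_forall_sdiff_eq_zero (measurableSet_extChartAt_target p)
      (fun z hz => ((hSmem z).1 hz).1) fun z hz => ?_
    rw [chartRep_eq_zero (hq _ fun h => hz.2 ((hSmem z).2 ⟨hz.1, h⟩))]
    simp
  have h2 : chartIntegral μ q ζ =
      ∫ u in τ '' S, chartSign μ q u * chartRep ζ q u coordVec := by
    refine setIntegral_eq_of_subset_of_forall_sdiff_eq_zero (measurableSet_extChartAt_target q)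
      (fun z hz => ((hTmem z).1 hz).1) fun z hz => ?_
    rw [chartRep_eq_zero (hp _ fun h => hz.2 ((hTmem z).2 ⟨hz.1, h⟩))]
    simp
  have hdiff : ∀ z ∈ S, HasFDerivWithinAt τ (fderivWithin ℝ τ (range (𝓡∂ (k + 1))) z) S z := by
    intro z hz
    have h3 : ContDiffWithinAt ℝ ∞ τ (range (𝓡∂ (k + 1))) z :=
      contDiffWithinAt_ext_coord_change (I := 𝓡∂ (k + 1)) q p hz
    exact ((h3.differentiableWithinAt (by simp)).hasFDerivWithinAt).mono fun w hw =>
      extChartAt_target_subset_range p ((hSmem w).1 hw).1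
  rw [h1, h2, integral_image_eq_integral_abs_det_fderiv_smul volume hSmeas hdiff
    (ep.symm ≫ eq).injOn]
  refine setIntegral_congr_fun hSmeas fun z hz => ?_
  exact chartSign_mul_chartRep μ ζ ((hSmem z).1 hz).1 ((hSmem z).1 hz).2

theorem continuousOn_chartSign {μ : DiffForm (𝓡∂ (k + 1)) N (k + 1)} (hμ : IsOrientationForm μ)
    (p : N) : ContinuousOn (chartSign μ p) (extChartAt (𝓡∂ (k + 1)) p).target := by
  have _ : IsManifold (𝓡∂ (k + 1)) 1 N := IsManifold.of_le (n := ∞) (by exact_mod_cast le_top)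
  have h1 : ContinuousOn (fun u => chartRep μ p u coordVec) (extChartAt (𝓡∂ (k + 1)) p).target :=
    continuous_apply_form (hμ.1 p).continuousOn _
  intro u hu
  refine (continuousAt_sign fun h0 => ?_).comp_continuousWithinAt (h1 u hu)
  -- a form of top degree which vanishes on a basis is zero, also before the passage to the chart
  have h2 : chartRep μ p u = 0 := by
    set e := (EuclideanSpace.basisFun (Fin (k + 1)) ℝ).toBasis with he
    have hc : (coordVec : Fin (k + 1) → EuclideanSpace ℝ (Fin (k + 1))) = e := by
      funext i
      simp [coordVec, he]
    have h3 := AlternatingMap.eq_smul_basis_det e (chartRep μ p u).toAlternatingMap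
    ext w
    have h4 : chartRep μ p u w = chartRep μ p u e * e.det w := congrArg (fun f => f w) h3
    rw [h4, ← hc, h0]
    simp
  refine hμ.2 ((extChartAt (𝓡∂ (k + 1)) p).symm u) ?_
  obtain ⟨L, hL⟩ : ∃ L : EuclideanSpace ℝ (Fin (k + 1)) ≃L[ℝ] EuclideanSpace ℝ (Fin (k + 1)),
      (L : EuclideanSpace ℝ (Fin (k + 1)) →L[ℝ] EuclideanSpace ℝ (Fin (k + 1))) =
        mfderivWithin 𝓘(ℝ, EuclideanSpace ℝ (Fin (k + 1))) (𝓡∂ (k + 1))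
          (extChartAt (𝓡∂ (k + 1)) p).symm (range (𝓡∂ (k + 1))) u :=
    isInvertible_mfderivWithin_extChartAt_symm (I := 𝓡∂ (k + 1)) hu
  have h5 : ∀ w : Fin (k + 1) → EuclideanSpace ℝ (Fin (k + 1)), modelForm μ ((extChartAt (𝓡∂ (k + 1)) p).symm u)
      (fun i => L (w i)) = 0 := by
    intro w
    have h6 : chartRep μ p u w = modelForm μ ((extChartAt (𝓡∂ (k + 1)) p).symm u)
        (fun i => (mfderivWithin 𝓘(ℝ, EuclideanSpace ℝ (Fin (k + 1))) (𝓡∂ (k + 1))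
          (extChartAt (𝓡∂ (k + 1)) p).symm (range (𝓡∂ (k + 1))) u :
          EuclideanSpace ℝ (Fin (k + 1)) →L[ℝ] EuclideanSpace ℝ (Fin (k + 1))) (w i)) := rfl
    rw [← hL, h2] at h6
    exact h6.symm
  refine ContinuousAlternatingMap.ext
    fun (w : Fin (k + 1) → EuclideanSpace ℝ (Fin (k + 1))) => ?_
  have h7 := h5 fun i => L.symm (w i)
  have h8 : (fun i => L (L.symm (w i))) = w := funext fun i => L.apply_symm_apply (w i)
  rw [← h8]
  exact h7

/-- A continuous form with compact support in the domain of a chart has an integral there. -/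
theorem integrableOn_chartIntegrand {μ : DiffForm (𝓡∂ (k + 1)) N (k + 1)}
    (hμ : IsOrientationForm μ) {p : N} {ζ : DiffForm (𝓡∂ (k + 1)) N (k + 1)}
    (hζ : IsContDiffForm 0 ζ) {K : Set N} (hK : IsCompact K)
    (hKp : K ⊆ (extChartAt (𝓡∂ (k + 1)) p).source) (hζK : ∀ x, x ∉ K → ζ x = 0) :
    IntegrableOn (fun u => chartSign μ p u * chartRep ζ p u coordVec)
      (extChartAt (𝓡∂ (k + 1)) p).target := by
  set K' := extChartAt (𝓡∂ (k + 1)) p '' K with hK'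
  have hK'c : IsCompact K' := hK.image_of_continuousOn ((continuousOn_extChartAt p).mono hKp)
  have hK't : K' ⊆ (extChartAt (𝓡∂ (k + 1)) p).target := by
    rintro _ ⟨x, hx, rfl⟩
    exact (extChartAt (𝓡∂ (k + 1)) p).map_source (hKp hx)
  have h1 : IntegrableOn (fun u => chartSign μ p u * chartRep ζ p u coordVec) K' :=
    (((continuousOn_chartSign hμ p).mul
      (continuous_apply_form (hζ p).continuousOn _)).mono hK't).integrableOn_compact hK'c
  refine h1.of_forall_sdiff_eq_zero (measurableSet_extChartAt_target p) fun u hu => ?_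
  rw [chartRep_eq_zero (hζK _ fun h => hu.2 ⟨_, h, (extChartAt (𝓡∂ (k + 1)) p).right_inv hu.1⟩)]
  simp

theorem chartIntegral_sum {ι : Type*} (s : Finset ι) {μ : DiffForm (𝓡∂ (k + 1)) N (k + 1)}
    {p : N} {ζ : ι → DiffForm (𝓡∂ (k + 1)) N (k + 1)}
    (hi : ∀ i ∈ s, IntegrableOn (fun u => chartSign μ p u * chartRep (ζ i) p u coordVec)
      (extChartAt (𝓡∂ (k + 1)) p).target) :
    ∑ i ∈ s, chartIntegral μ p (ζ i) = chartIntegral μ p (fun x => ∑ i ∈ s, ζ i x) := by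
  simp only [chartIntegral]
  rw [← integral_finsetSum s hi]
  refine setIntegral_congr_fun (measurableSet_extChartAt_target p) fun u hu => ?_
  simp only [← Finset.mul_sum]
  congr 1
  exact (chartRep_sum_apply s ζ p u coordVec).symm

end ChartIntegral

/-! ### The differentials of a partition of unity -/

section PartitionOfUnity

variable {k : ℕ} {N : Type*} [TopologicalSpace N] [ChartedSpace (EuclideanHalfSpace (k + 1)) N]
  [CompactSpace N] [T2Space N] [IsManifold (𝓡∂ (k + 1)) ∞ N]

theorem tsupport_chartPartition_subset (p : N) :
    tsupport (chartPartition k N p) ⊆ (extChartAt (𝓡∂ (k + 1)) p).source := by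
  rw [extChartAt_source]
  exact (SmoothPartitionOfUnity.exists_isSubordinate_chartAt_source (𝓡∂ (k + 1)) N).choose_spec p

variable (k N) in
theorem finite_support_chartPartition_nonempty :
    {p : N | (Function.support (chartPartition k N p)).Nonempty}.Finite :=
  (chartPartition k N).locallyFinite.finite_nonempty_of_compact

variable (k N) in
/-- The finite set of the points `p` for which the function of index `p` of the partition of unity
is not zero. -/
def chartPoints : Finset N := (finite_support_chartPartition_nonempty k N).toFinset

theorem chartPartition_eq_zero {p : N} (hp : p ∉ chartPoints k N) (x : N) :
    chartPartition k N p x = 0 := by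
  by_contra h
  exact hp ((finite_support_chartPartition_nonempty k N).mem_toFinset.2 ⟨x, h⟩)

theorem sum_chartPartition (x : N) : ∑ p ∈ chartPoints k N, chartPartition k N p x = 1 := by
  rw [← (chartPartition k N).sum_eq_one (mem_univ x)]
  refine (finsum_eq_sum_of_support_subset _ fun p hp => ?_).symm
  by_contra h
  exact hp (chartPartition_eq_zero h x)

theorem contMDiff_chartPartition (p : N) :
    ContMDiff (𝓡∂ (k + 1)) 𝓘(ℝ, ℝ) 1 (chartPartition k N p) :=
  (chartPartition k N p).contMDiff.of_le (by exact_mod_cast le_top)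

/-- The differential of a function of the partition of unity, as a covector on the model space. -/
def partitionDeriv (p x : N) : EuclideanSpace ℝ (Fin (k + 1)) →L[ℝ] ℝ :=
  mfderiv (𝓡∂ (k + 1)) 𝓘(ℝ, ℝ) (chartPartition k N p) x

theorem sum_partitionDeriv (x : N) :
    ∑ p ∈ chartPoints k N, partitionDeriv (k := k) p x = 0 := by
  have h1 : ∀ (s : Finset N) (f : N → ℝ) (L : EuclideanSpace ℝ (Fin (k + 1)) →L[ℝ] ℝ),
      (f = fun y => ∑ p ∈ s, chartPartition k N p y) →
      L = ∑ p ∈ s, partitionDeriv (k := k) p x →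
      HasMFDerivAt (𝓡∂ (k + 1)) 𝓘(ℝ, ℝ) f x L := by
    intro s
    classical
    induction s using Finset.induction_on with
    | empty =>
      rintro f L rfl rfl
      exact hasMFDerivAt_const (0 : ℝ) x
    | insert a s ha ih =>
      intro f L hf hL
      simp only [Finset.sum_insert ha] at hf hL
      rw [hf, hL]
      exact (((contMDiff_chartPartition a).mdifferentiable one_ne_zero x).hasMFDerivAt).add
        (ih _ _ rfl rfl)
  have h2 : (fun y => ∑ p ∈ chartPoints k N, chartPartition k N p y) = fun _ => (1 : ℝ) :=
    funext sum_chartPartition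
  exact hasMFDerivAt_unique (h1 (chartPoints k N) _ _ h2.symm rfl)
    (hasMFDerivAt_const (1 : ℝ) x)

theorem wedgeForm_eq_zero_of_notMem_tsupport {m : ℕ} {p x : N}
    (hx : x ∉ tsupport (chartPartition k N p)) (θ : DiffForm (𝓡∂ (k + 1)) N m) :
    wedgeForm (chartPartition k N p) θ x = 0 := by
  have h1 : (chartPartition k N p : N → ℝ) =ᶠ[𝓝 x] fun _ => 0 :=
    notMem_tsupport_iff_eventuallyEq.1 hx
  have h2 : mfderiv (𝓡∂ (k + 1)) 𝓘(ℝ, ℝ) (chartPartition k N p) x = 0 := by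
    rw [h1.mfderiv_eq]
    exact mfderiv_const
  rw [wedgeForm, h2]
  exact wedgeOne_zero _

/-- Since the functions of a partition of unity add up to a constant, their differentials
contribute nothing to an integral. Each of the terms lives in its own chart, and a second copy of the
partition of unity moves them all to common charts. -/
theorem sum_chartIntegral_wedgeForm {μ : DiffForm (𝓡∂ (k + 1)) N (k + 1)}
    (hμ : IsOrientationForm μ) {θ : DiffForm (𝓡∂ (k + 1)) N k} (hθ : IsContDiffForm 0 θ) :
    ∑ p ∈ chartPoints k N, chartIntegral μ p (wedgeForm (chartPartition k N p) θ) = 0 := by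
  set ζ : N → DiffForm (𝓡∂ (k + 1)) N (k + 1) := fun p =>
    wedgeForm (chartPartition k N p) θ with hζ
  set ζ' : N → N → DiffForm (𝓡∂ (k + 1)) N (k + 1) := fun q p x =>
    chartPartition k N q x • ζ p x with hζ'
  have hζ'c : ∀ q p, IsContDiffForm 0 (ζ' q p) := fun q p =>
    (hθ.wedgeForm (contMDiff_chartPartition p)).smul_function
      (chartPartition k N q).contMDiff.continuous
  have hp0 : ∀ q p x, x ∉ tsupport (chartPartition k N p) → ζ' q p x = 0 := fun q p x hx => by
    simp only [hζ', hζ, wedgeForm_eq_zero_of_notMem_tsupport hx, smul_zero]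
  have hq0 : ∀ q p x, x ∉ tsupport (chartPartition k N q) → ζ' q p x = 0 := fun q p x hx => by
    simp only [hζ', image_eq_zero_of_notMem_tsupport hx, zero_smul]
  have hcomp : ∀ p : N, IsCompact (tsupport (chartPartition k N p)) := fun p =>
    (isClosed_tsupport _).isCompact
  have h1 : ∀ p, chartIntegral μ p (ζ p) =
      ∑ q ∈ chartPoints k N, chartIntegral μ q (ζ' q p) := by
    intro p
    have h2 : ζ p = fun x => ∑ q ∈ chartPoints k N, ζ' q p x := by
      funext x
      simp only [hζ', ← Finset.sum_smul, sum_chartPartition, one_smul]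
    rw [h2, ← chartIntegral_sum _ fun q _ => integrableOn_chartIntegrand hμ (hζ'c q p) (hcomp p)
      (tsupport_chartPartition_subset p) (hp0 q p)]
    exact Finset.sum_congr rfl fun q _ => chartIntegral_eq_chartIntegral μ
      (fun x hx => hp0 q p x fun h => hx (tsupport_chartPartition_subset p h))
      (fun x hx => hq0 q p x fun h => hx (tsupport_chartPartition_subset q h))
  rw [Finset.sum_congr rfl fun p _ => h1 p, Finset.sum_comm]
  refine Finset.sum_eq_zero fun q _ => ?_
  rw [chartIntegral_sum _ fun p _ => integrableOn_chartIntegrand hμ (hζ'c q p) (hcomp q)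
      (tsupport_chartPartition_subset q) (hq0 q p)]
  have h3 : ∀ x, ∑ p ∈ chartPoints k N, ζ' q p x = 0 := by
    intro x
    refine ContinuousAlternatingMap.ext fun w => ?_
    have h4 := congrArg (fun L => wedgeOne L (modelForm θ x) w) (sum_partitionDeriv (k := k) x)
    have h5 : ∀ (s : Finset N) (L : N → EuclideanSpace ℝ (Fin (k + 1)) →L[ℝ] ℝ),
        wedgeOne (∑ p ∈ s, L p) (modelForm θ x) w = ∑ p ∈ s, wedgeOne (L p) (modelForm θ x) w := by
      intro s L
      classical
      induction s using Finset.induction_on with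
      | empty => rw [Finset.sum_empty, Finset.sum_empty, wedgeOne_zero]; rfl
      | insert a s ha ih => rw [Finset.sum_insert ha, Finset.sum_insert ha, wedgeOne_add, ← ih]; rfl
    simp only [h5, wedgeOne_zero] at h4
    simp only [hζ', ← Finset.smul_sum, ContinuousAlternatingMap.smul_apply,
      ContinuousAlternatingMap.sum_apply]
    have h6 : ∑ p ∈ chartPoints k N, (ζ p x) w = 0 := h4
    rw [h6]
    simp
  simp only [chartIntegral, h3]
  refine setIntegral_eq_zero_of_forall_eq_zero fun u _ => ?_
  rw [chartRep_eq_zero rfl]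
  simp

end PartitionOfUnity

/-! ### Pullback of forms under a flow -/

section FlowPullback

variable {E : Type*} [NormedAddCommGroup E] [NormedSpace ℝ E]
  {H : Type*} [TopologicalSpace H] {I : ModelWithCorners ℝ E H}
  {M : Type*} [TopologicalSpace M] [ChartedSpace H M]
  {Y : Type*} [NormedAddCommGroup Y] [NormedSpace ℝ Y]
  {V : ℝ → VField I M} {φ : ℝ → ℝ → M → M}

/-- The trajectories which pass at time `t₀` through the points of a parametrized set. -/
def trajectory (φ : ℝ → ℝ → M → M) (t₀ : ℝ) (G : Y → M) (z : ℝ × Y) : M := φ z.1 t₀ (G z.2)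

theorem IsFlow.contMDiffOn_trajectory (hφ : IsFlow V φ) (t₀ : ℝ) {G : Y → M} {T : Set Y}
    (hG : ContMDiffOn 𝓘(ℝ, Y) I 1 G T) :
    ContMDiffOn 𝓘(ℝ, ℝ × Y) I 1 (trajectory φ t₀ G) (univ ×ˢ T) := by
  have h1 : ContMDiffOn 𝓘(ℝ, ℝ × Y) 𝓘(ℝ, ℝ) 1 (fun z : ℝ × Y => z.1) (univ ×ˢ T) :=
    contDiff_fst.contMDiff.contMDiffOn
  have h2 : ContMDiffOn 𝓘(ℝ, ℝ × Y) I 1 (fun z : ℝ × Y => G z.2) (univ ×ˢ T) :=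
    hG.comp (contDiff_snd.contMDiff.contMDiffOn (I := 𝓘(ℝ, ℝ × Y)) (I' := 𝓘(ℝ, Y)))
      fun z hz => hz.2
  exact hφ.contMDiff.comp_contMDiffOn ((h1.prodMk contMDiffOn_const).prodMk h2)

theorem IsFlow.mdifferentiableWithinAt_trajectory (hφ : IsFlow V φ) (t₀ : ℝ) {G : Y → M}
    {T : Set Y} {y : Y} (hG : MDifferentiableWithinAt 𝓘(ℝ, Y) I G T y) (s : ℝ) :
    MDifferentiableWithinAt 𝓘(ℝ, ℝ × Y) I (trajectory φ t₀ G) (univ ×ˢ T) (s, y) := by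
  have h1 : MDifferentiableWithinAt 𝓘(ℝ, ℝ × Y) 𝓘(ℝ, ℝ) (fun z : ℝ × Y => z.1) (univ ×ˢ T)
      (s, y) := mdifferentiableWithinAt_iff_differentiableWithinAt.2 differentiableWithinAt_fst
  have h2 : MDifferentiableWithinAt 𝓘(ℝ, ℝ × Y) I (fun z : ℝ × Y => G z.2) (univ ×ˢ T) (s, y) :=
    MDifferentiableWithinAt.comp (g := G) (f := fun z : ℝ × Y => z.2) (s, y) hG
      (mdifferentiableWithinAt_iff_differentiableWithinAt.2 differentiableWithinAt_snd)
      fun z hz => hz.2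
  exact ((hφ.contMDiff.mdifferentiable one_ne_zero _).comp_mdifferentiableWithinAt (s, y)
    ((h1.prodMk mdifferentiableWithinAt_const).prodMk h2))

theorem IsFlow.mfderivWithin_trajectory_time (hφ : IsFlow V φ) (t₀ : ℝ) {G : Y → M}
    {T : Set Y} {y : Y} (hy : y ∈ T) (hG : MDifferentiableWithinAt 𝓘(ℝ, Y) I G T y) (s : ℝ) :
    (mfderivWithin 𝓘(ℝ, ℝ × Y) I (trajectory φ t₀ G) (univ ×ˢ T) (s, y) : ℝ × Y →L[ℝ] E) (1, 0) =
      V s (φ s t₀ (G y)) := by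
  have h1 : HasMFDerivWithinAt 𝓘(ℝ, ℝ) 𝓘(ℝ, ℝ × Y) (fun c : ℝ => (c, y)) univ s
      (ContinuousLinearMap.inl ℝ ℝ Y) :=
    (hasFDerivAt_prodMk_left s y).hasFDerivWithinAt.hasMFDerivWithinAt
  have hst : (univ : Set ℝ) ⊆ (fun c : ℝ => (c, y)) ⁻¹' (univ ×ˢ T) :=
    fun c _ => ⟨mem_univ _, hy⟩
  have h0 := (hφ.mdifferentiableWithinAt_trajectory t₀ hG s).hasMFDerivWithinAt
  have h2 := HasMFDerivWithinAt.comp (f := fun c : ℝ => (c, y)) s h0 h1 hst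
  rw [hasMFDerivWithinAt_univ] at h2
  have h3 := hasMFDerivAt_unique h2 (hφ.hasMFDerivAt s t₀ (G y))
  have h4 := congrArg (fun L : ℝ →L[ℝ] E => L 1) h3
  refine Eq.trans ?_ (h4.trans (one_smul ℝ _))
  rfl

theorem IsFlow.mfderivWithin_trajectory_space (hφ : IsFlow V φ) (t₀ : ℝ) {G : Y → M}
    {T : Set Y} {y : Y} (hT : UniqueDiffWithinAt ℝ T y)
    (hG : MDifferentiableWithinAt 𝓘(ℝ, Y) I G T y) (s : ℝ) (w : Y) :
    (mfderivWithin 𝓘(ℝ, ℝ × Y) I (trajectory φ t₀ G) (univ ×ˢ T) (s, y) : ℝ × Y →L[ℝ] E) (0, w) =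
      (mfderivWithin 𝓘(ℝ, Y) I (φ s t₀ ∘ G) T y : Y →L[ℝ] E) w := by
  have h1 : HasMFDerivWithinAt 𝓘(ℝ, Y) 𝓘(ℝ, ℝ × Y) (fun c : Y => (s, c)) T y
      (ContinuousLinearMap.inr ℝ ℝ Y) :=
    (hasFDerivAt_prodMk_right s y).hasFDerivWithinAt.hasMFDerivWithinAt
  have hst : T ⊆ (fun c : Y => (s, c)) ⁻¹' (univ ×ˢ T) := fun c hc => ⟨mem_univ _, hc⟩
  have h0 := (hφ.mdifferentiableWithinAt_trajectory t₀ hG s).hasMFDerivWithinAt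
  have h2 := HasMFDerivWithinAt.comp (f := fun c : Y => (s, c)) y h0 h1 hst
  have h3 := h2.mfderivWithin hT.uniqueMDiffWithinAt
  exact (congrArg (fun L : Y →L[ℝ] E => L w) h3).symm

theorem IsFlow.pullbackWithin_trajectory_space (hφ : IsFlow V φ) (t₀ : ℝ) {G : Y → M}
    {T : Set Y} {y : Y} (hT : UniqueDiffWithinAt ℝ T y)
    (hG : MDifferentiableWithinAt 𝓘(ℝ, Y) I G T y) (s : ℝ) {m : ℕ} (η : DiffForm I M m)
    (w : Fin m → Y) :
    pullbackWithin (trajectory φ t₀ G) (univ ×ˢ T) η (s, y) (fun i => (0, w i)) =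
      pullbackWithin (φ s t₀ ∘ G) T η y w := by
  refine congrArg (modelForm η (φ s t₀ (G y))) (funext fun i => ?_)
  exact hφ.mfderivWithin_trajectory_space t₀ hT hG s (w i)

/-- The contraction with the time direction amounts to the interior product by the velocity. -/
theorem IsFlow.pullbackWithin_trajectory_time (hφ : IsFlow V φ) (t₀ : ℝ) {G : Y → M}
    {T : Set Y} {y : Y} (hy : y ∈ T) (hT : UniqueDiffWithinAt ℝ T y)
    (hG : MDifferentiableWithinAt 𝓘(ℝ, Y) I G T y) (s : ℝ) {m : ℕ} (η : DiffForm I M (m + 1))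
    (w : Fin m → Y) :
    pullbackWithin (trajectory φ t₀ G) (univ ×ˢ T) η (s, y)
        (Fin.cons (1, 0) fun i => (0, w i)) =
      pullbackWithin (φ s t₀ ∘ G) T (interiorProd (V s) η) y w := by
  refine congrArg (modelForm η (φ s t₀ (G y))) (funext fun i => ?_)
  refine Fin.cases ?_ (fun j => ?_) i
  · exact hφ.mfderivWithin_trajectory_time t₀ hy hG s
  · exact hφ.mfderivWithin_trajectory_space t₀ hT hG s (w j)

variable [IsManifold I ∞ M]

/-- The velocity field of a `C^1` flow is continuous, and so are the interior products by it. -/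
theorem IsFlow.isContDiffForm_interiorProd (hφ : IsFlow V φ) (s : ℝ) {m : ℕ}
    {η : DiffForm I M (m + 1)} (hη : IsContDiffForm 0 η) :
    IsContDiffForm 0 (interiorProd (V s) η) := by
  have _ : IsManifold I 1 M := IsManifold.of_le (n := ∞) (by exact_mod_cast le_top)
  intro x₀
  refine contDiffOn_zero.2 ?_
  -- the velocity at time `s` is the time derivative at `s` of the trajectories issued at time `s`
  set e := extChartAt I x₀ with he
  have hsub := extChartAt_target_subset_range (I := I) x₀
  have h1 : ContMDiffOn 𝓘(ℝ, ℝ × E) I 1 (trajectory φ s e.symm) (univ ×ˢ e.target) :=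
    hφ.contMDiffOn_trajectory s (contMDiffOn_extChartAt_symm x₀)
  have h2 : ContinuousOn (pullbackWithin (trajectory φ s e.symm) (univ ×ˢ range I) η)
      (univ ×ˢ e.target) := by
    refine continuousOn_pullbackWithin (uniqueDiffOn_univ.prod I.uniqueDiffOn)
      (prod_mono_right hsub) (fun z hz => ?_) h1 hη
    rw [show z = (z.1, z.2) from rfl, nhdsWithin_prod_eq]
    exact Filter.prod_mem_prod self_mem_nhdsWithin (extChartAt_target_mem_nhdsWithin_of_mem hz.2)
  have h3 : ContinuousOn (fun u : E => pullbackWithin (trajectory φ s e.symm) (univ ×ˢ range I) η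
      (s, u)) e.target :=
    h2.comp (by fun_prop) fun u hu => ⟨mem_univ _, hu⟩
  have h4 : Continuous fun θ : (ℝ × E) [⋀^Fin (m + 1)]→L[ℝ] ℝ =>
      (θ.curryLeft (1, 0)).compContinuousLinearMap (ContinuousLinearMap.inr ℝ ℝ E) := by
    have h5 : Continuous fun θ : (ℝ × E) [⋀^Fin (m + 1)]→L[ℝ] ℝ => θ.curryLeft (1, 0) := by
      have := (ContinuousAlternatingMap.curryLeftLI (𝕜 := ℝ) (E := ℝ × E) (F := ℝ)
        (n := m)).continuous
      exact this.clm_apply continuous_const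
    exact continuous_compContinuousLinearMap.comp (h5.prodMk continuous_const)
  refine (h4.comp_continuousOn h3).congr fun u hu => ?_
  ext w
  have h6 := hφ.pullbackWithin_trajectory_time s (hsub hu) (I.uniqueDiffOn _ (hsub hu))
    (mdifferentiableWithinAt_extChartAt_symm hu) s η w
  have h7 : φ s s ∘ e.symm = e.symm := funext fun u => hφ.self s _
  rw [h7] at h6
  exact h6.symm

end FlowPullback

/-! ### The charts of the submanifold as boxes -/

section ChartBox

/-- The lower corner of the box `[0, R] × [-R, R]^k` of the half space. -/
def halfBoxLower (k : ℕ) (R : ℝ) : Fin (k + 1) → ℝ := Fin.cons 0 fun _ => -R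

/-- The upper corner of the box `[0, R] × [-R, R]^k` of the half space. -/
def halfBoxUpper (k : ℕ) (R : ℝ) : Fin (k + 1) → ℝ := fun _ => R

theorem halfBoxLower_lt {k : ℕ} {R : ℝ} (hR : 0 < R) (i : Fin (k + 1)) :
    halfBoxLower k R i < halfBoxUpper k R i := by
  refine Fin.cases ?_ (fun j => ?_) i
  · exact hR
  · simp only [halfBoxLower, halfBoxUpper, Fin.cons_succ]
    linarith

/-- The identity from the coordinate space `Fin (k + 1) → ℝ` to the Euclidean space. -/
def coordMap (k : ℕ) : (Fin (k + 1) → ℝ) →L[ℝ] EuclideanSpace ℝ (Fin (k + 1)) :=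
  ((EuclideanSpace.equiv (Fin (k + 1)) ℝ).symm :
    (Fin (k + 1) → ℝ) →L[ℝ] EuclideanSpace ℝ (Fin (k + 1)))

theorem mem_range_halfSpace {k : ℕ} {u : EuclideanSpace ℝ (Fin (k + 1))} :
    u ∈ range (𝓡∂ (k + 1)) ↔ 0 ≤ u 0 := by
  rw [range_modelWithCornersEuclideanHalfSpace]
  rfl

theorem halfBox_subset {k : ℕ} {R : ℝ} :
    Icc (halfBoxLower k R) (halfBoxUpper k R) ⊆ coordMap k ⁻¹' range (𝓡∂ (k + 1)) := by
  intro v hv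
  rw [mem_preimage, mem_range_halfSpace]
  exact hv.1 0

theorem cons_mem_halfBox {k : ℕ} {R : ℝ} (hR : 0 ≤ R) {w : Fin k → ℝ}
    (hw : w ∈ Icc (halfBoxLower k R ∘ Fin.succ) (halfBoxUpper k R ∘ Fin.succ)) :
    (Fin.cons 0 w : Fin (k + 1) → ℝ) ∈ Icc (halfBoxLower k R) (halfBoxUpper k R) := by
  refine ⟨fun i => ?_, fun i => ?_⟩
  · refine Fin.cases le_rfl (fun j => ?_) i
    exact hw.1 j
  · refine Fin.cases hR (fun j => ?_) i
    exact hw.2 j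

variable {k : ℕ} {N : Type*} [TopologicalSpace N] [ChartedSpace (EuclideanHalfSpace (k + 1)) N]

/-- The parametrization of `N` by the coordinates of the chart at `p`. -/
def chartParam (p : N) : (Fin (k + 1) → ℝ) → N :=
  (extChartAt (𝓡∂ (k + 1)) p).symm ∘ coordMap k

/-- The part of the box `[0, R] × [-R, R]^k` where the chart at `p` takes its values. -/
def chartBox (p : N) (R : ℝ) : Set (Fin (k + 1) → ℝ) :=
  Icc (halfBoxLower k R) (halfBoxUpper k R) ∩
    coordMap k ⁻¹' (extChartAt (𝓡∂ (k + 1)) p).target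

theorem chartBox_subset (p : N) (R : ℝ) :
    chartBox p R ⊆ Icc (halfBoxLower k R) (halfBoxUpper k R) := inter_subset_left

theorem chartBox_mem_nhdsWithin (p : N) (R : ℝ) (v : Fin (k + 1) → ℝ) (hv : v ∈ chartBox p R) :
    chartBox p R ∈ 𝓝[Icc (halfBoxLower k R) (halfBoxUpper k R)] v := by
  refine Filter.inter_mem self_mem_nhdsWithin ?_
  have h1 := extChartAt_target_mem_nhdsWithin_of_mem hv.2
  have h2 : Filter.Tendsto (coordMap k) (𝓝[Icc (halfBoxLower k R) (halfBoxUpper k R)] v)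
      (𝓝[range (𝓡∂ (k + 1))] (coordMap k v)) :=
    (coordMap k).continuous.continuousWithinAt.tendsto_nhdsWithin halfBox_subset
  exact h2 h1

theorem measurableSet_coordMap_preimage_target (p : N) :
    MeasurableSet (coordMap k ⁻¹' (extChartAt (𝓡∂ (k + 1)) p).target) :=
  (measurableSet_extChartAt_target p).preimage (coordMap k).continuous.measurable

section

variable [IsManifold (𝓡∂ (k + 1)) ∞ N]

theorem mdifferentiableWithinAt_chartParam {p : N} {R : ℝ} {v : Fin (k + 1) → ℝ}
    (hv : v ∈ chartBox p R) :
    MDifferentiableWithinAt 𝓘(ℝ, Fin (k + 1) → ℝ) (𝓡∂ (k + 1)) (chartParam p)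
      (Icc (halfBoxLower k R) (halfBoxUpper k R)) v := by
  have _ : IsManifold (𝓡∂ (k + 1)) 1 N := IsManifold.of_le (n := ∞) (by exact_mod_cast le_top)
  exact MDifferentiableWithinAt.comp v (mdifferentiableWithinAt_extChartAt_symm hv.2)
    (coordMap k).mdifferentiableWithinAt halfBox_subset

theorem contMDiffOn_chartParam (p : N) (R : ℝ) :
    ContMDiffOn 𝓘(ℝ, Fin (k + 1) → ℝ) (𝓡∂ (k + 1)) 1 (chartParam (k := k) p) (chartBox p R) := by
  have _ : IsManifold (𝓡∂ (k + 1)) 1 N := IsManifold.of_le (n := ∞) (by exact_mod_cast le_top)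
  exact (contMDiffOn_extChartAt_symm p).comp (coordMap k).contMDiff.contMDiffOn fun v hv => hv.2

theorem pullbackWithin_chartParam {m : ℕ} {p : N} {R : ℝ} (hR : 0 < R) {v : Fin (k + 1) → ℝ}
    (hv : v ∈ chartBox p R) (ζ : DiffForm (𝓡∂ (k + 1)) N m) :
    pullbackWithin (chartParam p) (Icc (halfBoxLower k R) (halfBoxUpper k R)) ζ v =
      (chartRep ζ p (coordMap k v)).compContinuousLinearMap (coordMap k) := by
  have _ : IsManifold (𝓡∂ (k + 1)) 1 N := IsManifold.of_le (n := ∞) (by exact_mod_cast le_top)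
  exact pullbackWithin_comp_linear (coordMap k) (uniqueDiffOn_Icc_pi (halfBoxLower_lt hR) v hv.1)
    halfBox_subset (mdifferentiableWithinAt_extChartAt_symm hv.2) ζ

theorem continuousOn_pullbackWithin_chartParam {m : ℕ} {ζ : DiffForm (𝓡∂ (k + 1)) N m}
    (hζ : IsContDiffForm 0 ζ) (p : N) {R : ℝ} (hR : 0 < R) :
    ContinuousOn (pullbackWithin (chartParam p) (Icc (halfBoxLower k R) (halfBoxUpper k R)) ζ)
      (chartBox p R) :=
  continuousOn_pullbackWithin (uniqueDiffOn_Icc_pi (halfBoxLower_lt hR)) (chartBox_subset p R)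
    (chartBox_mem_nhdsWithin p R) (contMDiffOn_chartParam p R) hζ

/-- The orientation of the chart is locally constant. -/
theorem eventually_chartSign_eq {μ : DiffForm (𝓡∂ (k + 1)) N (k + 1)} (hμ : IsOrientationForm μ)
    {p : N} {R : ℝ} {v : Fin (k + 1) → ℝ} (hv : v ∈ chartBox p R) :
    ∀ᶠ z in 𝓝[Icc (halfBoxLower k R) (halfBoxUpper k R)] v,
      chartSign μ p (coordMap k z) = chartSign μ p (coordMap k v) := by
  have h1 : ContinuousOn (fun z => chartSign μ p (coordMap k z)) (chartBox p R) :=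
    (continuousOn_chartSign hμ p).comp (coordMap k).continuous.continuousOn fun z hz => hz.2
  have h2 := h1.continuousWithinAt hv
  have h3 := h2.mono_of_mem_nhdsWithin (chartBox_mem_nhdsWithin p R v hv)
  have h4 : ∀ᶠ z in 𝓝[Icc (halfBoxLower k R) (halfBoxUpper k R)] v,
      |chartSign μ p (coordMap k z) - chartSign μ p (coordMap k v)| < 1 := by
    have := Metric.tendsto_nhds.1 h3.tendsto 1 one_pos
    simpa [Real.dist_eq] using this
  filter_upwards [h4] with z hz
  rcases Real.sign_apply_eq (chartRep μ p (coordMap k z) coordVec) with h | h | h <;>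
  rcases Real.sign_apply_eq (chartRep μ p (coordMap k v) coordVec) with h' | h' | h' <;>
  simp only [chartSign, h, h'] at hz ⊢ <;> norm_num at hz

end

variable [CompactSpace N] [T2Space N] [IsManifold (𝓡∂ (k + 1)) ∞ N]

variable (k) in
/-- The coordinates of the points of the support of the function of index `p` of the partition of
unity are smaller than `R`, so that this support meets no face of the box `[0, R] × [-R, R]^k`
except the one in the boundary of the half space. -/
def IsLargeBox (p : N) (R : ℝ) : Prop :=
  0 < R ∧ ∀ x ∈ tsupport (chartPartition k N p), ∀ i, |extChartAt (𝓡∂ (k + 1)) p x i| < R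

theorem exists_isLargeBox (p : N) : ∃ R, IsLargeBox k p R := by
  have h1 : IsCompact (extChartAt (𝓡∂ (k + 1)) p '' tsupport (chartPartition k N p)) :=
    (isClosed_tsupport _).isCompact.image_of_continuousOn
      ((continuousOn_extChartAt p).mono (tsupport_chartPartition_subset p))
  obtain ⟨C, hC⟩ := h1.isBounded.exists_norm_le
  refine ⟨max C 0 + 1, by positivity, fun x hx i => ?_⟩
  have h2 := hC _ (mem_image_of_mem _ hx)
  have h3 := PiLp.norm_apply_le (extChartAt (𝓡∂ (k + 1)) p x) i
  rw [Real.norm_eq_abs] at h3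
  have := le_max_left C 0
  linarith

open Classical in
/-- The function of index `p` of the partition of unity, in the coordinates of the chart at `p`,
with the sign of these coordinates. Outside the target of the chart, where its inverse is
meaningless, the value is zero. -/
def chartWeight (μ : DiffForm (𝓡∂ (k + 1)) N (k + 1)) (p : N) (v : Fin (k + 1) → ℝ) : ℝ :=
  if coordMap k v ∈ (extChartAt (𝓡∂ (k + 1)) p).target then
    chartSign μ p (coordMap k v) * chartPartition k N p (chartParam p v) else 0

theorem chartWeight_of_mem (μ : DiffForm (𝓡∂ (k + 1)) N (k + 1)) {p : N} {v : Fin (k + 1) → ℝ}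
    (hv : coordMap k v ∈ (extChartAt (𝓡∂ (k + 1)) p).target) : chartWeight μ p v =
      chartSign μ p (coordMap k v) * chartPartition k N p (chartParam p v) := if_pos hv

theorem mem_support_of_chartWeight_ne_zero {μ : DiffForm (𝓡∂ (k + 1)) N (k + 1)} {p : N}
    {v : Fin (k + 1) → ℝ} (hv : chartWeight μ p v ≠ 0) :
    coordMap k v ∈ (extChartAt (𝓡∂ (k + 1)) p).target ∧
      chartParam p v ∈ tsupport (chartPartition k N p) := by
  have h1 : coordMap k v ∈ (extChartAt (𝓡∂ (k + 1)) p).target := by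
    by_contra h
    exact hv (if_neg h)
  rw [chartWeight_of_mem μ h1] at hv
  exact ⟨h1, subset_tsupport _ (right_ne_zero_of_mul hv)⟩

theorem mem_halfBox_of_mem_tsupport {p : N} {R : ℝ} (hR : IsLargeBox k p R) {v : Fin (k + 1) → ℝ}
    (hv : coordMap k v ∈ (extChartAt (𝓡∂ (k + 1)) p).target)
    (hv' : chartParam p v ∈ tsupport (chartPartition k N p)) :
    v ∈ Icc (halfBoxLower k R) (halfBoxUpper k R) ∧ ∀ i, |v i| < R := by
  have h1 : ∀ i, |v i| < R := by
    intro i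
    have h2 := hR.2 _ hv' i
    rw [chartParam, Function.comp_apply, (extChartAt (𝓡∂ (k + 1)) p).right_inv hv] at h2
    exact h2
  have h3 : 0 ≤ v 0 := mem_range_halfSpace.1 (extChartAt_target_subset_range p hv)
  refine ⟨⟨fun i => ?_, fun i => (abs_lt.1 (h1 i)).2.le⟩, h1⟩
  refine Fin.cases ?_ (fun j => ?_) i
  · exact h3
  · exact (abs_lt.1 (h1 j.succ)).1.le

theorem chartWeight_eq_zero_of_eq {μ : DiffForm (𝓡∂ (k + 1)) N (k + 1)} {p : N} {R : ℝ}
    (hR : IsLargeBox k p R) {v : Fin (k + 1) → ℝ} {i : Fin (k + 1)} (hi : |v i| = R) :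
    chartWeight μ p v = 0 := by
  by_contra h
  obtain ⟨h1, h2⟩ := mem_support_of_chartWeight_ne_zero h
  exact absurd ((mem_halfBox_of_mem_tsupport hR h1 h2).2 i) (by rw [hi]; exact lt_irrefl R)

theorem vanishesOff_chartWeight (μ : DiffForm (𝓡∂ (k + 1)) N (k + 1)) (p : N) (R : ℝ) :
    VanishesOff (Icc (halfBoxLower k R) (halfBoxUpper k R)) (chartBox p R) (chartWeight μ p) := by
  intro v hv hvW
  set K := extChartAt (𝓡∂ (k + 1)) p '' tsupport (chartPartition k N p) with hK
  have h1 : IsCompact K :=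
    (isClosed_tsupport _).isCompact.image_of_continuousOn
      ((continuousOn_extChartAt p).mono (tsupport_chartPartition_subset p))
  have h2 : v ∉ coordMap k ⁻¹' K := by
    rintro ⟨x, hx, hxv⟩
    refine hvW ⟨hv, ?_⟩
    rw [mem_preimage, ← hxv]
    exact (extChartAt (𝓡∂ (k + 1)) p).map_source (tsupport_chartPartition_subset p hx)
  have h3 : (coordMap k ⁻¹' K)ᶜ ∈ 𝓝 v :=
    (h1.isClosed.preimage (coordMap k).continuous).isOpen_compl.mem_nhds h2
  filter_upwards [nhdsWithin_le_nhds h3] with z hz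
  by_contra h
  obtain ⟨h4, h5⟩ := mem_support_of_chartWeight_ne_zero h
  exact hz ⟨_, h5, (extChartAt (𝓡∂ (k + 1)) p).right_inv h4⟩

theorem chartWeight_eventuallyEq {μ : DiffForm (𝓡∂ (k + 1)) N (k + 1)} (hμ : IsOrientationForm μ)
    {p : N} {R : ℝ} {v : Fin (k + 1) → ℝ} (hv : v ∈ chartBox p R) :
    chartWeight μ p =ᶠ[𝓝[Icc (halfBoxLower k R) (halfBoxUpper k R)] v]
      fun z => chartSign μ p (coordMap k v) * (chartPartition k N p ∘ chartParam p) z := by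
  filter_upwards [eventually_chartSign_eq hμ hv, chartBox_mem_nhdsWithin p R v hv] with z hz hz'
  rw [chartWeight_of_mem μ hz'.2, hz]
  rfl

theorem contDiffOn_chartWeight {μ : DiffForm (𝓡∂ (k + 1)) N (k + 1)} (hμ : IsOrientationForm μ)
    (p : N) (R : ℝ) :
    ContDiffOn ℝ 1 (chartWeight μ p) (Icc (halfBoxLower k R) (halfBoxUpper k R)) := by
  intro v hv
  by_cases hvW : v ∈ chartBox p R
  · have h1 : ContDiffOn ℝ 1 (chartPartition k N p ∘ chartParam p) (chartBox p R) :=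
      contMDiffOn_iff_contDiffOn.1
        ((contMDiff_chartPartition p).comp_contMDiffOn (contMDiffOn_chartParam p R))
    have h2 := (h1 v hvW).mono_of_mem_nhdsWithin (chartBox_mem_nhdsWithin p R v hvW)
    exact (contDiffWithinAt_const.mul h2).congr_of_eventuallyEq (chartWeight_eventuallyEq hμ hvW)
      (chartWeight_of_mem μ hvW.2)
  · exact contDiffWithinAt_const.congr_of_eventuallyEq (vanishesOff_chartWeight μ p R v hv hvW)
      ((vanishesOff_chartWeight μ p R).eq_zero hv hvW)

theorem fderivWithin_chartWeight {μ : DiffForm (𝓡∂ (k + 1)) N (k + 1)} (hμ : IsOrientationForm μ)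
    {p : N} {R : ℝ} (hR : 0 < R) {v : Fin (k + 1) → ℝ} (hv : v ∈ chartBox p R) :
    fderivWithin ℝ (chartWeight μ p) (Icc (halfBoxLower k R) (halfBoxUpper k R)) v =
      chartSign μ p (coordMap k v) • fderivWithin ℝ (chartPartition k N p ∘ chartParam p)
        (Icc (halfBoxLower k R) (halfBoxUpper k R)) v := by
  have h1 : ContDiffOn ℝ 1 (chartPartition k N p ∘ chartParam p) (chartBox p R) :=
    contMDiffOn_iff_contDiffOn.1
      ((contMDiff_chartPartition p).comp_contMDiffOn (contMDiffOn_chartParam p R))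
  have h2 := (h1 v hv).mono_of_mem_nhdsWithin (chartBox_mem_nhdsWithin p R v hv)
  rw [(chartWeight_eventuallyEq hμ hv).fderivWithin_eq (chartWeight_of_mem μ hv.2)]
  exact fderivWithin_const_mul (uniqueDiffOn_Icc_pi (halfBoxLower_lt hR) v hv.1)
    (h2.differentiableWithinAt one_ne_zero) _

/-- The contribution of the chart at `p` to the integral of a form. -/
theorem integral_chart_eq_integral_box (μ ζ : DiffForm (𝓡∂ (k + 1)) N (k + 1)) {p : N} {R : ℝ}
    (hR : IsLargeBox k p R) :
    (∫ v in {v : Fin (k + 1) → ℝ | WithLp.toLp 2 v ∈ (extChartAt (𝓡∂ (k + 1)) p).target},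
      chartPartition k N p ((extChartAt (𝓡∂ (k + 1)) p).symm (WithLp.toLp 2 v))
        * chartSign μ p (WithLp.toLp 2 v) * chartRep ζ p (WithLp.toLp 2 v) coordVec) =
    ∫ v in Icc (halfBoxLower k R) (halfBoxUpper k R), chartWeight μ p v *
      pullbackWithin (chartParam p) (Icc (halfBoxLower k R) (halfBoxUpper k R)) ζ v
        (stdVec (k + 1)) := by
  trans ∫ v in chartBox p R, chartWeight μ p v *
      pullbackWithin (chartParam p) (Icc (halfBoxLower k R) (halfBoxUpper k R)) ζ v
        (stdVec (k + 1))
  · have h1 : (∫ v in {v : Fin (k + 1) → ℝ | WithLp.toLp 2 v ∈ (extChartAt (𝓡∂ (k + 1)) p).target},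
      chartPartition k N p ((extChartAt (𝓡∂ (k + 1)) p).symm (WithLp.toLp 2 v))
        * chartSign μ p (WithLp.toLp 2 v) * chartRep ζ p (WithLp.toLp 2 v) coordVec) =
      ∫ v in coordMap k ⁻¹' (extChartAt (𝓡∂ (k + 1)) p).target,
        chartWeight μ p v * chartRep ζ p (coordMap k v) coordVec := by
      refine setIntegral_congr_fun (measurableSet_coordMap_preimage_target p) fun v hv => ?_
      beta_reduce
      rw [chartWeight_of_mem μ hv, mul_comm (chartSign μ p (coordMap k v))]
      rfl
    rw [h1, setIntegral_eq_of_subset_of_forall_sdiff_eq_zero (s := chartBox p R)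
      (measurableSet_coordMap_preimage_target p) inter_subset_right]
    · refine setIntegral_congr_fun (measurableSet_Icc.inter
        (measurableSet_coordMap_preimage_target p)) fun v hv => ?_
      beta_reduce
      rw [pullbackWithin_chartParam hR.1 hv]
      rfl
    · intro v hv
      have h2 : chartWeight μ p v = 0 := by
        by_contra h
        obtain ⟨h3, h4⟩ := mem_support_of_chartWeight_ne_zero h
        exact hv.2 ⟨(mem_halfBox_of_mem_tsupport hR h3 h4).1, h3⟩
      rw [h2, zero_mul]
  · refine (setIntegral_eq_of_subset_of_forall_sdiff_eq_zero measurableSet_Icc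
      (chartBox_subset p R) fun v hv => ?_).symm
    rw [(vanishesOff_chartWeight μ p R).eq_zero hv.1 hv.2, zero_mul]

/-- The contribution of the chart at `p` to the integral of a form over the boundary. The sign comes
from the outward vector, which is the opposite of the first coordinate vector. -/
theorem integral_chart_boundary_eq_integral_face (μ : DiffForm (𝓡∂ (k + 1)) N (k + 1))
    (η : DiffForm (𝓡∂ (k + 1)) N k) {p : N} {R : ℝ} (hR : IsLargeBox k p R) :
    (∫ w in {w : Fin k → ℝ | boundaryPt w ∈ (extChartAt (𝓡∂ (k + 1)) p).target},
      chartPartition k N p ((extChartAt (𝓡∂ (k + 1)) p).symm (boundaryPt w))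
        * (-chartSign μ p (boundaryPt w)) * chartRep η p (boundaryPt w) (fun i => coordVec i.succ)) =
    -∫ w in Icc (halfBoxLower k R ∘ Fin.succ) (halfBoxUpper k R ∘ Fin.succ),
      chartWeight μ p (Fin.cons 0 w) *
      pullbackWithin (chartParam p) (Icc (halfBoxLower k R) (halfBoxUpper k R)) η (Fin.cons 0 w)
        (fun i => stdVec (k + 1) i.succ) := by
  set D : Set (Fin k → ℝ) := {w | boundaryPt w ∈ (extChartAt (𝓡∂ (k + 1)) p).target} with hD
  have hcons : Continuous fun w : Fin k → ℝ => (Fin.cons 0 w : Fin (k + 1) → ℝ) :=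
    continuous_const.finCons continuous_id
  have hDm : MeasurableSet D :=
    (measurableSet_coordMap_preimage_target p).preimage hcons.measurable
  have hmem : ∀ w : Fin k → ℝ, w ∈ Icc (halfBoxLower k R ∘ Fin.succ) (halfBoxUpper k R ∘ Fin.succ) →
      (Fin.cons 0 w : Fin (k + 1) → ℝ) ∈ Icc (halfBoxLower k R) (halfBoxUpper k R) :=
    fun w hw => cons_mem_halfBox hR.1.le hw
  have hmem' : ∀ w : Fin k → ℝ,
      (Fin.cons 0 w : Fin (k + 1) → ℝ) ∈ Icc (halfBoxLower k R) (halfBoxUpper k R) →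
      w ∈ Icc (halfBoxLower k R ∘ Fin.succ) (halfBoxUpper k R ∘ Fin.succ) := by
    intro w hw
    exact ⟨fun j => hw.1 j.succ, fun j => hw.2 j.succ⟩
  rw [← integral_neg]
  trans ∫ w in Icc (halfBoxLower k R ∘ Fin.succ) (halfBoxUpper k R ∘ Fin.succ) ∩ D,
      -(chartWeight μ p (Fin.cons 0 w) *
      pullbackWithin (chartParam p) (Icc (halfBoxLower k R) (halfBoxUpper k R)) η (Fin.cons 0 w)
        (fun i => stdVec (k + 1) i.succ))
  · have h1 : (∫ w in D,
      chartPartition k N p ((extChartAt (𝓡∂ (k + 1)) p).symm (boundaryPt w))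
        * (-chartSign μ p (boundaryPt w)) * chartRep η p (boundaryPt w)
          (fun i => coordVec i.succ)) =
      ∫ w in D, -(chartWeight μ p (Fin.cons 0 w) *
        chartRep η p (boundaryPt w) (fun i => coordVec i.succ)) := by
      refine setIntegral_congr_fun hDm fun w hw => ?_
      rw [chartWeight_of_mem μ (v := Fin.cons 0 w) hw, mul_neg, neg_mul, mul_comm (chartSign μ p _)]
      rfl
    rw [h1, setIntegral_eq_of_subset_of_forall_sdiff_eq_zero hDm
      (s := Icc (halfBoxLower k R ∘ Fin.succ) (halfBoxUpper k R ∘ Fin.succ) ∩ D)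
      inter_subset_right]
    · refine setIntegral_congr_fun (measurableSet_Icc.inter hDm) fun w hw => ?_
      rw [pullbackWithin_chartParam hR.1 ⟨hmem w hw.1, hw.2⟩]
      rfl
    · intro w hw
      have h2 : chartWeight μ p (Fin.cons 0 w) = 0 := by
        by_contra h
        obtain ⟨h3, h4⟩ := mem_support_of_chartWeight_ne_zero h
        exact hw.2 ⟨hmem' w (mem_halfBox_of_mem_tsupport hR h3 h4).1, h3⟩
      rw [h2, zero_mul, neg_zero]
  · refine (setIntegral_eq_of_subset_of_forall_sdiff_eq_zero measurableSet_Icc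
      inter_subset_left fun w hw => ?_).symm
    rw [(vanishesOff_chartWeight μ p R).eq_zero (hmem w hw.1) fun h => hw.2 ⟨hw.1, h.2⟩, zero_mul,
      neg_zero]

/-- The integral of `dχ ∧ θ`, where `χ` is the function of index `p` of the partition of unity: the
sign of the coordinates is locally constant and goes into the differential. -/
theorem chartIntegral_wedgeForm_eq_integral_box {μ : DiffForm (𝓡∂ (k + 1)) N (k + 1)}
    (hμ : IsOrientationForm μ) (θ : DiffForm (𝓡∂ (k + 1)) N k) {p : N} {R : ℝ}
    (hR : IsLargeBox k p R) :
    chartIntegral μ p (wedgeForm (chartPartition k N p) θ) =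
    ∫ v in Icc (halfBoxLower k R) (halfBoxUpper k R),
      wedgeOne (fderivWithin ℝ (chartWeight μ p) (Icc (halfBoxLower k R) (halfBoxUpper k R)) v)
      (pullbackWithin (chartParam p) (Icc (halfBoxLower k R) (halfBoxUpper k R)) θ v)
        (stdVec (k + 1)) := by
  set ζ := wedgeForm (chartPartition k N p) θ with hζ
  have h0 : chartIntegral μ p ζ = ∫ v in coordMap k ⁻¹' (extChartAt (𝓡∂ (k + 1)) p).target,
      chartSign μ p (coordMap k v) * chartRep ζ p (coordMap k v) coordVec := by
    have h1 := (PiLp.volume_preserving_toLp (Fin (k + 1))).setIntegral_preimage_emb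
      (MeasurableEquiv.toLp 2 (Fin (k + 1) → ℝ)).measurableEmbedding
      (fun u => chartSign μ p u * chartRep ζ p u coordVec) (extChartAt (𝓡∂ (k + 1)) p).target
    exact h1.symm
  rw [h0]
  trans ∫ v in chartBox p R,
      wedgeOne (fderivWithin ℝ (chartWeight μ p) (Icc (halfBoxLower k R) (halfBoxUpper k R)) v)
      (pullbackWithin (chartParam p) (Icc (halfBoxLower k R) (halfBoxUpper k R)) θ v)
        (stdVec (k + 1))
  · rw [setIntegral_eq_of_subset_of_forall_sdiff_eq_zero (s := chartBox p R)
      (measurableSet_coordMap_preimage_target p) inter_subset_right]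
    · refine setIntegral_congr_fun (measurableSet_Icc.inter
        (measurableSet_coordMap_preimage_target p)) fun v hv => ?_
      beta_reduce
      have h2 : chartRep ζ p (coordMap k v) coordVec = pullbackWithin (chartParam p)
          (Icc (halfBoxLower k R) (halfBoxUpper k R)) ζ v (stdVec (k + 1)) := by
        rw [pullbackWithin_chartParam hR.1 hv]
        rfl
      rw [h2, hζ, pullbackWithin_wedgeForm (uniqueDiffOn_Icc_pi (halfBoxLower_lt hR.1) v hv.1)
        (mdifferentiableWithinAt_chartParam hv)
        ((contMDiff_chartPartition p).mdifferentiable one_ne_zero _),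
        fderivWithin_chartWeight hμ hR.1 hv, wedgeOne_smul]
      rfl
    · intro v hv
      have h2 : chartParam p v ∉ tsupport (chartPartition k N p) := fun h =>
        hv.2 ⟨(mem_halfBox_of_mem_tsupport hR hv.1 h).1, hv.1⟩
      rw [chartRep_eq_zero (wedgeForm_eq_zero_of_notMem_tsupport h2 θ)]
      simp
  · refine (setIntegral_eq_of_subset_of_forall_sdiff_eq_zero measurableSet_Icc
      (chartBox_subset p R) fun v hv => ?_).symm
    rw [(vanishesOff_chartWeight μ p R).fderivWithin_eq_zero hv.1 hv.2, wedgeOne_zero]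
    rfl

end ChartBox

/-! ### Stokes' theorem in a chart of the submanifold -/

section ChartTerms

variable {k : ℕ} {N : Type*} [TopologicalSpace N] [ChartedSpace (EuclideanHalfSpace (k + 1)) N]
  [IsManifold (𝓡∂ (k + 1)) ∞ N]
  {E : Type*} [NormedAddCommGroup E] [NormedSpace ℝ E]
  {H : Type*} [TopologicalSpace H] {I : ModelWithCorners ℝ E H}
  {M : Type*} [TopologicalSpace M] [ChartedSpace H M]

theorem pullbackWithin_comp_chartParam {m : ℕ} {f : N → M} (hf : ContMDiff (𝓡∂ (k + 1)) I 1 f)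
    {p : N} {R : ℝ} (hR : 0 < R) {v : Fin (k + 1) → ℝ} (hv : v ∈ chartBox p R)
    (η : DiffForm I M m) :
    pullbackWithin (f ∘ chartParam p) (Icc (halfBoxLower k R) (halfBoxUpper k R)) η v =
      pullbackWithin (chartParam p) (Icc (halfBoxLower k R) (halfBoxUpper k R))
        (pullback (J := 𝓡∂ (k + 1)) f η) v :=
  pullbackWithin_pullback (uniqueDiffOn_Icc_pi (halfBoxLower_lt hR) v hv.1)
    (mdifferentiableWithinAt_chartParam hv) (hf.mdifferentiable one_ne_zero _) η

variable [CompactSpace N] [T2Space N]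

/-- The contribution of the chart at `p` to the integral of a form over `N`. -/
def formTerm (μ ζ : DiffForm (𝓡∂ (k + 1)) N (k + 1)) (p : N) : ℝ :=
  ∫ v in {v : Fin (k + 1) → ℝ | WithLp.toLp 2 v ∈ (extChartAt (𝓡∂ (k + 1)) p).target},
    chartPartition k N p ((extChartAt (𝓡∂ (k + 1)) p).symm (WithLp.toLp 2 v))
      * chartSign μ p (WithLp.toLp 2 v) * chartRep ζ p (WithLp.toLp 2 v) coordVec

/-- The contribution of the chart at `p` to the integral of a form over the boundary of `N`. -/
def boundaryTerm (μ : DiffForm (𝓡∂ (k + 1)) N (k + 1)) (η : DiffForm (𝓡∂ (k + 1)) N k) (p : N) :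
    ℝ :=
  ∫ w in {w : Fin k → ℝ | boundaryPt w ∈ (extChartAt (𝓡∂ (k + 1)) p).target},
    chartPartition k N p ((extChartAt (𝓡∂ (k + 1)) p).symm (boundaryPt w))
      * (-chartSign μ p (boundaryPt w)) * chartRep η p (boundaryPt w) (fun i => coordVec i.succ)

theorem formIntegral_eq_sum (μ ζ : DiffForm (𝓡∂ (k + 1)) N (k + 1)) :
    formIntegral μ ζ = ∑ p ∈ chartPoints k N, formTerm μ ζ p := by
  refine finsum_eq_sum_of_support_subset (formTerm μ ζ) fun p hp => ?_
  by_contra h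
  refine hp ?_
  simp [formTerm, chartPartition_eq_zero h]

theorem boundaryFormIntegral_eq_sum (μ : DiffForm (𝓡∂ (k + 1)) N (k + 1))
    (η : DiffForm (𝓡∂ (k + 1)) N k) :
    boundaryFormIntegral μ η = ∑ p ∈ chartPoints k N, boundaryTerm μ η p := by
  refine finsum_eq_sum_of_support_subset (boundaryTerm μ η) fun p hp => ?_
  by_contra h
  refine hp ?_
  simp [boundaryTerm, chartPartition_eq_zero h]

theorem continuousOn_chartWeight_mul {m : ℕ} {μ : DiffForm (𝓡∂ (k + 1)) N (k + 1)}
    (hμ : IsOrientationForm μ) {ζ : DiffForm (𝓡∂ (k + 1)) N m}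
    (hζ : IsContDiffForm 0 ζ) (p : N) {R : ℝ} (hR : 0 < R) (w : Fin m → Fin (k + 1) → ℝ) :
    ContinuousOn (fun v => chartWeight μ p v * pullbackWithin (chartParam p)
      (Icc (halfBoxLower k R) (halfBoxUpper k R)) ζ v w)
      (Icc (halfBoxLower k R) (halfBoxUpper k R)) :=
  continuousOn_mul_form (chartBox_subset p R) (chartBox_mem_nhdsWithin p R)
    (continuousOn_pullbackWithin_chartParam hζ p hR) (contDiffOn_chartWeight hμ p R).continuousOn
    (vanishesOff_chartWeight μ p R) w

theorem boundaryTerm_add {μ : DiffForm (𝓡∂ (k + 1)) N (k + 1)} (hμ : IsOrientationForm μ)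
    {η η' : DiffForm (𝓡∂ (k + 1)) N k} (hη : IsContDiffForm 0 η) (hη' : IsContDiffForm 0 η')
    (p : N) :
    boundaryTerm μ (fun x => η x + η' x) p = boundaryTerm μ η p + boundaryTerm μ η' p := by
  obtain ⟨R, hR⟩ := exists_isLargeBox (k := k) p
  have hi : ∀ {ζ : DiffForm (𝓡∂ (k + 1)) N k}, IsContDiffForm 0 ζ →
      IntegrableOn (fun w => chartWeight μ p (Fin.cons 0 w) *
      pullbackWithin (chartParam p) (Icc (halfBoxLower k R) (halfBoxUpper k R)) ζ (Fin.cons 0 w)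
        (fun i => stdVec (k + 1) i.succ))
        (Icc (halfBoxLower k R ∘ Fin.succ) (halfBoxUpper k R ∘ Fin.succ)) := by
    intro ζ hζ
    refine ContinuousOn.integrableOn_compact isCompact_Icc ?_
    have hcons : Continuous fun w : Fin k → ℝ => (Fin.cons 0 w : Fin (k + 1) → ℝ) :=
      continuous_const.finCons continuous_id
    exact (continuousOn_chartWeight_mul hμ hζ p hR.1 fun i => stdVec (k + 1) i.succ).comp
      hcons.continuousOn fun w hw => cons_mem_halfBox hR.1.le hw
  rw [boundaryTerm, boundaryTerm, boundaryTerm, integral_chart_boundary_eq_integral_face μ _ hR,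
    integral_chart_boundary_eq_integral_face μ _ hR,
    integral_chart_boundary_eq_integral_face μ _ hR, ← neg_add, ← integral_add (hi hη) (hi hη')]
  congr 1
  refine setIntegral_congr_fun measurableSet_Icc fun w _ => ?_
  exact mul_add _ _ _

theorem chartWeight_mul_pullbackWithin_comp {m : ℕ} {f : N → M}
    (hf : ContMDiff (𝓡∂ (k + 1)) I 1 f) (μ : DiffForm (𝓡∂ (k + 1)) N (k + 1))
    {p : N} {R : ℝ} (hR : 0 < R) {v : Fin (k + 1) → ℝ}
    (hv : v ∈ Icc (halfBoxLower k R) (halfBoxUpper k R)) (η : DiffForm I M m)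
    (w : Fin m → Fin (k + 1) → ℝ) :
    chartWeight μ p v * pullbackWithin (f ∘ chartParam p)
      (Icc (halfBoxLower k R) (halfBoxUpper k R)) η v w =
    chartWeight μ p v * pullbackWithin (chartParam p) (Icc (halfBoxLower k R) (halfBoxUpper k R))
        (pullback (J := 𝓡∂ (k + 1)) f η) v w := by
  by_cases hvW : v ∈ chartBox p R
  · rw [pullbackWithin_comp_chartParam hf hR hvW]
  · rw [(vanishesOff_chartWeight μ p R).eq_zero hv hvW, zero_mul, zero_mul]

theorem wedgeOne_chartWeight_pullbackWithin_comp {m : ℕ} {f : N → M}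
    (hf : ContMDiff (𝓡∂ (k + 1)) I 1 f) (μ : DiffForm (𝓡∂ (k + 1)) N (k + 1))
    {p : N} {R : ℝ} (hR : 0 < R) {v : Fin (k + 1) → ℝ}
    (hv : v ∈ Icc (halfBoxLower k R) (halfBoxUpper k R)) (η : DiffForm I M m) :
    wedgeOne (fderivWithin ℝ (chartWeight μ p) (Icc (halfBoxLower k R) (halfBoxUpper k R)) v)
      (pullbackWithin (f ∘ chartParam p) (Icc (halfBoxLower k R) (halfBoxUpper k R)) η v) =
    wedgeOne (fderivWithin ℝ (chartWeight μ p) (Icc (halfBoxLower k R) (halfBoxUpper k R)) v)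
      (pullbackWithin (chartParam p) (Icc (halfBoxLower k R) (halfBoxUpper k R))
        (pullback (J := 𝓡∂ (k + 1)) f η) v) := by
  by_cases hvW : v ∈ chartBox p R
  · rw [pullbackWithin_comp_chartParam hf hR hvW]
  · rw [(vanishesOff_chartWeight μ p R).fderivWithin_eq_zero hv hvW, wedgeOne_zero, wedgeOne_zero]

/-- The integral over the box of `g ζ + c dg ∧ θ`, where `g` is `chartWeight μ p`. -/
theorem integral_box_split {μ : DiffForm (𝓡∂ (k + 1)) N (k + 1)} (hμ : IsOrientationForm μ)
    {ζ : DiffForm (𝓡∂ (k + 1)) N (k + 1)} (hζ : IsContDiffForm 0 ζ)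
    {θ : DiffForm (𝓡∂ (k + 1)) N k} (hθ : IsContDiffForm 0 θ) {p : N} {R : ℝ}
    (hR : IsLargeBox k p R) (c : ℝ) :
    ∫ v in Icc (halfBoxLower k R) (halfBoxUpper k R), (chartWeight μ p v *
      pullbackWithin (chartParam p) (Icc (halfBoxLower k R) (halfBoxUpper k R)) ζ v (stdVec (k + 1))
      + c * wedgeOne (fderivWithin ℝ (chartWeight μ p)
          (Icc (halfBoxLower k R) (halfBoxUpper k R)) v)
        (pullbackWithin (chartParam p) (Icc (halfBoxLower k R) (halfBoxUpper k R)) θ v)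
        (stdVec (k + 1))) =
    formTerm μ ζ p + c * chartIntegral μ p (wedgeForm (chartPartition k N p) θ) := by
  rw [chartIntegral_wedgeForm_eq_integral_box hμ θ hR, formTerm,
    integral_chart_eq_integral_box μ ζ hR, ← integral_const_mul]
  refine integral_add ((continuousOn_chartWeight_mul hμ hζ p hR.1 _).integrableOn_compact
    isCompact_Icc) ?_
  refine Integrable.const_mul ?_ c
  exact (continuousOn_wedgeOne_fderivWithin (halfBoxLower_lt hR.1) (chartBox_subset p R)
    (chartBox_mem_nhdsWithin p R) (continuousOn_pullbackWithin_chartParam hθ p hR.1)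
    (contDiffOn_chartWeight hμ p R) (vanishesOff_chartWeight μ p R)).integrableOn_compact
    isCompact_Icc

variable [FiniteDimensional ℝ E] [IsManifold I ∞ M]

/-- Stokes' theorem in the chart at `p`, for the product of a form by the function of index `p` of
the partition of unity. -/
theorem formTerm_dForm_add {μ : DiffForm (𝓡∂ (k + 1)) N (k + 1)} (hμ : IsOrientationForm μ)
    {f : N → M} (hf : ContMDiff (𝓡∂ (k + 1)) I 1 f) {η : DiffForm I M k}
    (hη : IsContDiffForm 1 η) (p : N) :
    formTerm μ (pullback f (dForm η)) p +
      chartIntegral μ p (wedgeForm (chartPartition k N p) (pullback f η)) =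
      boundaryTerm μ (pullback f η) p := by
  obtain ⟨R, hR⟩ := exists_isLargeBox (k := k) p
  have h1 := boxStokes_pullbackWithin (halfBoxLower_lt hR.1) (chartBox_subset p R)
    (chartBox_mem_nhdsWithin p R) (hf.comp_contMDiffOn (contMDiffOn_chartParam p R)) hη
    (contDiffOn_chartWeight hμ p R) (vanishesOff_chartWeight μ p R)
  have h2 := integral_box_split hμ (hη.dForm.pullback hf)
    ((hη.of_le zero_le_one).pullback hf) hR 1
  rw [one_mul] at h2
  rw [← h2, boundaryTerm, integral_chart_boundary_eq_integral_face μ _ hR]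
  rw [BoxStokes, boxBoundary, Fin.sum_univ_succ] at h1
  -- only the face in the boundary of the half space contributes
  have h3 : ∀ (i : Fin (k + 1)) (c : ℝ), |c| = R → ∀ w : Fin k → ℝ,
      chartWeight μ p (i.insertNth c w : Fin (k + 1) → ℝ) = 0 := fun i c hc w =>
    chartWeight_eq_zero_of_eq hR (i := i) (by rw [Fin.insertNth_apply_same, hc])
  have hRabs : |R| = R := abs_of_pos hR.1
  have h4 : ∀ i : Fin k, |halfBoxLower k R i.succ| = R := fun i => by
    simp only [halfBoxLower, Fin.cons_succ, abs_neg, hRabs]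
  have h5 : ∀ i : Fin (k + 1), |halfBoxUpper k R i| = R := fun i => hRabs
  simp only [h3 _ _ (h5 _), h3 _ _ (h4 _), zero_mul, mul_zero, integral_zero, sub_zero,
    Finset.sum_const_zero, add_zero, zero_sub, Fin.val_zero, pow_zero, one_mul] at h1
  refine Eq.trans ?_ (h1.trans ?_)
  · refine setIntegral_congr_fun measurableSet_Icc fun v hv => ?_
    rw [one_mul, chartWeight_mul_pullbackWithin_comp hf μ hR.1 hv,
      wedgeOne_chartWeight_pullbackWithin_comp hf μ hR.1 hv]
  · congr 1
    have h6 : (0 : Fin (k + 1)).succAbove = Fin.succ := funext fun i => Fin.zero_succAbove i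
    rw [h6]
    refine setIntegral_congr_fun measurableSet_Icc fun w hw => ?_
    have h7 : ((0 : Fin (k + 1)).insertNth (halfBoxLower k R 0) w : Fin (k + 1) → ℝ) =
        Fin.cons 0 w := Fin.insertNth_zero' _ _
    rw [h7, chartWeight_mul_pullbackWithin_comp hf μ hR.1 (cons_mem_halfBox hR.1.le hw)]
    rfl

end ChartTerms

/-! ### The time as first coordinate of a box -/

section TimeCoordinate

variable {n : ℕ}

/-- Fubini's theorem on a box, with respect to the first coordinate. -/
theorem continuousOn_box_fubini {A B : Fin (n + 1) → ℝ} {f : (Fin (n + 1) → ℝ) → ℝ}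
    (hf : ContinuousOn f (Icc A B)) :
    IntegrableOn (fun s => ∫ w in Icc (A ∘ Fin.succ) (B ∘ Fin.succ), f (Fin.cons s w))
      (Icc (A 0) (B 0)) ∧
    ∫ x in Icc A B, f x = ∫ s in Icc (A 0) (B 0),
      ∫ w in Icc (A ∘ Fin.succ) (B ∘ Fin.succ), f (Fin.cons s w) := by
  have hmp := (volume_preserving_piFinSuccAbove (fun _ : Fin (n + 1) => ℝ) 0).symm
  set e := (MeasurableEquiv.piFinSuccAbove (fun _ : Fin (n + 1) => ℝ) 0).symm with he
  have hee : ∀ z : ℝ × (Fin n → ℝ), e z = Fin.cons z.1 z.2 := fun z => by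
    rw [he, MeasurableEquiv.piFinSuccAbove_symm_apply]
    exact Fin.insertNth_zero' _ _
  have hpre : e ⁻¹' Icc A B = Icc (A 0) (B 0) ×ˢ Icc (A ∘ Fin.succ) (B ∘ Fin.succ) := by
    ext z
    rw [mem_preimage, hee, mem_prod]
    simp only [mem_Icc, Pi.le_def, Fin.forall_fin_succ, Fin.cons_zero, Fin.cons_succ,
      Function.comp_apply]
    tauto
  have hint : IntegrableOn (fun z => f (e z))
      (Icc (A 0) (B 0) ×ˢ Icc (A ∘ Fin.succ) (B ∘ Fin.succ)) := by
    rw [← hpre]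
    exact (hmp.integrableOn_comp_preimage e.measurableEmbedding).2
      (hf.integrableOn_compact isCompact_Icc)
  have h1 : ∫ x in Icc A B, f x =
      ∫ z in Icc (A 0) (B 0) ×ˢ Icc (A ∘ Fin.succ) (B ∘ Fin.succ), f (e z) := by
    rw [← hpre, hmp.setIntegral_preimage_emb e.measurableEmbedding]
  rw [Measure.volume_eq_prod] at hint h1
  simp only [hee] at hint h1
  refine ⟨?_, ?_⟩
  · rw [IntegrableOn, ← Measure.prod_restrict] at hint
    exact hint.integral_prod_left
  · rw [h1, setIntegral_prod _ hint]

/-- The projection which forgets the first coordinate. -/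
def tailMap (n : ℕ) : (Fin (n + 1) → ℝ) →L[ℝ] (Fin n → ℝ) :=
  ContinuousLinearMap.pi fun i => ContinuousLinearMap.proj i.succ

/-- The separation of the first coordinate, the time, from the others. -/
def timeSplit (n : ℕ) : (Fin (n + 1) → ℝ) →L[ℝ] ℝ × (Fin n → ℝ) :=
  (ContinuousLinearMap.proj 0).prod (tailMap n)

theorem tailMap_cons (s : ℝ) (w : Fin n → ℝ) : tailMap n (Fin.cons s w) = w := rfl

theorem timeSplit_cons (s : ℝ) (w : Fin n → ℝ) : timeSplit n (Fin.cons s w) = (s, w) := rfl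

theorem stdVec_zero_eq : stdVec (n + 1) 0 = Fin.cons 1 0 := by
  funext j
  refine Fin.cases ?_ (fun j => ?_) j <;> simp [stdVec]

theorem stdVec_succ (i : Fin n) : stdVec (n + 1) i.succ = Fin.cons 0 (stdVec n i) := by
  funext j
  refine Fin.cases ?_ (fun j => ?_) j
  · simp [stdVec]
  · simp [stdVec, Pi.single_apply]

theorem stdVec_eq_cons : stdVec (n + 1) =
    Fin.cons (Fin.cons 1 0 : Fin (n + 1) → ℝ) fun i => Fin.cons 0 (stdVec n i) := by
  funext i
  refine Fin.cases ?_ (fun j => ?_) i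
  · exact stdVec_zero_eq
  · exact stdVec_succ j

theorem removeNth_zero_stdVec :
    (0 : Fin (n + 1)).removeNth (stdVec (n + 1)) = fun i => Fin.cons 0 (stdVec n i) := by
  funext i
  exact stdVec_succ i

theorem removeNth_succ_stdVec (j : Fin (n + 1)) : j.succ.removeNth (stdVec (n + 2)) =
    Fin.cons (Fin.cons 1 0 : Fin (n + 2) → ℝ)
      fun i => Fin.cons 0 (j.removeNth (stdVec (n + 1)) i) := by
  funext i
  refine Fin.cases ?_ (fun i => ?_) i
  · rw [Fin.removeNth, Fin.succ_succAbove_zero]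
    exact stdVec_zero_eq
  · rw [Fin.removeNth, Fin.succ_succAbove_succ]
    exact stdVec_succ _

/-- If `L` does not depend on the time, then `L ∧ θ'` is computed with the contraction `θ` of `θ'` with
the time direction. -/
theorem wedgeOne_comp_tailMap {L : (Fin (n + 1) → ℝ) →L[ℝ] ℝ}
    {θ' : (Fin (n + 2) → ℝ) [⋀^Fin (n + 1)]→L[ℝ] ℝ} {θ : (Fin (n + 1) → ℝ) [⋀^Fin n]→L[ℝ] ℝ}
    (h : ∀ w : Fin n → Fin (n + 1) → ℝ,
      θ' (Fin.cons (Fin.cons 1 0 : Fin (n + 2) → ℝ) fun i => Fin.cons 0 (w i)) = θ w) :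
    wedgeOne (L.comp (tailMap (n + 1))) θ' (stdVec (n + 2)) = -wedgeOne L θ (stdVec (n + 1)) := by
  rw [wedgeOne_apply, wedgeOne_apply, Fin.sum_univ_succ, ← Finset.sum_neg_distrib]
  have h0 : (L.comp (tailMap (n + 1))) (stdVec (n + 2) 0) = 0 := by
    rw [stdVec_zero_eq, ContinuousLinearMap.comp_apply, tailMap_cons, map_zero]
  rw [h0, zero_mul, mul_zero, zero_add]
  refine Finset.sum_congr rfl fun j _ => ?_
  rw [removeNth_succ_stdVec, h, stdVec_succ, ContinuousLinearMap.comp_apply, tailMap_cons,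
    Fin.val_succ, pow_succ]
  ring

theorem insertNth_one_cons {c s : ℝ} {w : Fin n → ℝ} :
    ((0 : Fin (n + 1)).succ.insertNth c (Fin.cons s w : Fin (n + 1) → ℝ) : Fin (n + 2) → ℝ) =
      Fin.cons s (Fin.cons c w : Fin (n + 1) → ℝ) := by
  rw [Fin.insertNth_eq_iff]
  refine ⟨rfl, funext fun i => ?_⟩
  refine Fin.cases ?_ (fun i => ?_) i
  · rw [Fin.removeNth, Fin.succ_succAbove_zero]
    rfl
  · rw [Fin.removeNth, Fin.succ_succAbove_succ]
    rfl

end TimeCoordinate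

/-! ### Stokes' theorem on the flow tube over a chart -/

section FlowStokes

variable {k : ℕ} {N : Type*} [TopologicalSpace N] [ChartedSpace (EuclideanHalfSpace (k + 1)) N]
  {E : Type*} [NormedAddCommGroup E] [NormedSpace ℝ E]
  {H : Type*} [TopologicalSpace H] {I : ModelWithCorners ℝ E H}
  {M : Type*} [TopologicalSpace M] [ChartedSpace H M]
  {V : ℝ → VField I M} {φ : ℝ → ℝ → M → M}

theorem tailMap_mem_halfBox {R r t : ℝ} {x : Fin (k + 2) → ℝ}
    (hx : x ∈ Icc (Fin.cons r (halfBoxLower k R) : Fin (k + 2) → ℝ)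
      (Fin.cons t (halfBoxUpper k R))) :
    tailMap (k + 1) x ∈ Icc (halfBoxLower k R) (halfBoxUpper k R) :=
  ⟨fun i => hx.1 i.succ, fun i => hx.2 i.succ⟩

theorem timeBox_lt {R r t : ℝ} (hR : 0 < R) (hrt : r < t) (i : Fin (k + 2)) :
    (Fin.cons r (halfBoxLower k R) : Fin (k + 2) → ℝ) i <
      (Fin.cons t (halfBoxUpper k R) : Fin (k + 2) → ℝ) i := by
  refine Fin.cases hrt (fun j => ?_) i
  exact halfBoxLower_lt hR j

/-- The part of the box `[r, t] × [0, R] × [-R, R]^k` where the chart at `p` takes its values. -/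
def timeChartBox (p : N) (R r t : ℝ) : Set (Fin (k + 2) → ℝ) :=
  Icc (Fin.cons r (halfBoxLower k R) : Fin (k + 2) → ℝ) (Fin.cons t (halfBoxUpper k R)) ∩
    tailMap (k + 1) ⁻¹' chartBox p R

/-- The trajectories of the points of the domain of the chart at `p`, where the first coordinate is
the time. -/
def chartTrajectory (φ : ℝ → ℝ → M → M) (t₀ : ℝ) (f : N → M) (p : N) : (Fin (k + 2) → ℝ) → M :=
  trajectory φ t₀ (f ∘ chartParam p) ∘ timeSplit (k + 1)

theorem timeSplit_mem {R r t : ℝ} :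
    Icc (Fin.cons r (halfBoxLower k R) : Fin (k + 2) → ℝ) (Fin.cons t (halfBoxUpper k R)) ⊆
      timeSplit (k + 1) ⁻¹' (univ ×ˢ Icc (halfBoxLower k R) (halfBoxUpper k R)) :=
  fun _ hx => ⟨mem_univ _, tailMap_mem_halfBox hx⟩

theorem timeChartBox_mem_nhdsWithin (p : N) (R r t : ℝ) (x : Fin (k + 2) → ℝ)
    (hx : x ∈ timeChartBox p R r t) : timeChartBox p R r t ∈
      𝓝[Icc (Fin.cons r (halfBoxLower k R) : Fin (k + 2) → ℝ)
        (Fin.cons t (halfBoxUpper k R))] x := by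
  refine Filter.inter_mem self_mem_nhdsWithin ?_
  have h2 : Filter.Tendsto (tailMap (k + 1))
      (𝓝[Icc (Fin.cons r (halfBoxLower k R) : Fin (k + 2) → ℝ) (Fin.cons t (halfBoxUpper k R))] x)
      (𝓝[Icc (halfBoxLower k R) (halfBoxUpper k R)] (tailMap (k + 1) x)) :=
    (tailMap (k + 1)).continuous.continuousWithinAt.tendsto_nhdsWithin
      fun _ hx => tailMap_mem_halfBox hx
  exact h2 (chartBox_mem_nhdsWithin p R _ hx.2)

variable [IsManifold (𝓡∂ (k + 1)) ∞ N]

theorem contMDiffOn_chartTrajectory (hφ : IsFlow V φ) (t₀ : ℝ) {f : N → M}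
    (hf : ContMDiff (𝓡∂ (k + 1)) I 1 f) (p : N) (R r t : ℝ) :
    ContMDiffOn 𝓘(ℝ, Fin (k + 2) → ℝ) I 1 (chartTrajectory (k := k) φ t₀ f p) (timeChartBox p R r t) :=
  (hφ.contMDiffOn_trajectory t₀ (hf.comp_contMDiffOn (contMDiffOn_chartParam p R))).comp
    (timeSplit (k + 1)).contMDiff.contMDiffOn fun _ hx => ⟨mem_univ _, hx.2⟩

theorem mdifferentiableWithinAt_comp_chartParam {f : N → M} (hf : ContMDiff (𝓡∂ (k + 1)) I 1 f)
    {p : N} {R : ℝ} {v : Fin (k + 1) → ℝ} (hv : v ∈ chartBox p R) :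
    MDifferentiableWithinAt 𝓘(ℝ, Fin (k + 1) → ℝ) I (f ∘ chartParam p)
      (Icc (halfBoxLower k R) (halfBoxUpper k R)) v :=
  (hf.mdifferentiable one_ne_zero _).comp_mdifferentiableWithinAt v
    (mdifferentiableWithinAt_chartParam hv)

theorem pullbackWithin_chartTrajectory_eq (hφ : IsFlow V φ) (t₀ : ℝ) {f : N → M}
    (hf : ContMDiff (𝓡∂ (k + 1)) I 1 f) {p : N} {R r t : ℝ} (hR : 0 < R) (hrt : r < t)
    {x : Fin (k + 2) → ℝ} (hx : x ∈ timeChartBox p R r t) {m : ℕ} (η : DiffForm I M m) :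
    pullbackWithin (chartTrajectory φ t₀ f p)
      (Icc (Fin.cons r (halfBoxLower k R) : Fin (k + 2) → ℝ) (Fin.cons t (halfBoxUpper k R))) η x =
    (pullbackWithin (trajectory φ t₀ (f ∘ chartParam p))
      (univ ×ˢ Icc (halfBoxLower k R) (halfBoxUpper k R)) η
      (x 0, tailMap (k + 1) x)).compContinuousLinearMap (timeSplit (k + 1)) :=
  pullbackWithin_comp_linear (timeSplit (k + 1)) (uniqueDiffOn_Icc_pi (timeBox_lt hR hrt) x hx.1)
    timeSplit_mem (hφ.mdifferentiableWithinAt_trajectory t₀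
      (mdifferentiableWithinAt_comp_chartParam hf hx.2) (x 0)) η

theorem pullbackWithin_chartTrajectory_space (hφ : IsFlow V φ) (t₀ : ℝ) {f : N → M}
    (hf : ContMDiff (𝓡∂ (k + 1)) I 1 f) {p : N} {R r t : ℝ} (hR : 0 < R) (hrt : r < t)
    {x : Fin (k + 2) → ℝ} (hx : x ∈ timeChartBox p R r t) {m : ℕ} (η : DiffForm I M m)
    (w : Fin m → Fin (k + 1) → ℝ) :
    pullbackWithin (chartTrajectory φ t₀ f p)
      (Icc (Fin.cons r (halfBoxLower k R) : Fin (k + 2) → ℝ) (Fin.cons t (halfBoxUpper k R))) η x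
      (fun i => Fin.cons 0 (w i)) =
    pullbackWithin (chartParam p) (Icc (halfBoxLower k R) (halfBoxUpper k R))
      (pullback (J := 𝓡∂ (k + 1)) (φ (x 0) t₀ ∘ f) η) (tailMap (k + 1) x) w := by
  rw [pullbackWithin_chartTrajectory_eq hφ t₀ hf hR hrt hx,
    ← pullbackWithin_comp_chartParam ((hφ.contMDiff_map _ _).comp hf) hR hx.2]
  exact hφ.pullbackWithin_trajectory_space t₀
    (uniqueDiffOn_Icc_pi (halfBoxLower_lt hR) _ (chartBox_subset p R hx.2))
    (mdifferentiableWithinAt_comp_chartParam hf hx.2) (x 0) η w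

theorem pullbackWithin_chartTrajectory_time (hφ : IsFlow V φ) (t₀ : ℝ) {f : N → M}
    (hf : ContMDiff (𝓡∂ (k + 1)) I 1 f) {p : N} {R r t : ℝ} (hR : 0 < R) (hrt : r < t)
    {x : Fin (k + 2) → ℝ} (hx : x ∈ timeChartBox p R r t) {m : ℕ} (η : DiffForm I M (m + 1))
    (w : Fin m → Fin (k + 1) → ℝ) :
    pullbackWithin (chartTrajectory φ t₀ f p)
      (Icc (Fin.cons r (halfBoxLower k R) : Fin (k + 2) → ℝ) (Fin.cons t (halfBoxUpper k R))) η x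
      (Fin.cons (Fin.cons 1 0 : Fin (k + 2) → ℝ) fun i => Fin.cons 0 (w i)) =
    pullbackWithin (chartParam p) (Icc (halfBoxLower k R) (halfBoxUpper k R))
      (pullback (J := 𝓡∂ (k + 1)) (φ (x 0) t₀ ∘ f) (interiorProd (V (x 0)) η))
      (tailMap (k + 1) x) w := by
  rw [pullbackWithin_chartTrajectory_eq hφ t₀ hf hR hrt hx,
    ← pullbackWithin_comp_chartParam ((hφ.contMDiff_map _ _).comp hf) hR hx.2]
  refine Eq.trans (congrArg (pullbackWithin (trajectory φ t₀ (f ∘ chartParam p))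
    (univ ×ˢ Icc (halfBoxLower k R) (halfBoxUpper k R)) η (x 0, tailMap (k + 1) x))
    (funext fun i => ?_)) (hφ.pullbackWithin_trajectory_time t₀
    (chartBox_subset p R hx.2)
    (uniqueDiffOn_Icc_pi (halfBoxLower_lt hR) _ (chartBox_subset p R hx.2))
    (mdifferentiableWithinAt_comp_chartParam hf hx.2) (x 0) η w)
  refine Fin.cases ?_ (fun j => ?_) i
  · exact timeSplit_cons 1 0
  · exact timeSplit_cons 0 (w j)

variable [CompactSpace N] [T2Space N] [FiniteDimensional ℝ E] [IsManifold I ∞ M]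

/-- Stokes' theorem for the part of the flow tube which lies over the chart at `p`. The box has the
time as first coordinate, and the test function does not depend on the time. The contraction of the
pullback of a form with the time direction is the pullback of its interior product by `V`. The final
and the initial face give the difference on the right, and the face in the boundary of the half space
gives the boundary term. -/
theorem formTerm_sub_formTerm (hφ : IsFlow V φ) (t₀ : ℝ)
    {μ : DiffForm (𝓡∂ (k + 1)) N (k + 1)} (hμ : IsOrientationForm μ) {f : N → M}
    (hf : ContMDiff (𝓡∂ (k + 1)) I 1 f) {η : DiffForm I M (k + 1)} (hη : IsContDiffForm 1 η)
    (p : N) {r t : ℝ} (hrt : r < t) :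
    IntegrableOn (fun s =>
      formTerm μ (pullback (φ s t₀ ∘ f) (interiorProd (V s) (dForm η))) p
        - chartIntegral μ p (wedgeForm (chartPartition k N p)
            (pullback (φ s t₀ ∘ f) (interiorProd (V s) η)))
        + boundaryTerm μ (pullback (φ s t₀ ∘ f) (interiorProd (V s) η)) p) (Icc r t) ∧
    (∫ s in Icc r t, (formTerm μ (pullback (φ s t₀ ∘ f) (interiorProd (V s) (dForm η))) p
        - chartIntegral μ p (wedgeForm (chartPartition k N p)
            (pullback (φ s t₀ ∘ f) (interiorProd (V s) η)))
        + boundaryTerm μ (pullback (φ s t₀ ∘ f) (interiorProd (V s) η)) p)) =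
      formTerm μ (pullback (φ t t₀ ∘ f) η) p - formTerm μ (pullback (φ r t₀ ∘ f) η) p := by
  have _ : IsManifold I 1 M := IsManifold.of_le (n := ∞) (by exact_mod_cast le_top)
  obtain ⟨R, hR⟩ := exists_isLargeBox (k := k) p
  have hfs : ∀ s, ContMDiff (𝓡∂ (k + 1)) I 1 (φ s t₀ ∘ f) := fun s => (hφ.contMDiff_map _ _).comp hf
  set a := halfBoxLower k R with ha
  set b := halfBoxUpper k R with hb
  set A : Fin (k + 2) → ℝ := Fin.cons r a with hA
  set B : Fin (k + 2) → ℝ := Fin.cons t b with hB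
  set F := chartTrajectory (k := k) φ t₀ f p with hF
  set g := chartWeight μ p with hg
  set g' : (Fin (k + 2) → ℝ) → ℝ := g ∘ tailMap (k + 1) with hg'
  have hAB : ∀ i, A i < B i := timeBox_lt hR.1 hrt
  have hudAB := uniqueDiffOn_Icc_pi hAB
  have hud := uniqueDiffOn_Icc_pi (halfBoxLower_lt (k := k) hR.1)
  have htail : MapsTo (tailMap (k + 1)) (Icc A B) (Icc a b) := fun x hx => tailMap_mem_halfBox hx
  have hWI : timeChartBox p R r t ⊆ Icc A B := inter_subset_left
  have hW := timeChartBox_mem_nhdsWithin (k := k) p R r t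
  have hFs := contMDiffOn_chartTrajectory hφ t₀ hf p R r t
  have hgc : ContDiffOn ℝ 1 g (Icc a b) := contDiffOn_chartWeight hμ p R
  have hgv : VanishesOff (Icc a b) (chartBox p R) g := vanishesOff_chartWeight μ p R
  have hg'c : ContDiffOn ℝ 1 g' (Icc A B) :=
    hgc.comp (tailMap (k + 1)).contDiff.contDiffOn htail
  have hg'v : VanishesOff (Icc A B) (timeChartBox p R r t) g' := by
    intro x hx hxW
    have h1 := hgv (tailMap (k + 1) x) (htail hx) fun h => hxW ⟨hx, h⟩
    exact ((tailMap (k + 1)).continuous.continuousWithinAt.tendsto_nhdsWithin htail) h1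
  have hdg' : ∀ x ∈ Icc A B, fderivWithin ℝ g' (Icc A B) x =
      (fderivWithin ℝ g (Icc a b) (tailMap (k + 1) x)).comp (tailMap (k + 1)) := by
    intro x hx
    rw [hg', fderivWithin_comp x (hgc.differentiableOn one_ne_zero _ (htail hx))
      (tailMap (k + 1)).differentiableWithinAt htail (hudAB x hx),
      (tailMap (k + 1)).fderivWithin (hudAB x hx)]
  have hstokes := boxStokes_pullbackWithin hAB hWI hW hFs hη hg'c hg'v
  have hcη := continuousOn_pullbackWithin hudAB hWI hW hFs (hη.of_le zero_le_one)
  have hcdη := continuousOn_pullbackWithin hudAB hWI hW hFs hη.dForm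
  -- the integral over the flow tube
  have hΦc : ContinuousOn (fun x => g' x * pullbackWithin F (Icc A B) (dForm η) x (stdVec (k + 2)) +
      wedgeOne (fderivWithin ℝ g' (Icc A B) x) (pullbackWithin F (Icc A B) η x) (stdVec (k + 2)))
      (Icc A B) :=
    (continuousOn_mul_form hWI hW hcdη hg'c.continuousOn hg'v _).add
      (continuousOn_wedgeOne_fderivWithin hAB hWI hW hcη hg'c hg'v)
  have hΦ := continuousOn_box_fubini hΦc
  have hΦs : ∀ s ∈ Icc r t, (∫ v in Icc a b,
      (g' (Fin.cons s v) * pullbackWithin F (Icc A B) (dForm η) (Fin.cons s v) (stdVec (k + 2)) +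
      wedgeOne (fderivWithin ℝ g' (Icc A B) (Fin.cons s v))
        (pullbackWithin F (Icc A B) η (Fin.cons s v)) (stdVec (k + 2)))) =
      formTerm μ (pullback (φ s t₀ ∘ f) (interiorProd (V s) (dForm η))) p
        - chartIntegral μ p (wedgeForm (chartPartition k N p)
            (pullback (φ s t₀ ∘ f) (interiorProd (V s) η))) := by
    intro s hs
    have h1 := integral_box_split hμ
      ((hφ.isContDiffForm_interiorProd s hη.dForm).pullback (hfs s))
      ((hφ.isContDiffForm_interiorProd s (hη.of_le zero_le_one)).pullback (hfs s)) hR (-1)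
    rw [neg_one_mul, ← sub_eq_add_neg] at h1
    rw [← h1]
    refine setIntegral_congr_fun measurableSet_Icc fun v hv => ?_
    have hx : (Fin.cons s v : Fin (k + 2) → ℝ) ∈ Icc A B := by
      refine ⟨fun i => ?_, fun i => ?_⟩
      · exact Fin.cases hs.1 (fun j => hv.1 j) i
      · exact Fin.cases hs.2 (fun j => hv.2 j) i
    rw [hdg' _ hx, tailMap_cons]
    by_cases hvW : v ∈ chartBox p R
    · have hxW : (Fin.cons s v : Fin (k + 2) → ℝ) ∈ timeChartBox p R r t := ⟨hx, hvW⟩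
      rw [wedgeOne_comp_tailMap (pullbackWithin_chartTrajectory_time hφ t₀ hf hR.1 hrt hxW η),
        stdVec_eq_cons, pullbackWithin_chartTrajectory_time hφ t₀ hf hR.1 hrt hxW, neg_one_mul]
      rfl
    · have h2 : g' (Fin.cons s v) = 0 := hgv.eq_zero hv hvW
      have h3 : chartWeight μ p v = 0 := h2
      have h4 : fderivWithin ℝ g (Icc a b) v = 0 := hgv.fderivWithin_eq_zero hv hvW
      rw [h2, h3, h4, ContinuousLinearMap.zero_comp, wedgeOne_zero, wedgeOne_zero]
      simp
  -- the lateral face of the tube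
  have hΨc : ContinuousOn (fun x => g' x * pullbackWithin F (Icc A B) η x
      ((0 : Fin (k + 1)).succ.removeNth (stdVec (k + 2)))) (Icc A B) :=
    continuousOn_mul_form hWI hW hcη hg'c.continuousOn hg'v _
  have hA1 : A (0 : Fin (k + 1)).succ ∈ Icc (A (0 : Fin (k + 1)).succ) (B (0 : Fin (k + 1)).succ) :=
    ⟨le_rfl, (hAB _).le⟩
  have hΨ := continuousOn_box_fubini (continuousOn_face hΨc hA1)
  have hAs : (A ∘ (0 : Fin (k + 1)).succ.succAbove) ∘ Fin.succ = a ∘ Fin.succ := by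
    funext i
    simp only [Function.comp_apply, Fin.succ_succAbove_succ, Fin.zero_succAbove, hA, Fin.cons_succ]
  have hBs : (B ∘ (0 : Fin (k + 1)).succ.succAbove) ∘ Fin.succ = b ∘ Fin.succ := by
    funext i
    simp only [Function.comp_apply, Fin.succ_succAbove_succ, Fin.zero_succAbove, hB, Fin.cons_succ]
  have hA0 : (A ∘ (0 : Fin (k + 1)).succ.succAbove) 0 = r := by
    simp only [Function.comp_apply, Fin.succ_succAbove_zero, hA, Fin.cons_zero]
  have hB0 : (B ∘ (0 : Fin (k + 1)).succ.succAbove) 0 = t := by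
    simp only [Function.comp_apply, Fin.succ_succAbove_zero, hB, Fin.cons_zero]
  rw [hAs, hBs, hA0, hB0] at hΨ
  have hAa : A (0 : Fin (k + 1)).succ = 0 := rfl
  simp only [insertNth_one_cons, hAa] at hΨ
  have hΨs : ∀ s ∈ Icc r t, (∫ w in Icc (a ∘ Fin.succ) (b ∘ Fin.succ),
      g' (Fin.cons s (Fin.cons 0 w : Fin (k + 1) → ℝ)) *
      pullbackWithin F (Icc A B) η (Fin.cons s (Fin.cons 0 w : Fin (k + 1) → ℝ))
      ((0 : Fin (k + 1)).succ.removeNth (stdVec (k + 2)))) =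
      -boundaryTerm μ (pullback (φ s t₀ ∘ f) (interiorProd (V s) η)) p := by
    intro s hs
    rw [boundaryTerm, integral_chart_boundary_eq_integral_face μ _ hR, neg_neg]
    refine setIntegral_congr_fun measurableSet_Icc fun w hw => ?_
    have hv := cons_mem_halfBox hR.1.le hw
    have hx : (Fin.cons s (Fin.cons 0 w : Fin (k + 1) → ℝ) : Fin (k + 2) → ℝ) ∈ Icc A B := by
      refine ⟨fun i => ?_, fun i => ?_⟩
      · exact Fin.cases hs.1 (fun j => hv.1 j) i
      · exact Fin.cases hs.2 (fun j => hv.2 j) i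
    by_cases hvW : (Fin.cons 0 w : Fin (k + 1) → ℝ) ∈ chartBox p R
    · rw [removeNth_succ_stdVec, pullbackWithin_chartTrajectory_time hφ t₀ hf hR.1 hrt
        (x := Fin.cons s (Fin.cons 0 w : Fin (k + 1) → ℝ)) ⟨hx, hvW⟩]
      rfl
    · have h2 : g' (Fin.cons s (Fin.cons 0 w : Fin (k + 1) → ℝ)) = 0 := hgv.eq_zero hv hvW
      have h3 : chartWeight μ p (Fin.cons 0 w) = 0 := h2
      rw [h2, h3, zero_mul, zero_mul]
  -- the initial and final faces of the tube
  have hD : ∀ s ∈ Icc r t, (∫ v in Icc a b, g' (Fin.cons s v) *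
      pullbackWithin F (Icc A B) η (Fin.cons s v) ((0 : Fin (k + 2)).removeNth (stdVec (k + 2)))) =
      formTerm μ (pullback (φ s t₀ ∘ f) η) p := by
    intro s hs
    rw [formTerm, integral_chart_eq_integral_box μ _ hR]
    refine setIntegral_congr_fun measurableSet_Icc fun v hv => ?_
    have hx : (Fin.cons s v : Fin (k + 2) → ℝ) ∈ Icc A B := by
      refine ⟨fun i => ?_, fun i => ?_⟩
      · exact Fin.cases hs.1 (fun j => hv.1 j) i
      · exact Fin.cases hs.2 (fun j => hv.2 j) i
    by_cases hvW : v ∈ chartBox p R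
    · rw [removeNth_zero_stdVec, pullbackWithin_chartTrajectory_space hφ t₀ hf hR.1 hrt
        (x := Fin.cons s v) ⟨hx, hvW⟩]
      rfl
    · have h2 : g' (Fin.cons s v) = 0 := hgv.eq_zero hv hvW
      have h3 : chartWeight μ p v = 0 := h2
      rw [h2, h3, zero_mul, zero_mul]
  have hRabs : |R| = R := abs_of_pos hR.1
  have hface : ∀ (j : Fin (k + 1)) (c : ℝ), |c| = R → ∀ w : Fin (k + 1) → ℝ,
      g' (j.succ.insertNth c w : Fin (k + 2) → ℝ) = 0 := fun j c hc w =>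
    chartWeight_eq_zero_of_eq hR (i := j) (by
      have h1 : tailMap (k + 1) (j.succ.insertNth c w : Fin (k + 2) → ℝ) j = c :=
        Fin.insertNth_apply_same (α := fun _ => ℝ) j.succ c w
      rw [h1, hc])
  have hup : ∀ j : Fin (k + 1), |B j.succ| = R := fun j => hRabs
  have hlow : ∀ j : Fin k, |A j.succ.succ| = R := fun j => by
    have h1 : A j.succ.succ = -R := rfl
    rw [h1, abs_neg, hRabs]
  rw [BoxStokes, boxBoundary, Fin.sum_univ_succ, Fin.sum_univ_succ] at hstokes
  simp only [hface _ _ (hup _), hface _ _ (hlow _), zero_mul, mul_zero, integral_zero, sub_zero,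
    Finset.sum_const_zero, add_zero, zero_sub, Fin.val_zero, pow_zero, one_mul, Fin.val_succ,
    zero_add, pow_one, neg_one_mul, integral_neg, neg_neg, hAa] at hstokes
  have h0s : ∀ c : Fin (k + 2) → ℝ, c ∘ (0 : Fin (k + 2)).succAbove = c ∘ Fin.succ := fun c => by
    funext i
    simp
  have hI0 : ∀ (c : ℝ) (w : Fin (k + 1) → ℝ),
      ((0 : Fin (k + 2)).insertNth c w : Fin (k + 2) → ℝ) = Fin.cons c w :=
    fun c w => Fin.insertNth_zero' _ _
  simp only [h0s, hI0] at hstokes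
  have hAt : A ∘ Fin.succ = a := rfl
  have hBt : B ∘ Fin.succ = b := rfl
  have hA00 : A 0 = r := rfl
  have hB00 : B 0 = t := rfl
  rw [hAt, hBt, hA00, hB00] at hΦ
  rw [hAt, hBt, hA00, hB00, hD t ⟨hrt.le, le_rfl⟩, hD r ⟨le_rfl, hrt.le⟩, hΨ.2, hΦ.2,
    setIntegral_congr_fun measurableSet_Icc hΦs, setIntegral_congr_fun measurableSet_Icc hΨs]
    at hstokes
  have hi1 := hΦ.1.congr_fun hΦs measurableSet_Icc
  have hi2 := hΨ.1.congr_fun hΨs measurableSet_Icc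
  have hi3 : IntegrableOn (fun s => boundaryTerm μ
      (pullback (φ s t₀ ∘ f) (interiorProd (V s) η)) p) (Icc r t) := by
    simpa using hi2.neg
  refine ⟨hi1.add hi3, ?_⟩
  rw [integral_add hi1 hi3, hstokes, integral_neg]
  ring

end FlowStokes

/-! ### The flux of the Lagrangian form -/

section ActionFlux

variable {k : ℕ} {N : Type*} [TopologicalSpace N] [ChartedSpace (EuclideanHalfSpace (k + 1)) N]
  [CompactSpace N] [T2Space N] [IsManifold (𝓡∂ (k + 1)) ∞ N]
  {E : Type*} [NormedAddCommGroup E] [NormedSpace ℝ E] [FiniteDimensional ℝ E]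
  {H : Type*} [TopologicalSpace H] {I : ModelWithCorners ℝ E H}
  {M : Type*} [TopologicalSpace M] [ChartedSpace H M] [IsManifold I ∞ M]
  {V : ℝ → VField I M} {φ : ℝ → ℝ → M → M}

/-- Stokes' theorem for the potential `β` turns its flux into the integral of `dβ = i_V dα`. The terms
in which the partition of unity is differentiated add up to zero, both for `β` and for `i_V α`, so
that the flux of the Lagrangian form is the sum over the charts of the integrands of
`formTerm_sub_formTerm`. -/
theorem boundaryFormIntegral_lagrangianForm (hφ : IsFlow V φ) (t₀ : ℝ)
    {μ : DiffForm (𝓡∂ (k + 1)) N (k + 1)} (hμ : IsOrientationForm μ) {f : N → M}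
    (hf : ContMDiff (𝓡∂ (k + 1)) I 1 f) {α : DiffForm I M (k + 1)} (hα : IsContDiffForm 1 α)
    {β : DiffForm I M k} {s : ℝ} (hβ : IsLiouvillePotential (dForm α) (V s) β) :
    boundaryFormIntegral μ (pullback (φ s t₀ ∘ f) (lagrangianForm α (V s) β)) =
      ∑ p ∈ chartPoints k N,
        (formTerm μ (pullback (φ s t₀ ∘ f) (interiorProd (V s) (dForm α))) p
        - chartIntegral μ p (wedgeForm (chartPartition k N p)
            (pullback (φ s t₀ ∘ f) (interiorProd (V s) α)))
        + boundaryTerm μ (pullback (φ s t₀ ∘ f) (interiorProd (V s) α)) p) := by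
  have hfs : ContMDiff (𝓡∂ (k + 1)) I 1 (φ s t₀ ∘ f) := (hφ.contMDiff_map s t₀).comp hf
  have h1 : IsContDiffForm 0 (pullback (J := 𝓡∂ (k + 1)) (φ s t₀ ∘ f) (interiorProd (V s) α)) :=
    (hφ.isContDiffForm_interiorProd s (hα.of_le zero_le_one)).pullback hfs
  have h2 : IsContDiffForm 0 (pullback (J := 𝓡∂ (k + 1)) (φ s t₀ ∘ f) β) :=
    (hβ.1.of_le zero_le_one).pullback hfs
  have h3 : pullback (J := 𝓡∂ (k + 1)) (φ s t₀ ∘ f) (lagrangianForm α (V s) β) =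
      fun x => pullback (J := 𝓡∂ (k + 1)) (φ s t₀ ∘ f) (interiorProd (V s) α) x +
        pullback (J := 𝓡∂ (k + 1)) (φ s t₀ ∘ f) β x := rfl
  rw [boundaryFormIntegral_eq_sum, h3, Finset.sum_add_distrib, Finset.sum_sub_distrib,
    sum_chartIntegral_wedgeForm hμ h1, Finset.sum_congr rfl fun p _ => boundaryTerm_add hμ h1 h2 p,
    Finset.sum_add_distrib, Finset.sum_congr rfl fun p _ => (formTerm_dForm_add hμ hfs hβ.1 p).symm,
    Finset.sum_add_distrib, sum_chartIntegral_wedgeForm hμ h2, hβ.2]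
  ring

theorem intervalIntegrable_boundaryIntegral_and_integral_eq (hφ : IsFlow V φ) (t₀ : ℝ)
    (Γ : OrientedSubmanifold I M k N) {α : DiffForm I M (k + 1)} (hα : IsContDiffForm 1 α)
    {β : ℝ → DiffForm I M k} (hβ : ∀ s, IsLiouvillePotential (dForm α) (V s) (β s)) {r t : ℝ}
    (hrt : r < t) :
    IntervalIntegrable
        (fun s => (Γ.evolve hφ t₀ s).boundaryIntegral (lagrangianForm α (V s) (β s))) volume r t ∧
      (∫ s in r..t, (Γ.evolve hφ t₀ s).boundaryIntegral (lagrangianForm α (V s) (β s))) =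
        (Γ.evolve hφ t₀ t).integral α - (Γ.evolve hφ t₀ r).integral α := by
  have h1 : (fun s => (Γ.evolve hφ t₀ s).boundaryIntegral (lagrangianForm α (V s) (β s))) =
      fun s => ∑ p ∈ chartPoints k N,
        (formTerm Γ.orientation (pullback (φ s t₀ ∘ Γ.toFun) (interiorProd (V s) (dForm α))) p
        - chartIntegral Γ.orientation p (wedgeForm (chartPartition k N p)
            (pullback (φ s t₀ ∘ Γ.toFun) (interiorProd (V s) α)))
        + boundaryTerm Γ.orientation (pullback (φ s t₀ ∘ Γ.toFun) (interiorProd (V s) α)) p) :=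
    funext fun s => boundaryFormIntegral_lagrangianForm hφ t₀ Γ.isOrientationForm Γ.contMDiff hα
      (hβ s)
  have h2 := fun p : N =>
    formTerm_sub_formTerm hφ t₀ Γ.isOrientationForm Γ.contMDiff hα p hrt
  have h3 : ∀ s, (Γ.evolve hφ t₀ s).integral α = ∑ p ∈ chartPoints k N,
      formTerm Γ.orientation (pullback (φ s t₀ ∘ Γ.toFun) α) p :=
    fun s => formIntegral_eq_sum _ _
  rw [h1, intervalIntegrable_iff_integrableOn_Icc_of_le hrt.le, h3, h3, ← Finset.sum_sub_distrib,
    intervalIntegral.integral_of_le hrt.le, ← integral_Icc_eq_integral_Ioc]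
  refine ⟨integrable_finsetSum _ fun p _ => (h2 p).1, ?_⟩
  rw [integral_finsetSum _ fun p _ => (h2 p).1]
  exact Finset.sum_congr rfl fun p _ => (h2 p).2

end ActionFlux

end ActionFlux

end

theorem theorem1
    {k : ℕ}
    {E : Type*} [NormedAddCommGroup E] [NormedSpace ℝ E] (hE : Module.finrank ℝ E = k + 2)
    {H : Type*} [TopologicalSpace H] {I : ModelWithCorners ℝ E H}
    {M : Type*} [TopologicalSpace M] [ChartedSpace H M] [IsManifold I ∞ M]
    [T2Space M] [SecondCountableTopology M]
    {N : Type*} [TopologicalSpace N] [ChartedSpace (EuclideanHalfSpace (k + 1)) N]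
    [IsManifold (𝓡∂ (k + 1)) ∞ N] [CompactSpace N] [T2Space N]
    (Ω : DiffForm I M (k + 2)) (hΩ : IsVolumeForm Ω)
    (α : DiffForm I M (k + 1)) (hα : IsContDiffForm 1 α) (hΩα : Ω = dForm α)
    (V : ℝ → VField I M) (φ : ℝ → ℝ → M → M) (hφ : IsFlow V φ)
    (β : ℝ → DiffForm I M k) (hβ : ∀ t, IsLiouvillePotential Ω (V t) (β t))
    (A : Set (M × ℝ)) (hA : IsFlowInvariant φ A)
    (t₀ : ℝ) (Γ : OrientedSubmanifold I M k N) (hΓ : Γ.carrier = slice A t₀)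
    (r t : ℝ) :
    IntervalIntegrable
        (fun s => (Γ.evolve hφ t₀ s).boundaryIntegral (lagrangianForm α (V s) (β s))) volume r t ∧
      (Γ.evolve hφ t₀ t).integral α
        = (∫ s in r..t, (Γ.evolve hφ t₀ s).boundaryIntegral (lagrangianForm α (V s) (β s)))
          + (Γ.evolve hφ t₀ r).integral α := by
  have _ : FiniteDimensional ℝ E := Module.finite_of_finrank_pos (by omega)
  subst hΩα
  rcases lt_trichotomy r t with h | rfl | h
  · obtain ⟨h1, h2⟩ := intervalIntegrable_boundaryIntegral_and_integral_eq hφ t₀ Γ hα hβ h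
    exact ⟨h1, by rw [h2]; ring⟩
  · exact ⟨IntervalIntegrable.refl, by rw [intervalIntegral.integral_same, zero_add]⟩
  · obtain ⟨h1, h2⟩ := intervalIntegrable_boundaryIntegral_and_integral_eq hφ t₀ Γ hα hβ h
    exact ⟨h1.symm, by rw [intervalIntegral.integral_symm, h2]; ring⟩
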